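/- Throughout, $G$ is a finite simple graph drawn in the plane, and $m$ assigns an integer $m(e)\ge 0$ (the multiplicity) to every edge $e$; for $F\subseteq E(G)$ put $m(F)=\sum_{e\in F}m(e)$, and for $X\subseteq V(G)$ let $\delta(X)$ be the set of edges with exactly one end in $X$. The pair $(G,m)$ is an $8$-target if $m(\delta(\{v\}))=8$ for every vertex $v$ and $m(\delta(X))\ge 8$ for every $X\subseteq V(G)$ with $|X|$ odd. For a region $r$ (the unbounded one included), $C_r$ denotes its boundary (a cycle, when $G$ is two-connected), and the length of $r$ is the number of edges of $C_r$. A triangle $uvw$ is a region of length three with vertices $u,v,w$; a square $uvwx$ is a region of length four with vertices $u,v,w,x$ in order. Degrees are taken in the simple graph $G$. Two edges are disjoint if they have no common end. For an edge $e$ of $C_r$, the second region for $e$ is the region $r'\ne r$ incident with $e$. * $e$ is $i$-heavy for $r$ if $m(e)\ge i$, or $r'$ is a triangle $uvw$ with $e=uv$ and $m(uv)+\min(m(uw),m(vw))\ge i$. * $e$ is a door for $r$ if $m(e)=1$ and some edge $f$ incident with $r'$ and disjoint from $e$ has $m(f)=1$. * $r$ is big if there are at least four doors for $r$, and small otherwise.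 * $m^+(e)=m(e)$ if the second region for $e$ is big, and $m^+(e)=m(e)+1$ if it is small. Here, in each configuration below, the second region for $e$ is the region incident with $e$ other than the region listed in the configuration to which $e$ belongs. An $8$-target $(G,m)$ is prime if $m(e)>0$ for every edge $e$; $|V(G)|\ge 6$; $m(\delta(X))\ge 10$ for every $X\subseteq V(G)$ with $|X|$ odd and $|X|,|V(G)\setminus X|\neq 1$; $G$ is three-connected and $m(e)\le 6$ for every edge $e$; and $(G,m)$ contains none of the following (regions named in one configuration being distinct): * Conf(1): a triangle $uvw$ where $u,v$ both have degree three. * Conf(2): a triangle $uvw$ where $u$ has degree three and its third neighbour $x$ satisfies $m(ux)<m(uw)+m(vw)$. * Conf(3): two triangles $uvw,uwx$ with $m(uv)+m(uw)+m(vw)+m(ux)\ge 8$. * Conf(4): a square $uvwx$ where $m(uv)+m(vw)+m(ux)\ge 8$ and $(m(uv),m(vw),m(wx),m(ux))\ne(4,2,1,2)$. * Conf(5): two triangles $uvw,uwx$ where $m^+(uv)+m(uw)+m^+(wx)\ge 7$. * Conf(6): a square $uvwx$ where $m^+(uv)+m^+(wx)\ge 7$. * Conf(7): a triangle $uvw$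 with $m^+(uv)+m^+(uw)\ge 7$. * Conf(8): a triangle $uvw$ with $m(uv)=3$, $m(uw)=m(vw)=2$, such that the second region for one of $uv,uw,vw$ has no door disjoint from $uvw$ (that is, no door with no end in $\{u,v,w\}$). * Conf(9): a triangle $uvw$ with $m(uv)=m(uw)=m(vw)=2$, such that $u$ has degree at least four, and the second regions for $uv,uw$ each have at most one door, and no door that is disjoint from $uvw$. * Conf(10): a square $uvwx$ and a triangle $wxy$, where $m(uv)=m(wx)=m(xy)=2$ and $m(vw)=4$. * Conf(11): a square $uvwx$ and a triangle $wxy$, where $m(uv)\ge 3$, $m(wy)\ge 3$, $m(wx)=1$, $m(ux)\le 3$ and $m^+(xy)\ge 3$. * Conf(12): a square $uvwx$ and a triangle $wxy$, where $m^+(uv),m(vw)\ge 2$, $m(wx)=m(wy)=2$, $m(ux)\le 3$ and $m^+(xy)\ge 3$. * Conf(13): a region of length five, with edges $e_1,\dots,e_5$ in order, where $m(e_1)\ge\max(m(e_2),m(e_5))$, $m(e_1)+m(e_2)+m(e_3)\ge 8$ and $m^+(e_1)+m^+(e_4)\ge 7$. * Conf(14): a region $r$ and an edge $e$ of $C_r$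 such that $m^+(e)\ge 6$ and at most six edges of $C_r$ disjoint from $e$ are doors for $r$. * Conf(15): a region $r$ of length at least four and an edge $e$ of $C_r$ such that $m^+(e)\ge 4$ and every edge of $C_r$ disjoint from $e$ is $3$-heavy for $r$. * Conf(16): a region $r$, an edge $uv$ of $C_r$ and a triangle $uvw$ such that $m(uv)+m^+(uw)\ge 4$, $m(vw)\le m(uw)$, the second edge of $C_r$ incident with $u$ has multiplicity at most $m(uw)$, and every edge of $C_r$ not incident with $u$ is $3$-heavy for $r$. * Conf(17): a region $r$ of length at least five and an edge $e$ of $C_r$ such that $m^+(e)\ge 5$, every edge $f$ of $C_r$ disjoint from $e$ satisfies $m^+(f)\ge 2$, and at most one of these edges $f$ is not $3$-heavy for $r$. * Conf(18): a region $r$ of length at least four, an edge $uv$ of $C_r$ and a triangle $uvw$ such that $m^+(uw)+m(uv)\ge 5$, $m(vw)\le m(uw)$, the second edge of $C_r$ incident with $u$ has multiplicity at most $m(uw)$, and either (a) $m(uv)=3$, $uv$ is $5$-heavy for $r$, every edge $f$ of $C_r$ disjoint from $uv$ satisfies $m^+(f)\ge 2$, and at most one of them is not $3$-heavy for $r$;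 or (b) $m^+(f)\ge 2$ for every edge $f$ of $C_r$ not incident with $u$, and at most one such edge is not $3$-heavy for $r$. * Conf(19): a region $r$ of length at least five and an edge $e$ of $C_r$ such that $m^+(e)\ge 5$, every edge of $C_r$ disjoint from $e$ is $2$-heavy for $r$, and at most two of them are not $3$-heavy for $r$. **Theorem.** No $8$-target is prime. -/

import Mathlib

/-- A rotation system on a simple graph: a permutation of the darts (oriented edges) which, at every
vertex, permutes the darts leaving that vertex in one single cycle (their clockwise order). -/
structure RotationSystem {V : Type*} (G : SimpleGraph V) where
  /-- the next dart, in clockwise order, around the initial vertex of the dart -/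
  next : Equiv.Perm G.Dart
  fst_next : ∀ d, (next d).fst = d.fst
  sameCycle : ∀ d d' : G.Dart, d.fst = d'.fst → next.SameCycle d d'

namespace RotationSystem

variable {V : Type*} {G : SimpleGraph V} (R : RotationSystem G)

/-- Walking along the boundary of a region: traverse a dart, then turn into the next dart at its
terminal vertex. -/
def face : Equiv.Perm G.Dart :=
  (SimpleGraph.Dart.symm_involutive (G := G)).toPerm.trans R.next

/-- The regions (faces): the orbits of the boundary walk. -/
def Region : Type _ := Quotient (Equiv.Perm.SameCycle.setoid R.face)

/-- The region on the side of the dart `d`; the region across the edge of `d` is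
`R.side d.symm`. -/
def side (d : G.Dart) : R.Region := Quotient.mk (Equiv.Perm.SameCycle.setoid R.face) d

/-- The surface obtained by gluing a disc to each boundary walk is a sphere. This is expressed by
the Jordan curve property: every cycle of `G` separates the regions into two classes, so that the
edges with one side in each class are exactly the edges of the cycle. -/
def IsSpherical : Prop :=
  ∀ (v : V) (c : G.Walk v v), c.IsCycle →
    ∃ S : Set R.Region, ∀ d : G.Dart,
      d.edge ∈ c.edges ↔ ¬ (R.side d ∈ S ↔ R.side d.symm ∈ S)

end RotationSystem

/-- A connected simple graph drawn in the plane (equivalently, on the sphere), given as a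
combinatorial map: the clockwise order of the edges around each vertex, with spherical surface.
The unbounded region is a region like any other. -/
structure PlaneGraph (V : Type*) where
  graph : SimpleGraph V
  connected : graph.Connected
  rot : RotationSystem graph
  spherical : rot.IsSpherical

/-- Three-connectedness: at least four vertices, and no set of at most two vertices whose deletion
disconnects the graph. -/
def ThreeConnected {V : Type*} (G : SimpleGraph V) : Prop :=
  4 ≤ Nat.card V ∧ ∀ Z : Set V, Z.ncard ≤ 2 → (G.induce Zᶜ).Connected

/-- The set of edges of `G` with exactly one end in `X`. -/
def cutEdges {V : Type*} (G : SimpleGraph V) (X : Set V) : Set (Sym2 V) :=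
  {e | ∃ a b, G.Adj a b ∧ a ∈ X ∧ b ∉ X ∧ e = s(a, b)}

/-- The total multiplicity of a set of edges. -/
noncomputable def totalMult {V : Type*} [Finite V] (m : Sym2 V → ℕ) (F : Set (Sym2 V)) : ℕ :=
  ∑ e ∈ F.toFinite.toFinset, m e

/-- `(P, m)` is a `d`-target. Only the values of `m` at edges of the graph are ever used. -/
structure IsTarget {V : Type*} [Finite V] (d : ℕ) (P : PlaneGraph V) (m : Sym2 V → ℕ) : Prop where
  regular : ∀ v, totalMult m (cutEdges P.graph {v}) = d
  oddCut : ∀ X : Set V, Odd X.ncard → d ≤ totalMult m (cutEdges P.graph X)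

/-- Two edges are disjoint if no vertex is an end of both of them. -/
def EdgeDisjoint {V : Type*} (e f : Sym2 V) : Prop := ∀ v, ¬ (v ∈ e ∧ v ∈ f)

namespace PlaneGraph

variable {V : Type*} (P : PlaneGraph V)

/-- The regions of the drawing. -/
abbrev Region : Type _ := P.rot.Region

/-- The edges incident with the region `r`, that is, the edges of its boundary `C_r`. -/
def bd (r : P.Region) : Set (Sym2 V) := {e | ∃ d : P.graph.Dart, P.rot.side d = r ∧ d.edge = e}

/-- The length of a region. -/
noncomputable def length (r : P.Region) : ℕ := (P.bd r).ncard

/-- The degree of a vertex in the (simple) graph. -/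
noncomputable def deg (v : V) : ℕ := (P.graph.neighborSet v).ncard

/-- `r'` is the second region for the edge `e` of `C_r`. -/
def IsSecond (r : P.Region) (e : Sym2 V) (r' : P.Region) : Prop :=
  e ∈ P.bd r ∧ e ∈ P.bd r' ∧ r' ≠ r

/-- The region `r` is a triangle `uvw`. -/
def IsTriangle (r : P.Region) (u v w : V) : Prop :=
  P.length r = 3 ∧ P.bd r = {s(u, v), s(v, w), s(w, u)}

/-- The region `r` is a square with vertices `u, v, w, x` in order. -/
def IsSquare (r : P.Region) (u v w x : V) : Prop :=
  P.length r = 4 ∧ P.bd r = {s(u, v), s(v, w), s(w, x), s(x, u)}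

/-- The region `r` has length five, with vertices `v₁, …, v₅` in order. -/
def IsPentagon (r : P.Region) (v₁ v₂ v₃ v₄ v₅ : V) : Prop :=
  P.length r = 5 ∧ P.bd r = {s(v₁, v₂), s(v₂, v₃), s(v₃, v₄), s(v₄, v₅), s(v₅, v₁)}

variable (m : Sym2 V → ℕ)

/-- The edge `e` is `i`-heavy for the region `r`. -/
def Heavy (i : ℕ) (r : P.Region) (e : Sym2 V) : Prop :=
  i ≤ m e ∨ ∃ r' u v w, P.IsSecond r e r' ∧ P.IsTriangle r' u v w ∧ e = s(u, v) ∧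
    i ≤ m s(u, v) + min (m s(u, w)) (m s(v, w))

/-- The edge `e` is a door for the region `r`. -/
def Door (r : P.Region) (e : Sym2 V) : Prop :=
  e ∈ P.bd r ∧ m e = 1 ∧ ∃ r', P.IsSecond r e r' ∧ ∃ f ∈ P.bd r', EdgeDisjoint e f ∧ m f = 1

/-- A region is big if there are at least four doors for it. -/
def Big (r : P.Region) : Prop := 4 ≤ {e | P.Door m r e}.ncard

/-- A region is small if it is not big. -/
def Small (r : P.Region) : Prop := ¬ P.Big m r

open Classical in
/-- `m⁺(e)`, where `e` is an edge of `C_r` and the region on the far side of `e` from `r` is its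
second region: `m(e) + 1` if that second region is small, and `m(e)` if it is big. -/
noncomputable def mp (r : P.Region) (e : Sym2 V) : ℕ :=
  if ∃ r', P.IsSecond r e r' ∧ P.Small m r' then m e + 1 else m e

/-- There is no door for `r` that is disjoint from the triangle `uvw`. -/
def NoDoorOff (r : P.Region) (u v w : V) : Prop :=
  ¬ ∃ f, P.Door m r f ∧ u ∉ f ∧ v ∉ f ∧ w ∉ f

def Conf1 : Prop := ∃ r u v w, P.IsTriangle r u v w ∧ P.deg u = 3 ∧ P.deg v = 3

def Conf2 : Prop := ∃ r u v w x, P.IsTriangle r u v w ∧ P.deg u = 3 ∧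
  P.graph.Adj u x ∧ x ≠ v ∧ x ≠ w ∧ m s(u, x) < m s(u, w) + m s(v, w)

def Conf3 : Prop := ∃ r r' u v w x, r ≠ r' ∧ P.IsTriangle r u v w ∧ P.IsTriangle r' u w x ∧
  8 ≤ m s(u, v) + m s(u, w) + m s(v, w) + m s(u, x)

def Conf4 : Prop := ∃ r u v w x, P.IsSquare r u v w x ∧
  8 ≤ m s(u, v) + m s(v, w) + m s(u, x) ∧
  (m s(u, v), m s(v, w), m s(w, x), m s(u, x)) ≠ (4, 2, 1, 2)

def Conf5 : Prop := ∃ r r' u v w x, r ≠ r' ∧ P.IsTriangle r u v w ∧ P.IsTriangle r' u w x ∧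
  7 ≤ P.mp m r s(u, v) + m s(u, w) + P.mp m r' s(w, x)

def Conf6 : Prop := ∃ r u v w x, P.IsSquare r u v w x ∧
  7 ≤ P.mp m r s(u, v) + P.mp m r s(w, x)

def Conf7 : Prop := ∃ r u v w, P.IsTriangle r u v w ∧
  7 ≤ P.mp m r s(u, v) + P.mp m r s(u, w)

def Conf8 : Prop := ∃ r u v w, P.IsTriangle r u v w ∧
  m s(u, v) = 3 ∧ m s(u, w) = 2 ∧ m s(v, w) = 2 ∧
  ∃ e ∈ P.bd r, ∃ r', P.IsSecond r e r' ∧ P.NoDoorOff m r' u v w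

def Conf9 : Prop := ∃ r u v w, P.IsTriangle r u v w ∧
  m s(u, v) = 2 ∧ m s(u, w) = 2 ∧ m s(v, w) = 2 ∧ 4 ≤ P.deg u ∧
  ∃ r₁ r₂, P.IsSecond r s(u, v) r₁ ∧ P.IsSecond r s(u, w) r₂ ∧
    {f | P.Door m r₁ f}.ncard ≤ 1 ∧ P.NoDoorOff m r₁ u v w ∧
    {f | P.Door m r₂ f}.ncard ≤ 1 ∧ P.NoDoorOff m r₂ u v w

def Conf10 : Prop := ∃ r r' u v w x y, P.IsSquare r u v w x ∧ P.IsTriangle r' w x y ∧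
  m s(u, v) = 2 ∧ m s(w, x) = 2 ∧ m s(x, y) = 2 ∧ m s(v, w) = 4

def Conf11 : Prop := ∃ r r' u v w x y, P.IsSquare r u v w x ∧ P.IsTriangle r' w x y ∧
  3 ≤ m s(u, v) ∧ 3 ≤ m s(w, y) ∧ m s(w, x) = 1 ∧ m s(u, x) ≤ 3 ∧ 3 ≤ P.mp m r' s(x, y)

def Conf12 : Prop := ∃ r r' u v w x y, P.IsSquare r u v w x ∧ P.IsTriangle r' w x y ∧
  2 ≤ P.mp m r s(u, v) ∧ 2 ≤ m s(v, w) ∧ m s(w, x) = 2 ∧ m s(w, y) = 2 ∧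
  m s(u, x) ≤ 3 ∧ 3 ≤ P.mp m r' s(x, y)

def Conf13 : Prop := ∃ r v₁ v₂ v₃ v₄ v₅, P.IsPentagon r v₁ v₂ v₃ v₄ v₅ ∧
  max (m s(v₂, v₃)) (m s(v₅, v₁)) ≤ m s(v₁, v₂) ∧
  8 ≤ m s(v₁, v₂) + m s(v₂, v₃) + m s(v₃, v₄) ∧
  7 ≤ P.mp m r s(v₁, v₂) + P.mp m r s(v₄, v₅)

def Conf14 : Prop := ∃ r, ∃ e ∈ P.bd r, 6 ≤ P.mp m r e ∧
  {f | P.Door m r f ∧ EdgeDisjoint e f}.ncard ≤ 6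

def Conf15 : Prop := ∃ r, 4 ≤ P.length r ∧ ∃ e ∈ P.bd r, 4 ≤ P.mp m r e ∧
  ∀ f ∈ P.bd r, EdgeDisjoint e f → P.Heavy m 3 r f

/-- `r` is a region with an edge `uv` of `C_r`, and `r'` is a triangle `uvw` on the other side of
`uv`, where neither `vw` nor the second edge of `C_r` incident with `u` has multiplicity larger than
that of `uw`. -/
def Attached (r r' : P.Region) (u v w : V) : Prop :=
  P.IsSecond r s(u, v) r' ∧ P.IsTriangle r' u v w ∧ m s(v, w) ≤ m s(u, w) ∧
  ∀ f ∈ P.bd r, u ∈ f → f ≠ s(u, v) → m f ≤ m s(u, w)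

def Conf16 : Prop := ∃ r r' u v w, P.Attached m r r' u v w ∧
  4 ≤ m s(u, v) + P.mp m r' s(u, w) ∧
  ∀ f ∈ P.bd r, u ∉ f → P.Heavy m 3 r f

def Conf17 : Prop := ∃ r, 5 ≤ P.length r ∧ ∃ e ∈ P.bd r, 5 ≤ P.mp m r e ∧
  (∀ f ∈ P.bd r, EdgeDisjoint e f → 2 ≤ P.mp m r f) ∧
  {f | f ∈ P.bd r ∧ EdgeDisjoint e f ∧ ¬ P.Heavy m 3 r f}.ncard ≤ 1

def Conf18 : Prop := ∃ r r' u v w, 4 ≤ P.length r ∧ P.Attached m r r' u v w ∧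
  5 ≤ P.mp m r' s(u, w) + m s(u, v) ∧
  ((m s(u, v) = 3 ∧ P.Heavy m 5 r s(u, v) ∧
      (∀ f ∈ P.bd r, EdgeDisjoint s(u, v) f → 2 ≤ P.mp m r f) ∧
      {f | f ∈ P.bd r ∧ EdgeDisjoint s(u, v) f ∧ ¬ P.Heavy m 3 r f}.ncard ≤ 1) ∨
    ((∀ f ∈ P.bd r, u ∉ f → 2 ≤ P.mp m r f) ∧
      {f | f ∈ P.bd r ∧ u ∉ f ∧ ¬ P.Heavy m 3 r f}.ncard ≤ 1))

def Conf19 : Prop := ∃ r, 5 ≤ P.length r ∧ ∃ e ∈ P.bd r, 5 ≤ P.mp m r e ∧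
  (∀ f ∈ P.bd r, EdgeDisjoint e f → P.Heavy m 2 r f) ∧
  {f | f ∈ P.bd r ∧ EdgeDisjoint e f ∧ ¬ P.Heavy m 3 r f}.ncard ≤ 2

end PlaneGraph

/-- The 8-target `(P, m)` is prime. -/
structure IsPrimeTarget {V : Type*} [Finite V] (P : PlaneGraph V) (m : Sym2 V → ℕ) : Prop where
  target : IsTarget 8 P m
  mult_pos : ∀ e ∈ P.graph.edgeSet, 0 < m e
  six_le_card : 6 ≤ Nat.card V
  oddCut : ∀ X : Set V, Odd X.ncard → X.ncard ≠ 1 → Xᶜ.ncard ≠ 1 →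
    10 ≤ totalMult m (cutEdges P.graph X)
  threeConnected : ThreeConnected P.graph
  mult_le : ∀ e ∈ P.graph.edgeSet, m e ≤ 6
  not_conf1 : ¬ P.Conf1
  not_conf2 : ¬ P.Conf2 m
  not_conf3 : ¬ P.Conf3 m
  not_conf4 : ¬ P.Conf4 m
  not_conf5 : ¬ P.Conf5 m
  not_conf6 : ¬ P.Conf6 m
  not_conf7 : ¬ P.Conf7 m
  not_conf8 : ¬ P.Conf8 m
  not_conf9 : ¬ P.Conf9 m
  not_conf10 : ¬ P.Conf10 m
  not_conf11 : ¬ P.Conf11 m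
  not_conf12 : ¬ P.Conf12 m
  not_conf13 : ¬ P.Conf13 m
  not_conf14 : ¬ P.Conf14 m
  not_conf15 : ¬ P.Conf15 m
  not_conf16 : ¬ P.Conf16 m
  not_conf17 : ¬ P.Conf17 m
  not_conf18 : ¬ P.Conf18 m
  not_conf19 : ¬ P.Conf19 m

/-! The proof is by discharging. Give a region `r` the charge 16 − Σ (8 − 2m(e)), summed over the
edges of `C_r`. Every edge borders two regions and the multiplicities at a vertex add up to eight,
so the charges total 16(V − E + F), which is positive by Euler's inequality (`euler`). Moving charge
across edges antisymmetrically (`beta`) keeps the total, so some region ends with positive charge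
(`exists_positive_region`). In a prime target no region does (`sixteen_le_sum_toll`); this is the
contradiction.

After the exchange the charge of `r` is 16 − Σ `toll`, with `toll` equal to 8 − 2m − `beta`; a
positive `beta m d` therefore adds to the charge of the region on the side of `d`. Positive charge
moves in two ways. A big region takes `out` from each small neighbour, in two parts (`share`)
belonging to the two ends of the edge. Between two small regions, a triangle whose multiplicities
and surroundings occur in the list `senders` passes charge to the region across (`recvD`).

Big regions can absorb this because of their doors. Grouped by corners, the tolls yield at least
four per door, or two per door when there are at least eight doors (`big_region`).

For small regions the problem is made finite. Each edge is described by an `EdgeData` record from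
the list `all`, which is complete because `conf14` bounds `m⁺` by five (`pm_le_five`,
`exists_sees`). Consecutive records are compatible (`Sees.fits`), and a record together with its two
neighbours bounds the toll from below (`Sees.cost_le`). For triangles, squares, and regions of
length five with exactly two edges that are not `3`-heavy, the forbidden configurations become
Boolean tests on records, and exhaustive searches (`check1`, `check3`, `check4`, `check5`) show that
every record pattern passing the tests has total toll at least 16.

In the other regions of length at least five, call an edge light if it is not `3`-heavy. Light edges
take at least four each and the rest is nonnegative, so four light edges suffice. With at most
three, `conf15` to `conf19` control where light edges can lie relative to edges with large `m⁺`, and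
the missing excess is found by hand (`sum_of_zero`, `sum_of_one`, `sum_of_two`, `sum_of_three`).

Of plane topology only the Jordan property is used. It gives Euler's inequality, and together with
three-connectivity it shows that an edge has two different sides and that a boundary walk passes
each vertex at most once (`side_symm_ne`, `eq_of_side_of_fst`). -/

namespace PlaneGraph

/-! ### Darts around a vertex and boundary walks. -/

variable {V : Type*} (P : PlaneGraph V)

/-- The rotation at the initial vertices of the darts. -/
abbrev nx : Equiv.Perm P.graph.Dart := P.rot.next

/-- The boundary walk. -/
abbrev fc : Equiv.Perm P.graph.Dart := P.rot.face

/-- The region on the side of a dart. -/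
abbrev side (d : P.graph.Dart) : P.Region := P.rot.side d

theorem fc_apply (d : P.graph.Dart) : P.fc d = P.nx d.symm := rfl

theorem fc_symm (d : P.graph.Dart) : P.fc d.symm = P.nx d := by
  rw [fc_apply, SimpleGraph.Dart.symm_symm]

@[simp] theorem nx_fst (d : P.graph.Dart) : (P.nx d).fst = d.fst := P.rot.fst_next d

@[simp] theorem nx_inv_fst (d : P.graph.Dart) : (P.nx.symm d).fst = d.fst := by
  have := P.nx_fst (P.nx.symm d)
  rw [Equiv.apply_symm_apply] at this
  exact this.symm

@[simp] theorem fc_fst (d : P.graph.Dart) : (P.fc d).fst = d.snd := P.nx_fst d.symm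

theorem fc_inv_apply (d : P.graph.Dart) : P.fc.symm d = (P.nx.symm d).symm := by
  rw [Equiv.symm_apply_eq, fc_symm, Equiv.apply_symm_apply]

@[simp] theorem fc_inv_snd (d : P.graph.Dart) : (P.fc.symm d).snd = d.fst := by
  rw [fc_inv_apply]
  exact P.nx_inv_fst d

theorem side_eq_iff {d e : P.graph.Dart} : P.side d = P.side e ↔ P.fc.SameCycle d e :=
  Quotient.eq (r := Equiv.Perm.SameCycle.setoid P.rot.face)

@[simp] theorem side_fc (d : P.graph.Dart) : P.side (P.fc d) = P.side d := by
  rw [side_eq_iff]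
  exact (Equiv.Perm.SameCycle.refl _ _).apply_left

@[simp] theorem side_fc_inv (d : P.graph.Dart) : P.side (P.fc.symm d) = P.side d := by
  conv_rhs => rw [← Equiv.apply_symm_apply P.fc d]
  rw [side_fc]

@[simp] theorem side_nx (d : P.graph.Dart) : P.side (P.nx d) = P.side d.symm := by
  rw [← fc_symm, side_fc]

theorem exists_side (r : P.Region) : ∃ d, P.side d = r := Quotient.exists_rep r

theorem mem_bd {r : P.Region} {d : P.graph.Dart} :
    d.edge ∈ P.bd r ↔ P.side d = r ∨ P.side d.symm = r := by
  constructor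
  · rintro ⟨d', hd', he⟩
    rcases (SimpleGraph.dart_edge_eq_iff _ _).1 he with rfl | rfl
    · exact Or.inl hd'
    · exact Or.inr hd'
  · rintro (h | h)
    · exact ⟨d, h, rfl⟩
    · exact ⟨d.symm, h, d.edge_symm⟩

theorem edge_eq (d : P.graph.Dart) : d.edge = s(d.fst, d.snd) := rfl

theorem mem_edge {d : P.graph.Dart} {v : V} : v ∈ d.edge ↔ v = d.fst ∨ v = d.snd := by
  rw [edge_eq, Sym2.mem_iff]

theorem dart_ext {d e : P.graph.Dart} (h₁ : d.fst = e.fst) (h₂ : d.snd = e.snd) : d = e :=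
  SimpleGraph.Dart.ext _ _ (Prod.ext h₁ h₂)

theorem edge_inj_of_fst {d e : P.graph.Dart} (h₁ : d.fst = e.fst) (h : d.edge = e.edge) :
    d = e := by
  rcases (SimpleGraph.dart_edge_eq_iff _ _).1 h with rfl | rfl
  · rfl
  · exact absurd (h₁.symm) e.adj.ne

/-- Two darts at the same vertex lie on a cycle that uses no other edge at this vertex, and so
some set of regions is separated exactly by them around this vertex. -/
theorem exists_separation (h3 : ThreeConnected P.graph) {a b : P.graph.Dart}
    (hv : a.fst = b.fst) (hab : a ≠ b) :
    ∃ S : Set P.Region, ∀ d : P.graph.Dart, d.fst = a.fst →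
      ((d = a ∨ d = b) ↔ ¬ (P.side d ∈ S ↔ P.side d.symm ∈ S)) := by
  classical
  set v := a.fst with hv'
  -- Deleting `v` leaves a connected graph, so the far ends of `a` and `b` are joined by a path that
  -- misses `v`; closing it through `v` gives the cycle.
  have hc := h3.2 {v} (by simp)
  have ha : a.snd ∈ ({v} : Set V)ᶜ := by
    simp only [Set.mem_compl_iff, Set.mem_singleton_iff]
    exact a.adj.ne'
  have hb : b.snd ∈ ({v} : Set V)ᶜ := by
    simp only [Set.mem_compl_iff, Set.mem_singleton_iff, hv]
    exact b.adj.ne'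
  obtain ⟨p, hp⟩ := hc.exists_isPath ⟨a.snd, ha⟩ ⟨b.snd, hb⟩
  let f : P.graph.induce ({v} : Set V)ᶜ →g P.graph := (SimpleGraph.Embedding.induce _).toHom
  have hfinj : Function.Injective f := Subtype.val_injective
  have hq : (p.map f).IsPath := SimpleGraph.Walk.IsPath.map hfinj hp
  have hvq : v ∉ (p.map f).support := by
    rw [SimpleGraph.Walk.support_map]
    intro h
    obtain ⟨x, _, hx⟩ := List.mem_map.1 h
    exact x.2 hx
  let q : P.graph.Walk a.snd b.snd := p.map f
  change q.IsPath at hq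
  change v ∉ q.support at hvq
  have hbv : P.graph.Adj b.snd v := by
    rw [hv]; exact b.adj.symm
  have hq' : (q.concat hbv).IsPath := hq.concat hvq hbv
  have hav : P.graph.Adj v a.snd := a.adj
  have hcyc : (SimpleGraph.Walk.cons hav (q.concat hbv)).IsCycle := by
    rw [SimpleGraph.Walk.cons_isCycle_iff]
    refine ⟨hq', ?_⟩
    rw [SimpleGraph.Walk.edges_concat, List.concat_eq_append, List.mem_append, List.mem_singleton]
    rintro (h | h)
    · exact hvq (SimpleGraph.Walk.fst_mem_support_of_mem_edges _ h)
    · apply hab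
      apply P.edge_inj_of_fst hv
      rw [P.edge_eq a, P.edge_eq b, ← hv, Sym2.eq_swap (a := v) (b := b.snd)]
      exact h
  obtain ⟨S, hS⟩ := P.spherical v _ hcyc
  refine ⟨S, fun d hd => ?_⟩
  change _ ↔ ¬ (P.rot.side d ∈ S ↔ P.rot.side d.symm ∈ S)
  rw [← hS d]
  rw [SimpleGraph.Walk.edges_cons, SimpleGraph.Walk.edges_concat, List.mem_cons,
    List.concat_eq_append, List.mem_append, List.mem_singleton]
  have e1 : d.edge = s(v, a.snd) ↔ d = a :=
    ⟨fun h => P.edge_inj_of_fst hd h, fun h => by rw [h]; rfl⟩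
  have e2 : d.edge = s(b.snd, v) ↔ d = b := by
    refine ⟨fun h => P.edge_inj_of_fst (hd.trans hv) ?_, fun h => ?_⟩
    · rw [h, P.edge_eq b, ← hv, Sym2.eq_swap]
    · rw [h, P.edge_eq b, ← hv, Sym2.eq_swap]
  have e3 : d.edge ∉ q.edges := by
    intro h
    apply hvq
    rw [← hd]
    exact SimpleGraph.Walk.fst_mem_support_of_mem_edges _ h
  rw [e1, e2]
  tauto

/-- The set of darts at a vertex is the orbit of any of them under the rotation. -/
theorem nx_orbit [Finite V] {a b : P.graph.Dart} (h : a.fst = b.fst) :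
    ∃ n : ℕ, (P.nx ^ n) a = b := by
  classical
  have : Fintype V := Fintype.ofFinite V
  obtain ⟨n, hn⟩ := (P.rot.sameCycle a b h).exists_pow_eq''
  exact ⟨n, hn.2.2⟩

theorem exists_walk_step {W : Set V} {x : V} (hx : x ∈ W) (hc : (P.graph.induce W).Connected)
    {y : V} (hy : y ∈ W) (hxy : x ≠ y) : ∃ z ∈ W, P.graph.Adj x z := by
  obtain ⟨p⟩ := hc.preconnected ⟨x, hx⟩ ⟨y, hy⟩
  cases p with
  | nil => exact absurd rfl hxy
  | @cons _ z _ h q => exact ⟨z.1, z.2, h⟩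

/-- Three-connectivity enters here as minimum degree three. This rules out fixed points and
two-cycles of the rotation. -/
theorem exists_other_neighbour [Finite V] (h3 : ThreeConnected P.graph) (x : V) (Z : Set V)
    (hZ : Z.ncard ≤ 2) (hx : x ∉ Z) : ∃ d : P.graph.Dart, d.fst = x ∧ d.snd ∉ Z := by
  have hc := h3.2 Z hZ
  have : ∃ y, y ∉ Z ∧ x ≠ y := by
    by_contra! hno
    have hsub : (Set.univ : Set V) ⊆ insert x Z := by
      intro y _
      by_cases hy : y ∈ Z
      · exact Or.inr hy
      · exact Or.inl (hno y hy).symm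
    have h1 := Set.ncard_le_ncard hsub (Set.toFinite _)
    have h2 := Set.ncard_insert_le x Z
    rw [Set.ncard_univ] at h1
    have := h3.1
    omega
  obtain ⟨y, hy, hxy⟩ := this
  obtain ⟨z, hz, hadj⟩ := P.exists_walk_step (W := Zᶜ) hx hc hy hxy
  exact ⟨⟨(x, z), hadj⟩, rfl, hz⟩

theorem nx_ne [Finite V] (h3 : ThreeConnected P.graph) (d : P.graph.Dart) : P.nx d ≠ d := by
  intro h
  obtain ⟨e, he, hne⟩ := P.exists_other_neighbour h3 d.fst {d.snd} (by simp) (by simp [d.adj.ne])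
  obtain ⟨n, hn⟩ := P.nx_orbit he.symm
  rw [Equiv.Perm.pow_apply_eq_self_of_apply_eq_self h] at hn
  exact hne (by rw [← hn]; rfl)

theorem nx_nx_ne [Finite V] (h3 : ThreeConnected P.graph) (d : P.graph.Dart) :
    P.nx (P.nx d) ≠ d := by
  intro h
  have hd : d.fst ≠ (P.nx d).snd := by
    rw [← P.nx_fst d]
    exact (P.nx d).adj.ne
  obtain ⟨e, he, hne⟩ := P.exists_other_neighbour h3 d.fst {d.snd, (P.nx d).snd}
    ((Set.ncard_insert_le _ _).trans (by simp)) (by simp [d.adj.ne, hd])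
  obtain ⟨n, hn⟩ := P.nx_orbit he.symm
  rcases Equiv.Perm.pow_apply_eq_of_apply_apply_eq_self h n with h' | h' <;> rw [hn] at h' <;>
    simp [h'] at hne

/-- Some cycle uses the edge of `d`, and it separates the two sides. Any second dart at the vertex
would do for `exists_separation`; `P.nx d` is at hand. -/
theorem side_symm_ne [Finite V] (h3 : ThreeConnected P.graph) (d : P.graph.Dart) :
    P.side d ≠ P.side d.symm := by
  intro h
  obtain ⟨S, hS⟩ := P.exists_separation h3 (a := d) (b := P.nx d) (by simp) (P.nx_ne h3 d).symm
  have := (hS d rfl).1 (Or.inl rfl)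
  rw [h] at this
  exact this Iff.rfl

/-- The boundary walk of a region passes every vertex at most once. -/
theorem eq_of_side_of_fst [Finite V] (h3 : ThreeConnected P.graph) {a b : P.graph.Dart}
    (hs : P.side a = P.side b) (hv : a.fst = b.fst) : a = b := by
  classical
  by_contra hab
  obtain ⟨S, hS⟩ := P.exists_separation h3 hv hab
  have hex := P.nx_orbit hv
  set n := Nat.find hex with hn
  have hnb : (P.nx ^ n) a = b := Nat.find_spec hex
  have hmin : ∀ k < n, (P.nx ^ k) a ≠ b := fun k hk => Nat.find_min hex hk
  have hfst : ∀ k : ℕ, ((P.nx ^ k) a).fst = a.fst := by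
    intro k
    induction k with
    | zero => rfl
    | succ k ih => rw [pow_succ', Equiv.Perm.mul_apply, nx_fst, ih]
  have hstep : ∀ k : ℕ, (P.side ((P.nx ^ (k + 1)) a) ∈ S ↔ P.side ((P.nx ^ k) a).symm ∈ S) := by
    intro k
    rw [pow_succ', Equiv.Perm.mul_apply, side_nx]
  have hn0 : n ≠ 0 := by
    intro h0
    rw [h0] at hnb
    exact hab hnb
  -- Turn around the vertex from `a`. Consecutive darts border a common region, membership in `S`
  -- changes when `a` is crossed and, by minimality of `n`, not again before `b` is reached. So the
  -- sides of `a` and `b` lie in different classes.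
  have key : ∀ k, 1 ≤ k → k ≤ n → ¬ (P.side a ∈ S ↔ P.side ((P.nx ^ k) a) ∈ S) := by
    intro k hk
    induction k, hk using Nat.le_induction with
    | base =>
      intro _
      rw [hstep 0]
      exact (hS a rfl).1 (Or.inl rfl)
    | succ k hk ih =>
      intro hkn
      have h1 := ih (by omega)
      have h2 : ¬ ((P.nx ^ k) a = a ∨ (P.nx ^ k) a = b) := by
        rintro (h | h)
        -- A return to `a` after `k` steps would mean that `b` is reached after `n - k` steps
        -- already.
        · apply hmin (n - k) (by omega)
          rw [← hnb]
          conv_rhs => rw [show n = (n - k) + k by omega, pow_add, Equiv.Perm.mul_apply, h]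
        · exact hmin k (by omega) h
      rw [hS _ (hfst k), not_not] at h2
      rw [hstep k, ← h2]
      exact h1
  have := key n (by omega) le_rfl
  rw [hnb, hs] at this
  exact this Iff.rfl

theorem eq_of_side_of_snd [Finite V] (h3 : ThreeConnected P.graph) {a b : P.graph.Dart}
    (hs : P.side a = P.side b) (hv : a.snd = b.snd) : a = b := by
  apply P.fc.injective
  apply P.eq_of_side_of_fst h3
  · simpa using hs
  · simpa using hv

theorem eq_of_side_of_edge [Finite V] (h3 : ThreeConnected P.graph) {a b : P.graph.Dart}
    (hs : P.side a = P.side b) (he : a.edge = b.edge) : a = b := by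
  rcases (SimpleGraph.dart_edge_eq_iff _ _).1 he with h | rfl
  · exact h
  · exact absurd hs.symm (P.side_symm_ne h3 b)

theorem fc_ne [Finite V] (d : P.graph.Dart) : P.fc d ≠ d := by
  intro h
  have := P.fc_fst d
  rw [h] at this
  exact d.adj.ne this

/-- A boundary walk of length two would turn back along its edge and put one region on both sides.
-/
theorem fc_fc_ne [Finite V] (h3 : ThreeConnected P.graph) (d : P.graph.Dart) :
    P.fc (P.fc d) ≠ d := by
  intro h
  have h1 : P.fc d = d.symm := by
    apply P.dart_ext
    · simp
    · have := P.fc_fst (P.fc d)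
      rw [h] at this
      exact this.symm
  have h2 := P.side_fc d
  rw [h1] at h2
  exact P.side_symm_ne h3 d h2.symm

end PlaneGraph

/-! ### Multiplicities around a vertex. -/

namespace PlaneGraph

variable {V : Type*} (P : PlaneGraph V)

instance [Finite V] : Finite P.graph.Dart :=
  Finite.of_injective (fun d => d.toProd) fun _ _ h => SimpleGraph.Dart.ext _ _ h

instance [Finite V] : Finite P.Region :=
  Finite.of_surjective P.side fun r => P.exists_side r

noncomputable instance [Finite V] : Fintype P.graph.Dart := Fintype.ofFinite _

noncomputable instance [Finite V] : Fintype P.Region := Fintype.ofFinite _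

open Classical in
-- A cut edge belongs to exactly one dart that leaves `X`; this turns cuts into sums over darts.
theorem totalMult_cutEdges [Finite V] (m : Sym2 V → ℕ) (X : Set V) :
    totalMult m (cutEdges P.graph X) =
      ∑ d : P.graph.Dart with d.fst ∈ X ∧ d.snd ∉ X, m d.edge := by
  unfold totalMult
  symm
  apply Finset.sum_bij (fun d _ => d.edge)
  · intro d hd
    simp only [Finset.mem_filter, Finset.mem_univ, true_and] at hd
    rw [Set.Finite.mem_toFinset]
    exact ⟨d.fst, d.snd, d.adj, hd.1, hd.2, rfl⟩
  · intro d hd e he h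
    simp only [Finset.mem_filter, Finset.mem_univ, true_and] at hd he
    rcases (SimpleGraph.dart_edge_eq_iff _ _).1 h with rfl | rfl
    · rfl
    · exact absurd hd.1 he.2
  · intro x hx
    rw [Set.Finite.mem_toFinset] at hx
    obtain ⟨a, b, hab, ha, hb, rfl⟩ := hx
    exact ⟨⟨(a, b), hab⟩, by simp [ha, hb], rfl⟩
  · intros; rfl

open Classical in
theorem sum_at_vertex [Finite V] {m : Sym2 V → ℕ} (h : IsTarget 8 P m) (v : V) :
    ∑ d : P.graph.Dart with d.fst = v, m d.edge = 8 := by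
  rw [← h.regular v, totalMult_cutEdges]
  apply Finset.sum_congr _ fun _ _ => rfl
  ext d
  simp only [Finset.mem_filter, Finset.mem_univ, true_and, Set.mem_singleton_iff]
  exact ⟨fun h => ⟨h, fun h' => d.adj.ne (h.trans h'.symm)⟩, fun h => h.1⟩

open Classical in
theorem deg_eq [Finite V] (v : V) :
    P.deg v = (Finset.univ.filter fun d : P.graph.Dart => d.fst = v).card := by
  rw [deg, ← Set.ncard_coe_finset]
  symm
  apply Set.ncard_congr (fun d _ => d.snd)
  · intro d hd
    simp only [Finset.coe_filter, Finset.mem_univ, true_and, Set.mem_ofPred_eq] at hd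
    rw [← hd]
    exact d.adj
  · intro d e hd he h
    simp only [Finset.coe_filter, Finset.mem_univ, true_and, Set.mem_ofPred_eq] at hd he
    exact P.dart_ext (hd.trans he.symm) h
  · intro w hw
    exact ⟨⟨(v, w), hw⟩, by simp, rfl⟩

end PlaneGraph


namespace PlaneGraph

variable {V : Type*} [Finite V] {P : PlaneGraph V} {m : Sym2 V → ℕ}

theorem mult_pos (h : IsPrimeTarget P m) (d : P.graph.Dart) : 1 ≤ m d.edge :=
  h.mult_pos _ d.edge_mem

open Classical in
/-- Darts at a common vertex have total multiplicity at most eight, with equality only if they are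
all the darts there. -/
theorem sum_le_eight (h : IsPrimeTarget P m) {v : V} {S : Finset P.graph.Dart}
    (hS : ∀ d ∈ S, d.fst = v) :
    ∑ d ∈ S, m d.edge ≤ 8 ∧ (∑ d ∈ S, m d.edge = 8 → ∀ d, d.fst = v → d ∈ S) := by
  have hsub : S ⊆ Finset.univ.filter fun d : P.graph.Dart => d.fst = v := by
    intro d hd
    simp [hS d hd]
  have hsum := P.sum_at_vertex h.target v
  have hle := Finset.sum_le_sum_of_subset (f := fun d : P.graph.Dart => m d.edge) hsub
  refine ⟨by omega, fun heq d hd => ?_⟩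
  by_contra hdS
  have h2 : insert d S ⊆ Finset.univ.filter fun d : P.graph.Dart => d.fst = v := by
    intro e he
    rcases Finset.mem_insert.1 he with rfl | he
    · simp [hd]
    · simp [hS e he]
  have h3 := Finset.sum_le_sum_of_subset (f := fun d : P.graph.Dart => m d.edge) h2
  rw [Finset.sum_insert hdS] at h3
  have := mult_pos h d
  omega

/-- The two ways in which the darts around the end of `d` can look like. -/
theorem corner (h : IsPrimeTarget P m) (d : P.graph.Dart) :
    (P.nx.symm d.symm = P.nx (P.fc d) ∧
      m (P.nx.symm d.symm).edge + m d.edge + m (P.fc d).edge = 8 ∧ P.deg d.snd = 3) ∨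
    (m (P.nx.symm d.symm).edge + m d.edge + m (P.fc d).edge + m (P.nx (P.fc d)).edge ≤ 8 ∧
      4 ≤ P.deg d.snd ∧
      (m (P.nx.symm d.symm).edge + m d.edge + m (P.fc d).edge + m (P.nx (P.fc d)).edge = 8 →
        P.nx (P.nx (P.fc d)) = P.nx.symm d.symm)) := by
  classical
  have h3 := h.threeConnected
  -- At the head of `d` the darts come in the order `x`, `d.symm`, `e`, `y`. The region of `d` lies
  -- between `d.symm` and `e`, while `x` borders the region across `d` and `y` the region across
  -- `e`. The case `x = y` is that of degree three.
  set x := P.nx.symm d.symm with hx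
  have hxd : P.nx x = d.symm := by rw [hx, Equiv.apply_symm_apply]
  set e := P.fc d with he
  have hde : P.nx d.symm = e := rfl
  set y := P.nx e with hy
  have v1 : x.fst = d.snd := P.nx_inv_fst _
  have v2 : d.symm.fst = d.snd := rfl
  have v3 : e.fst = d.snd := P.fc_fst _
  have v4 : y.fst = d.snd := (P.nx_fst _).trans v3
  have n1 : x ≠ d.symm := fun h => P.nx_ne h3 x (hxd.trans h.symm)
  have n2 : x ≠ e := fun h => P.nx_nx_ne h3 x (by rw [hxd, hde, h])
  have n3 : d.symm ≠ e := fun h => P.nx_ne h3 d.symm (hde.trans h.symm)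
  have n4 : y ≠ e := P.nx_ne h3 e
  have n5 : y ≠ d.symm := fun h => P.nx_nx_ne h3 d.symm (by rw [hde]; exact h)
  have s1 : m d.symm.edge = m d.edge := by rw [SimpleGraph.Dart.edge_symm]
  by_cases hxy : x = y
  · left
    have hall : ∀ f : P.graph.Dart, f.fst = d.snd → f ∈ ({x, d.symm, e} : Finset _) := by
      intro f hf
      obtain ⟨n, hn⟩ := P.nx_orbit (v1.trans hf.symm)
      rw [← hn]
      clear hn
      induction n with
      | zero => simp
      | succ n ih =>
        rw [pow_succ', Equiv.Perm.mul_apply]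
        simp only [Finset.mem_insert, Finset.mem_singleton] at ih ⊢
        rcases ih with h | h | h <;> rw [h]
        · right; left; exact hxd
        · right; right; exact hde
        · left; exact hxy.symm
    have hS : (Finset.univ.filter fun f : P.graph.Dart => f.fst = d.snd) = {x, d.symm, e} := by
      ext f
      refine ⟨fun hf => hall f (by simpa using hf), fun hf => ?_⟩
      simp only [Finset.mem_insert, Finset.mem_singleton] at hf
      rcases hf with rfl | rfl | rfl <;> simp [v1, v3]
    have hsum := P.sum_at_vertex h.target d.snd
    rw [hS, Finset.sum_insert (by simp [n1, n2]), Finset.sum_insert (by simp [n3]),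
      Finset.sum_singleton, s1] at hsum
    refine ⟨hxy, by omega, ?_⟩
    rw [P.deg_eq, hS, Finset.card_insert_of_notMem (by simp [n1, n2]),
      Finset.card_insert_of_notMem (by simp [n3]), Finset.card_singleton]
  · right
    have key := sum_le_eight h (v := d.snd) (S := {x, d.symm, e, y}) (by
      intro f hf
      simp only [Finset.mem_insert, Finset.mem_singleton] at hf
      rcases hf with rfl | rfl | rfl | rfl <;> assumption)
    have i1 : x ∉ ({d.symm, e, y} : Finset P.graph.Dart) := by simp [n1, n2, hxy]
    have i2 : d.symm ∉ ({e, y} : Finset P.graph.Dart) := by simp [n3, n5.symm]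
    have i3 : e ∉ ({y} : Finset P.graph.Dart) := by simp [n4.symm]
    rw [Finset.sum_insert i1, Finset.sum_insert i2, Finset.sum_insert i3, Finset.sum_singleton,
      s1] at key
    refine ⟨by omega, ?_, fun heq => ?_⟩
    · rw [P.deg_eq]
      calc 4 = ({x, d.symm, e, y} : Finset P.graph.Dart).card := by
            rw [Finset.card_insert_of_notMem i1, Finset.card_insert_of_notMem i2,
              Finset.card_insert_of_notMem i3, Finset.card_singleton]
        _ ≤ _ := Finset.card_le_card (by
          intro f hf
          simp only [Finset.mem_insert, Finset.mem_singleton] at hf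
          rcases hf with rfl | rfl | rfl | rfl <;> simp [v1, v3, v4])
    · have := key.2 (by omega) (P.nx y) ((P.nx_fst _).trans v4)
      simp only [Finset.mem_insert, Finset.mem_singleton] at this
      rcases this with h' | h' | h' | h'
      · exact h'
      · exact absurd (P.nx.injective (h'.trans hxd.symm)).symm hxy
      · exact absurd (P.nx.injective (h'.trans hde.symm)) n5
      · exact absurd h' (P.nx_ne h3 y)

end PlaneGraph

/-! ### Euler's inequality. -/

namespace PlaneGraph

variable {V : Type*} (P : PlaneGraph V)

theorem exists_dart {e : Sym2 V} (he : e ∈ P.graph.edgeSet) : ∃ d : P.graph.Dart, d.edge = e := by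
  induction e with
  | h a b => exact ⟨⟨(a, b), he⟩, rfl⟩

/-- An edge outside a spanning tree is separated, among all such edges, by some set of regions. -/
theorem exists_fundamental_separation {T : SimpleGraph V} (hT : T ≤ P.graph) (hc : T.Connected)
    {d : P.graph.Dart} (hd : d.edge ∉ T.edgeSet) :
    ∃ S : Set P.Region, ∀ f : P.graph.Dart, f.edge ∉ T.edgeSet →
      (f.edge = d.edge ↔ ¬ (P.side f ∈ S ↔ P.side f.symm ∈ S)) := by
  -- The cycle is the fundamental cycle over `T`, whose only edge outside `T` is `d.edge`.
  obtain ⟨p, hp⟩ := hc.exists_isPath d.snd d.fst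
  have hq : (p.mapLe hT).IsPath := hp.mapLe hT
  have hedges : ∀ e ∈ (p.mapLe hT).edges, e ∈ T.edgeSet := by
    intro e he
    rw [SimpleGraph.Walk.edges_mapLe_eq_edges] at he
    exact p.edges_subset_edgeSet he
  have hcyc : (SimpleGraph.Walk.cons d.adj (p.mapLe hT)).IsCycle := by
    rw [SimpleGraph.Walk.cons_isCycle_iff]
    exact ⟨hq, fun h => hd (hedges _ h)⟩
  obtain ⟨S, hS⟩ := P.spherical _ _ hcyc
  refine ⟨S, fun f hf => ?_⟩
  change _ ↔ ¬ (P.rot.side f ∈ S ↔ P.rot.side f.symm ∈ S)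
  rw [← hS f, SimpleGraph.Walk.edges_cons, List.mem_cons]
  exact ⟨fun h => Or.inl h, fun h => h.resolve_right fun h' => hf (hedges _ h')⟩

/-- The inequality in Euler's formula. -/
theorem euler [Finite V] :
    Nat.card P.graph.Dart + 2 ≤ 2 * Nat.card V + 2 * Nat.card P.Region := by
  classical
  have : Fintype V := Fintype.ofFinite V
  obtain ⟨T, hT, htree⟩ := P.connected.exists_isTree_le
  have hcardT := htree.card_edgeFinset
  have hdarts := P.graph.dart_card_eq_twice_card_edges
  let N := {e : P.graph.edgeSet // (e : Sym2 V) ∉ T.edgeSet}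
  have hN : Fintype.card N + T.edgeFinset.card = P.graph.edgeFinset.card := by
    have h1 := Fintype.card_subtype_compl (fun e : P.graph.edgeSet => (e : Sym2 V) ∈ T.edgeSet)
    have h2 : Fintype.card {e : P.graph.edgeSet // (e : Sym2 V) ∈ T.edgeSet} =
        T.edgeFinset.card := by
      rw [SimpleGraph.edgeFinset, Set.toFinset_card]
      apply Fintype.card_congr
      exact ⟨fun e => ⟨e.1.1, e.2⟩, fun e => ⟨⟨e.1, SimpleGraph.edgeSet_mono hT e.2⟩, e.2⟩,
        fun _ => rfl, fun _ => rfl⟩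
    have h3 := Fintype.card_subtype_le (fun e : P.graph.edgeSet => (e : Sym2 V) ∈ T.edgeSet)
    have h4 : Fintype.card P.graph.edgeSet = P.graph.edgeFinset.card := by
      rw [SimpleGraph.edgeFinset, Set.toFinset_card]
    have h5 : Fintype.card N =
      Fintype.card {e : P.graph.edgeSet // ¬ (e : Sym2 V) ∈ T.edgeSet} :=
      Fintype.card_congr (Equiv.refl _)
    omega
  have hdart : ∀ n : N, ∃ d : P.graph.Dart, d.edge = n.1.1 := fun n => P.exists_dart n.1.2
  choose D hD using hdart
  have hsep : ∀ n : N, ∃ S : Set P.Region, ∀ n' : N,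
      (n' = n ↔ ¬ (P.side (D n') ∈ S ↔ P.side (D n').symm ∈ S)) := by
    intro n
    obtain ⟨S, hS⟩ := P.exists_fundamental_separation hT htree.connected (d := D n)
      (by rw [hD]; exact n.2)
    refine ⟨S, fun n' => ?_⟩
    rw [← hS (D n') (by rw [hD]; exact n'.2), hD, hD]
    exact ⟨fun h => by rw [h], fun h => Subtype.ext (Subtype.ext h)⟩
  choose S hS using hsep
  -- Over the field with two elements, send a set of regions to the non-tree edges that it
  -- separates. Each single non-tree edge is hit, by one side of its fundamental cycle, so the map
  -- is onto and there are at most as many non-tree edges as regions. The constant functions in the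
  -- kernel would improve the bound by one; the weaker bound is enough for the charges.
  let φ : (P.Region → ZMod 2) → (N → ZMod 2) := fun f n =>
    f (P.side (D n)) + f (P.side (D n).symm)
  have hφ : Function.Surjective φ := by
    intro g
    refine ⟨fun r => ∑ n, g n * (if r ∈ S n then 1 else 0), ?_⟩
    funext n'
    simp only [φ, ← Finset.sum_add_distrib, ← mul_add]
    rw [Finset.sum_eq_single n']
    · have := (hS n' n').1 rfl
      by_cases h1 : P.side (D n') ∈ S n' <;> by_cases h2 : P.side (D n').symm ∈ S n' <;>
        simp_all
    · intro n _ hn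
      have := (hS n n').not.1 (Ne.symm hn)
      rw [not_not] at this
      by_cases h1 : P.side (D n').symm ∈ S n
      · rw [if_pos h1, if_pos (this.2 h1), show (1 + 1 : ZMod 2) = 0 from rfl, mul_zero]
      · rw [if_neg h1, if_neg (fun h => h1 (this.1 h)), add_zero, mul_zero]
    · intro h
      exact absurd (Finset.mem_univ _) h
  have hcard := Fintype.card_le_of_surjective φ hφ
  rw [Fintype.card_fun, Fintype.card_fun, ZMod.card] at hcard
  have hle := (Nat.pow_le_pow_iff_right (by norm_num)).1 hcard
  rw [Nat.card_eq_fintype_card (α := V), Nat.card_eq_fintype_card (α := P.Region)]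
  have : Nat.card P.graph.Dart = 2 * P.graph.edgeFinset.card := by
    rw [← hdarts, Nat.card_eq_fintype_card]
    congr!
  omega

end PlaneGraph

/-! ### The total charge. -/

namespace PlaneGraph

variable {V : Type*} [Finite V] {P : PlaneGraph V} {m : Sym2 V → ℕ}

open Classical in
theorem sum_darts (h : IsTarget 8 P m) : ∑ d : P.graph.Dart, m d.edge = 8 * Nat.card V := by
  have : Fintype V := Fintype.ofFinite V
  rw [← Finset.sum_fiberwise (s := Finset.univ) (g := fun d : P.graph.Dart => d.fst),
    Finset.sum_congr rfl fun v _ => P.sum_at_vertex h v, Finset.sum_const, smul_eq_mul, mul_comm,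
    Finset.card_univ, Nat.card_eq_fintype_card]

open Classical in
/-- If the sides of the edges exchange charges, then some region keeps a positive charge. -/
theorem exists_positive_region (h : IsTarget 8 P m) (β : P.graph.Dart → ℤ)
    (hβ : ∀ d, β d.symm = - β d) :
    ∃ r : P.Region, ∑ d : P.graph.Dart with P.side d = r, (8 - 2 * (m d.edge : ℤ) - β d) < 16 := by
  by_contra! hno
  have h1 : ∑ r : P.Region, ∑ d : P.graph.Dart with P.side d = r,
      (8 - 2 * (m d.edge : ℤ) - β d) = ∑ d : P.graph.Dart, (8 - 2 * (m d.edge : ℤ) - β d) :=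
    Finset.sum_fiberwise _ _ _
  have h2 : ∑ r : P.Region, (16 : ℤ) ≤ ∑ r : P.Region, ∑ d : P.graph.Dart with P.side d = r,
      (8 - 2 * (m d.edge : ℤ) - β d) := Finset.sum_le_sum fun r _ => hno r
  have h3 : ∑ d : P.graph.Dart, β d = 0 := by
    have : ∑ d : P.graph.Dart, β d = ∑ d : P.graph.Dart, β d.symm :=
      (Equiv.sum_comp (SimpleGraph.Dart.symm_involutive (G := P.graph)).toPerm β).symm
    simp only [hβ, Finset.sum_neg_distrib] at this
    omega
  have h4 : ∑ d : P.graph.Dart, (m d.edge : ℤ) = 8 * Nat.card V := by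
    exact_mod_cast sum_darts h
  rw [h1, Finset.sum_sub_distrib, Finset.sum_sub_distrib, ← Finset.mul_sum, h3, h4,
    Finset.sum_const, Finset.sum_const, Finset.card_univ, Finset.card_univ,
    ← Nat.card_eq_fintype_card, ← Nat.card_eq_fintype_card, nsmul_eq_mul, nsmul_eq_mul] at h2
  -- If no region had positive charge, then 16E − 16V ≥ 16F, against E + 1 ≤ V + F.
  have := P.euler
  zify at this
  linarith

end PlaneGraph

/-! ### Boundaries of length three, four and five. -/

namespace PlaneGraph

variable {V : Type*} {P : PlaneGraph V} {m : Sym2 V → ℕ}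

/-- The region on the side of `d` is a triangle. -/
def Tri (d : P.graph.Dart) : Prop := P.fc (P.fc (P.fc d)) = d

/-- The region on the side of `d` is a square. -/
def Quad (d : P.graph.Dart) : Prop := P.fc (P.fc (P.fc (P.fc d))) = d

/-- The region on the side of `d` has length five. -/
def Pent (d : P.graph.Dart) : Prop := P.fc (P.fc (P.fc (P.fc (P.fc d)))) = d

theorem Tri.inv {d : P.graph.Dart} (h : Tri d) : P.fc.symm d = P.fc (P.fc d) := by
  rw [Equiv.symm_apply_eq]; exact h.symm

theorem Quad.inv {d : P.graph.Dart} (h : Quad d) : P.fc.symm d = P.fc (P.fc (P.fc d)) := by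
  rw [Equiv.symm_apply_eq]; exact h.symm

theorem Pent.inv {d : P.graph.Dart} (h : Pent d) : P.fc.symm d = P.fc (P.fc (P.fc (P.fc d))) := by
  rw [Equiv.symm_apply_eq]; exact h.symm

theorem Tri.fc {d : P.graph.Dart} (h : Tri d) : Tri (P.fc d) := congrArg P.fc h

theorem Quad.fc {d : P.graph.Dart} (h : Quad d) : Quad (P.fc d) := congrArg P.fc h

theorem Pent.fc {d : P.graph.Dart} (h : Pent d) : Pent (P.fc d) := congrArg P.fc h

theorem fc_snd_of_fc_eq {d e : P.graph.Dart} (h : P.fc d = e) : d.snd = e.fst := by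
  rw [← h, fc_fst]

theorem mem_bd_iff {r : P.Region} {f : Sym2 V} :
    f ∈ P.bd r ↔ ∃ d : P.graph.Dart, P.side d = r ∧ d.edge = f := Iff.rfl

theorem edge_mem_bd (d : P.graph.Dart) : d.edge ∈ P.bd (P.side d) := ⟨d, rfl, rfl⟩

theorem exists_pow_of_side [Finite V] {d e : P.graph.Dart} (h : P.side e = P.side d) {k : ℕ}
    (hk : (P.fc ^ k) d = d) (hk0 : 0 < k) : ∃ i < k, e = (P.fc ^ i) d := by
  obtain ⟨n, hn⟩ := (P.side_eq_iff.1 h.symm).exists_pow_eq''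
  refine ⟨n % k, Nat.mod_lt _ hk0, ?_⟩
  rw [← hn.2.2]
  conv_lhs => rw [← Nat.mod_add_div n k, pow_add, Equiv.Perm.mul_apply, pow_mul]
  rw [Equiv.Perm.pow_apply_eq_self_of_apply_eq_self hk]

theorem Tri.side_eq_iff [Finite V] {d e : P.graph.Dart} (h : Tri d) :
    P.side e = P.side d ↔ e = d ∨ e = P.fc d ∨ e = P.fc (P.fc d) := by
  constructor
  · intro he
    obtain ⟨i, hi, rfl⟩ := exists_pow_of_side he (k := 3) h (by norm_num)
    interval_cases i
    exacts [Or.inl rfl, Or.inr (Or.inl rfl), Or.inr (Or.inr rfl)]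
  · rintro (rfl | rfl | rfl) <;> simp

theorem Quad.side_eq_iff [Finite V] {d e : P.graph.Dart} (h : Quad d) :
    P.side e = P.side d ↔
      e = d ∨ e = P.fc d ∨ e = P.fc (P.fc d) ∨ e = P.fc (P.fc (P.fc d)) := by
  constructor
  · intro he
    obtain ⟨i, hi, rfl⟩ := exists_pow_of_side he (k := 4) h (by norm_num)
    interval_cases i
    exacts [Or.inl rfl, Or.inr (Or.inl rfl), Or.inr (Or.inr (Or.inl rfl)),
      Or.inr (Or.inr (Or.inr rfl))]
  · rintro (rfl | rfl | rfl | rfl) <;> simp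

theorem Pent.side_eq_iff [Finite V] {d e : P.graph.Dart} (h : Pent d) :
    P.side e = P.side d ↔ e = d ∨ e = P.fc d ∨ e = P.fc (P.fc d) ∨ e = P.fc (P.fc (P.fc d)) ∨
      e = P.fc (P.fc (P.fc (P.fc d))) := by
  constructor
  · intro he
    obtain ⟨i, hi, rfl⟩ := exists_pow_of_side he (k := 5) h (by norm_num)
    interval_cases i
    exacts [Or.inl rfl, Or.inr (Or.inl rfl), Or.inr (Or.inr (Or.inl rfl)),
      Or.inr (Or.inr (Or.inr (Or.inl rfl))), Or.inr (Or.inr (Or.inr (Or.inr rfl)))]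
  · rintro (rfl | rfl | rfl | rfl | rfl) <;> simp

theorem IsTriangle.rotate {r : P.Region} {u v w : V} (h : P.IsTriangle r u v w) :
    P.IsTriangle r v w u := by
  refine ⟨h.1, h.2.trans ?_⟩
  ext f; simp only [Set.mem_insert_iff, Set.mem_singleton_iff]; tauto

theorem ne_of_edgeDisjoint {a b : P.graph.Dart} (hd : EdgeDisjoint a.edge b.edge) :
    b ≠ a ∧ b ≠ P.fc a ∧ b ≠ P.fc.symm a := by
  refine ⟨?_, ?_, ?_⟩
  · rintro rfl
    exact hd b.fst ⟨P.mem_edge.2 (Or.inl rfl), P.mem_edge.2 (Or.inl rfl)⟩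
  · rintro rfl
    exact hd a.snd ⟨P.mem_edge.2 (Or.inr rfl), P.mem_edge.2 (Or.inl (P.fc_fst a).symm)⟩
  · rintro rfl
    exact hd a.fst ⟨P.mem_edge.2 (Or.inl rfl), P.mem_edge.2 (Or.inr (P.fc_inv_snd a).symm)⟩

variable [Finite V]

/-- The darts with a given region on their side. -/
noncomputable def faceDarts (r : P.Region) : Finset P.graph.Dart :=
  letI := Classical.decEq P.Region
  Finset.univ.filter fun d => P.side d = r

@[simp] theorem mem_faceDarts {r : P.Region} {d : P.graph.Dart} :
    d ∈ faceDarts r ↔ P.side d = r := by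
  simp [faceDarts]

/-- The two darts of an edge have different sides, so no edge is counted twice along a boundary. -/
theorem length_eq (h : IsPrimeTarget P m) (r : P.Region) : P.length r = (faceDarts r).card := by
  rw [length, ← Set.ncard_coe_finset]
  have : P.bd r = (fun d : P.graph.Dart => d.edge) '' (faceDarts r : Set P.graph.Dart) := by
    ext f
    simp [mem_bd_iff]
  rw [this]
  apply Set.InjOn.ncard_image
  intro a ha b hb hab
  simp only [Finset.mem_coe, mem_faceDarts] at ha hb
  exact P.eq_of_side_of_edge h.threeConnected (ha.trans hb.symm) hab

section
variable [DecidableEq P.graph.Dart]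

theorem Tri.faceDarts_eq {d : P.graph.Dart} (h : Tri d) :
    faceDarts (P.side d) = {d, P.fc d, P.fc (P.fc d)} := by
  ext e; simp [h.side_eq_iff]

theorem Quad.faceDarts_eq {d : P.graph.Dart} (h : Quad d) :
    faceDarts (P.side d) = {d, P.fc d, P.fc (P.fc d), P.fc (P.fc (P.fc d))} := by
  ext e; simp [h.side_eq_iff]

theorem Pent.faceDarts_eq {d : P.graph.Dart} (h : Pent d) :
    faceDarts (P.side d) =
      {d, P.fc d, P.fc (P.fc d), P.fc (P.fc (P.fc d)), P.fc (P.fc (P.fc (P.fc d)))} := by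
  ext e; simp [h.side_eq_iff]

end

theorem fc_fc_fc_ne_of_quad {d : P.graph.Dart} (h : Quad d) : ¬ Tri d := by
  intro h'
  unfold Quad at h
  unfold Tri at h'
  rw [h'] at h
  exact P.fc_ne d h

theorem not_quad_of_pent {d : P.graph.Dart} (h : Pent d) : ¬ Quad d := by
  intro h'
  unfold Pent at h
  unfold Quad at h'
  rw [h'] at h
  exact P.fc_ne d h

theorem not_tri_of_pent (h3 : ThreeConnected P.graph) {d : P.graph.Dart} (h : Pent d) :
    ¬ Tri d := by
  intro h'
  unfold Pent at h
  unfold Tri at h'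
  rw [h'] at h
  exact P.fc_fc_ne h3 d h

theorem Tri.sum (h : IsPrimeTarget P m) {d : P.graph.Dart} (hd : Tri d) (f : P.graph.Dart → ℤ) :
    ∑ e ∈ faceDarts (P.side d), f e = f d + f (P.fc d) + f (P.fc (P.fc d)) := by
  classical
  have h3 := h.threeConnected
  have n1 := P.fc_ne
  have n2 := P.fc_fc_ne h3
  rw [hd.faceDarts_eq, Finset.sum_insert, Finset.sum_insert, Finset.sum_singleton, add_assoc]
  · simpa using (n1 _).symm
  · simpa using ⟨(n1 _).symm, (n2 _).symm⟩

theorem Quad.sum (h : IsPrimeTarget P m) {d : P.graph.Dart} (hd : Quad d)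
    (f : P.graph.Dart → ℤ) :
    ∑ e ∈ faceDarts (P.side d), f e =
      f d + f (P.fc d) + f (P.fc (P.fc d)) + f (P.fc (P.fc (P.fc d))) := by
  classical
  have h3 := h.threeConnected
  have n1 := P.fc_ne
  have n2 := P.fc_fc_ne h3
  have n3 : P.fc (P.fc (P.fc d)) ≠ d := fc_fc_fc_ne_of_quad hd
  rw [hd.faceDarts_eq, Finset.sum_insert, Finset.sum_insert, Finset.sum_insert, Finset.sum_singleton]
  · ring
  · simpa using (n1 _).symm
  · simpa using ⟨(n1 _).symm, (n2 _).symm⟩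
  · simpa using ⟨(n1 _).symm, (n2 _).symm, n3.symm⟩

theorem Pent.sum (h : IsPrimeTarget P m) {d : P.graph.Dart} (hd : Pent d)
    (f : P.graph.Dart → ℤ) :
    ∑ e ∈ faceDarts (P.side d), f e =
      f d + f (P.fc d) + f (P.fc (P.fc d)) + f (P.fc (P.fc (P.fc d))) +
        f (P.fc (P.fc (P.fc (P.fc d)))) := by
  classical
  have h3 := h.threeConnected
  have n1 := P.fc_ne
  have n2 := P.fc_fc_ne h3
  have n3 : P.fc (P.fc (P.fc d)) ≠ d := not_tri_of_pent h3 hd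
  have n3' : P.fc (P.fc (P.fc (P.fc d))) ≠ P.fc d := fun h => n3 (P.fc.injective h)
  have n4 : P.fc (P.fc (P.fc (P.fc d))) ≠ d := not_quad_of_pent hd
  rw [hd.faceDarts_eq, Finset.sum_insert, Finset.sum_insert, Finset.sum_insert, Finset.sum_insert,
    Finset.sum_singleton]
  · ring
  · simpa using (n1 _).symm
  · simpa using ⟨(n1 _).symm, (n2 _).symm⟩
  · simpa using ⟨(n1 _).symm, (n2 _).symm, n3.symm⟩
  · simpa using ⟨(n1 _).symm, (n2 _).symm, n3.symm, n4.symm⟩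

theorem Tri.length (h : IsPrimeTarget P m) {d : P.graph.Dart} (hd : Tri d) :
    P.length (P.side d) = 3 := by
  have := hd.sum h fun _ => 1
  rw [length_eq h]
  simp only [Finset.sum_const, nsmul_eq_mul, mul_one] at this
  exact_mod_cast this

theorem Quad.length (h : IsPrimeTarget P m) {d : P.graph.Dart} (hd : Quad d) :
    P.length (P.side d) = 4 := by
  have := hd.sum h fun _ => 1
  rw [length_eq h]
  simp only [Finset.sum_const, nsmul_eq_mul, mul_one] at this
  exact_mod_cast this

theorem Pent.length (h : IsPrimeTarget P m) {d : P.graph.Dart} (hd : Pent d) :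
    P.length (P.side d) = 5 := by
  have := hd.sum h fun _ => 1
  rw [length_eq h]
  simp only [Finset.sum_const, nsmul_eq_mul, mul_one] at this
  exact_mod_cast this

theorem four_le_length (h : IsPrimeTarget P m) {d : P.graph.Dart} (hd : ¬ Tri d) :
    4 ≤ P.length (P.side d) := by
  classical
  have h3 := h.threeConnected
  have n1 := P.fc_ne
  have n2 := P.fc_fc_ne h3
  have n3 : P.fc (P.fc (P.fc d)) ≠ d := hd
  rw [length_eq h]
  have : ({d, P.fc d, P.fc (P.fc d), P.fc (P.fc (P.fc d))} : Finset P.graph.Dart) ⊆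
      faceDarts (P.side d) := by
    intro e he
    simp only [Finset.mem_insert, Finset.mem_singleton] at he
    rcases he with rfl | rfl | rfl | rfl <;> simp
  refine le_trans (le_of_eq ?_) (Finset.card_le_card this)
  rw [Finset.card_insert_of_notMem, Finset.card_insert_of_notMem, Finset.card_insert_of_notMem,
    Finset.card_singleton]
  · simpa using (n1 _).symm
  · simpa using ⟨(n1 _).symm, (n2 _).symm⟩
  · simpa using ⟨(n1 _).symm, (n2 _).symm, n3.symm⟩

theorem five_le_length (h : IsPrimeTarget P m) {d : P.graph.Dart} (hd : ¬ Tri d)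
    (hd4 : ¬ Quad d) : 5 ≤ P.length (P.side d) := by
  classical
  have h3 := h.threeConnected
  have n1 := P.fc_ne
  have n2 := P.fc_fc_ne h3
  have n3 : P.fc (P.fc (P.fc d)) ≠ d := hd
  have n3' : P.fc (P.fc (P.fc (P.fc d))) ≠ P.fc d := fun h => n3 (P.fc.injective h)
  have n4 : P.fc (P.fc (P.fc (P.fc d))) ≠ d := hd4
  rw [length_eq h]
  have : ({d, P.fc d, P.fc (P.fc d), P.fc (P.fc (P.fc d)), P.fc (P.fc (P.fc (P.fc d)))} :
      Finset P.graph.Dart) ⊆ faceDarts (P.side d) := by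
    intro e he
    simp only [Finset.mem_insert, Finset.mem_singleton] at he
    rcases he with rfl | rfl | rfl | rfl | rfl <;> simp
  refine le_trans (le_of_eq ?_) (Finset.card_le_card this)
  rw [Finset.card_insert_of_notMem, Finset.card_insert_of_notMem, Finset.card_insert_of_notMem,
    Finset.card_insert_of_notMem, Finset.card_singleton]
  · simpa using (n1 _).symm
  · simpa using ⟨(n1 _).symm, (n2 _).symm⟩
  · simpa using ⟨(n1 _).symm, (n2 _).symm, n3.symm⟩
  · simpa using ⟨(n1 _).symm, (n2 _).symm, n3.symm, n4.symm⟩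

theorem Tri.isTriangle (h : IsPrimeTarget P m) {d : P.graph.Dart} (hd : Tri d) :
    P.IsTriangle (P.side d) d.fst d.snd (P.fc d).snd := by
  refine ⟨hd.length h, ?_⟩
  have e1 : d.edge = s(d.fst, d.snd) := rfl
  have e2 : (P.fc d).edge = s(d.snd, (P.fc d).snd) := by rw [P.edge_eq, fc_fst]
  have e3 : (P.fc (P.fc d)).edge = s((P.fc d).snd, d.fst) := by
    rw [P.edge_eq, fc_fst, fc_snd_of_fc_eq (d := P.fc (P.fc d)) hd]
  rw [← e2, ← e3, ← e1]
  ext f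
  simp only [mem_bd_iff, hd.side_eq_iff, Set.mem_insert_iff, Set.mem_singleton_iff]
  constructor
  · rintro ⟨e, rfl | rfl | rfl, rfl⟩ <;> simp
  · rintro (rfl | rfl | rfl)
    exacts [⟨_, Or.inl rfl, rfl⟩, ⟨_, Or.inr (Or.inl rfl), rfl⟩, ⟨_, Or.inr (Or.inr rfl), rfl⟩]

theorem Quad.isSquare (h : IsPrimeTarget P m) {d : P.graph.Dart} (hd : Quad d) :
    P.IsSquare (P.side d) d.fst d.snd (P.fc d).snd (P.fc (P.fc d)).snd := by
  refine ⟨hd.length h, ?_⟩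
  have e1 : d.edge = s(d.fst, d.snd) := rfl
  have e2 : (P.fc d).edge = s(d.snd, (P.fc d).snd) := by rw [P.edge_eq, fc_fst]
  have e3 : (P.fc (P.fc d)).edge = s((P.fc d).snd, (P.fc (P.fc d)).snd) := by
    rw [P.edge_eq, fc_fst]
  have e4 : (P.fc (P.fc (P.fc d))).edge = s((P.fc (P.fc d)).snd, d.fst) := by
    rw [P.edge_eq, fc_fst, fc_snd_of_fc_eq (d := P.fc (P.fc (P.fc d))) hd]
  rw [← e2, ← e3, ← e4, ← e1]
  ext f
  simp only [mem_bd_iff, hd.side_eq_iff, Set.mem_insert_iff, Set.mem_singleton_iff]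
  constructor
  · rintro ⟨e, rfl | rfl | rfl | rfl, rfl⟩ <;> simp
  · rintro (rfl | rfl | rfl | rfl)
    exacts [⟨_, Or.inl rfl, rfl⟩, ⟨_, Or.inr (Or.inl rfl), rfl⟩,
      ⟨_, Or.inr (Or.inr (Or.inl rfl)), rfl⟩, ⟨_, Or.inr (Or.inr (Or.inr rfl)), rfl⟩]

theorem Pent.isPentagon (h : IsPrimeTarget P m) {d : P.graph.Dart} (hd : Pent d) :
    P.IsPentagon (P.side d) d.fst d.snd (P.fc d).snd (P.fc (P.fc d)).snd
      (P.fc (P.fc (P.fc d))).snd := by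
  refine ⟨hd.length h, ?_⟩
  have e1 : d.edge = s(d.fst, d.snd) := rfl
  have e2 : (P.fc d).edge = s(d.snd, (P.fc d).snd) := by rw [P.edge_eq, fc_fst]
  have e3 : (P.fc (P.fc d)).edge = s((P.fc d).snd, (P.fc (P.fc d)).snd) := by
    rw [P.edge_eq, fc_fst]
  have e4 : (P.fc (P.fc (P.fc d))).edge = s((P.fc (P.fc d)).snd, (P.fc (P.fc (P.fc d))).snd) := by
    rw [P.edge_eq, fc_fst]
  have e5 : (P.fc (P.fc (P.fc (P.fc d)))).edge = s((P.fc (P.fc (P.fc d))).snd, d.fst) := by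
    rw [P.edge_eq, fc_fst, fc_snd_of_fc_eq (d := P.fc (P.fc (P.fc (P.fc d)))) hd]
  rw [← e2, ← e3, ← e4, ← e5, ← e1]
  ext f
  simp only [mem_bd_iff, hd.side_eq_iff, Set.mem_insert_iff, Set.mem_singleton_iff]
  constructor
  · rintro ⟨e, rfl | rfl | rfl | rfl | rfl, rfl⟩ <;> simp
  · rintro (rfl | rfl | rfl | rfl | rfl)
    exacts [⟨_, Or.inl rfl, rfl⟩, ⟨_, Or.inr (Or.inl rfl), rfl⟩,
      ⟨_, Or.inr (Or.inr (Or.inl rfl)), rfl⟩, ⟨_, Or.inr (Or.inr (Or.inr (Or.inl rfl))), rfl⟩,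
      ⟨_, Or.inr (Or.inr (Or.inr (Or.inr rfl))), rfl⟩]

theorem isSecond_iff (h3 : ThreeConnected P.graph) {d : P.graph.Dart} {r : P.Region} :
    P.IsSecond (P.side d) d.edge r ↔ r = P.side d.symm := by
  constructor
  · rintro ⟨_, h2, h⟩
    rcases P.mem_bd.1 h2 with h' | h'
    · exact absurd h'.symm h
    · exact h'.symm
  · rintro rfl
    refine ⟨edge_mem_bd d, ?_, (P.side_symm_ne h3 d).symm⟩
    rw [← d.edge_symm]
    exact edge_mem_bd _

open Classical in
theorem mp_eq (h3 : ThreeConnected P.graph) (d : P.graph.Dart) :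
    P.mp m (P.side d) d.edge =
      if P.Big m (P.side d.symm) then m d.edge else m d.edge + 1 := by
  have : (∃ r', P.IsSecond (P.side d) d.edge r' ∧ P.Small m r') ↔ ¬ P.Big m (P.side d.symm) := by
    constructor
    · rintro ⟨r', h1, h2⟩
      rw [(isSecond_iff h3).1 h1] at h2
      exact h2
    · intro hb
      exact ⟨_, (isSecond_iff h3).2 rfl, hb⟩
  unfold mp
  by_cases hb : P.Big m (P.side d.symm)
  · rw [if_neg (this.not.2 (not_not.2 hb)), if_pos hb]
  · rw [if_pos (this.2 hb), if_neg hb]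

end PlaneGraph

/-! ### Forbidden configurations as statements about darts. -/

namespace PlaneGraph

variable {V : Type*} {P : PlaneGraph V}

theorem IsTriangle.flip {r : P.Region} {u v w : V} (h : P.IsTriangle r u v w) :
    P.IsTriangle r v u w := by
  refine ⟨h.1, h.2.trans ?_⟩
  ext f
  simp only [Set.mem_insert_iff, Set.mem_singleton_iff, Sym2.eq_swap (a := v) (b := u),
    Sym2.eq_swap (a := w) (b := v), Sym2.eq_swap (a := w) (b := u)]
  tauto

theorem IsSquare.flip {r : P.Region} {u v w x : V} (h : P.IsSquare r u v w x) :
    P.IsSquare r v u x w := by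
  refine ⟨h.1, h.2.trans ?_⟩
  ext f
  simp only [Set.mem_insert_iff, Set.mem_singleton_iff, Sym2.eq_swap (a := v) (b := u),
    Sym2.eq_swap (a := u) (b := x), Sym2.eq_swap (a := x) (b := w), Sym2.eq_swap (a := w) (b := v)]
  tauto

theorem IsPentagon.flip {r : P.Region} {a b c d e : V} (h : P.IsPentagon r a b c d e) :
    P.IsPentagon r b a e d c := by
  refine ⟨h.1, h.2.trans ?_⟩
  ext f
  simp only [Set.mem_insert_iff, Set.mem_singleton_iff, Sym2.eq_swap (a := b) (b := a),
    Sym2.eq_swap (a := a) (b := e), Sym2.eq_swap (a := e) (b := d), Sym2.eq_swap (a := d) (b := c),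
    Sym2.eq_swap (a := c) (b := b)]
  tauto

theorem edge_fc (d : P.graph.Dart) : (P.fc d).edge = s(d.snd, (P.fc d).snd) := by
  rw [P.edge_eq, fc_fst]

theorem edge_fc_inv (d : P.graph.Dart) : (P.fc.symm d).edge = (P.nx.symm d).edge := by
  rw [fc_inv_apply, SimpleGraph.Dart.edge_symm]

theorem Tri.edge {d : P.graph.Dart} (hd : Tri d) :
    (P.fc (P.fc d)).edge = s((P.fc d).snd, d.fst) := by
  rw [edge_fc, fc_snd_of_fc_eq (d := P.fc (P.fc d)) hd]

theorem Quad.edge {d : P.graph.Dart} (hd : Quad d) :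
    (P.fc (P.fc (P.fc d))).edge = s((P.fc (P.fc d)).snd, d.fst) := by
  rw [edge_fc, fc_snd_of_fc_eq (d := P.fc (P.fc (P.fc d))) hd]

theorem Pent.edge {d : P.graph.Dart} (hd : Pent d) :
    (P.fc (P.fc (P.fc (P.fc d)))).edge = s((P.fc (P.fc (P.fc d))).snd, d.fst) := by
  rw [edge_fc, fc_snd_of_fc_eq (d := P.fc (P.fc (P.fc (P.fc d)))) hd]

variable (m : Sym2 V → ℕ)

/-- The region across the edge of `d` is big. -/
def Bg (d : P.graph.Dart) : Prop := P.Big m (P.side d.symm)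

open Classical in
/-- The value `m⁺` for the edge of `d`, seen from the region on the side of `d`. -/
noncomputable def pm (d : P.graph.Dart) : ℕ := if Bg m d then m d.edge else m d.edge + 1

/-- The edge of `d` is `i`-heavy for the region on the side of `d`. -/
def Hv (i : ℕ) (d : P.graph.Dart) : Prop :=
  i ≤ m d.edge ∨
    (Tri d.symm ∧ i ≤ m d.edge + min (m (P.nx d).edge) (m (P.nx.symm d.symm).edge))

variable {m}

/-- `b` belongs to the same region as `d`, and their edges are disjoint. -/
def Far (d b : P.graph.Dart) : Prop :=
  P.side b = P.side d ∧ b ≠ d ∧ b ≠ P.fc d ∧ b ≠ P.fc.symm d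

/-- `b` belongs to the same region as `d`, and its edge avoids the tail of `d`. -/
def OffTail (d b : P.graph.Dart) : Prop := P.side b = P.side d ∧ b ≠ d ∧ b ≠ P.fc.symm d

/-- `b` belongs to the same region as `d`, and its edge avoids the head of `d`. -/
def OffHead (d b : P.graph.Dart) : Prop := P.side b = P.side d ∧ b ≠ d ∧ b ≠ P.fc d

/-- One implication suffices. The absence of a configuration yields a witness edge disjoint from the
given one, and afterwards only its position on the boundary walk matters. -/
theorem far_of_edgeDisjoint {d b : P.graph.Dart} (hs : P.side b = P.side d)
    (h : EdgeDisjoint d.edge b.edge) : Far d b :=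
  ⟨hs, ne_of_edgeDisjoint h⟩

theorem offTail_of_notMem {d b : P.graph.Dart} (hs : P.side b = P.side d)
    (h : d.fst ∉ b.edge) : OffTail d b := by
  refine ⟨hs, ?_, ?_⟩
  · rintro rfl
    exact h (P.mem_edge.2 (Or.inl rfl))
  · rintro rfl
    exact h (P.mem_edge.2 (Or.inr (P.fc_inv_snd d).symm))

theorem offHead_of_notMem {d b : P.graph.Dart} (hs : P.side b = P.side d)
    (h : d.snd ∉ b.edge) : OffHead d b := by
  refine ⟨hs, ?_, ?_⟩
  · rintro rfl
    exact h (P.mem_edge.2 (Or.inr rfl))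
  · rintro rfl
    exact h (P.mem_edge.2 (Or.inl (P.fc_fst d).symm))

variable [Finite V]

theorem mp_eq_pm (h : IsPrimeTarget P m) {r : P.Region} {d : P.graph.Dart} (hs : P.side d = r) :
    P.mp m r d.edge = pm m d := by
  rw [← hs, mp_eq h.threeConnected]
  rfl

theorem heavy_of_hv (h : IsPrimeTarget P m) {i : ℕ} {r : P.Region} {d : P.graph.Dart}
    (hs : P.side d = r) (hd : Hv m i d) : P.Heavy m i r d.edge := by
  subst hs
  rcases hd with hd | ⟨ht, hd⟩
  · exact Or.inl hd
  · right
    refine ⟨_, d.fst, d.snd, (P.nx d).snd, (isSecond_iff h.threeConnected).2 rfl, ?_, rfl, ?_⟩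
    · rw [← P.fc_symm]
      exact (ht.isTriangle h).flip
    · have e1 : s(d.fst, (P.nx d).snd) = (P.nx d).edge := by rw [P.edge_eq, nx_fst]
      have e2 : s(d.snd, (P.nx d).snd) = (P.nx.symm d.symm).edge := by
        rw [← edge_fc_inv, ht.inv, ht.edge, Sym2.eq_swap, ← P.fc_symm]
        rfl
      rw [e1, e2]
      exact hd

/-- The pattern for the configurations of long regions: the absence of one that requires all distant
edges to be heavy becomes the existence of a distant dart that is not heavy. Where the configuration
tolerates exceptions, two or three such darts appear. -/
theorem conf15 (h : IsPrimeTarget P m) {d : P.graph.Dart} (hd : ¬ Tri d) (hp : 4 ≤ pm m d) :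
    ∃ b, Far d b ∧ ¬ Hv m 3 b := by
  by_contra! hno
  apply h.not_conf15
  refine ⟨P.side d, four_le_length h hd, d.edge, edge_mem_bd d, ?_, ?_⟩
  · rwa [mp_eq_pm h rfl]
  · rintro _ ⟨b, hb, rfl⟩ hdis
    exact heavy_of_hv h hb (hno b (far_of_edgeDisjoint hb hdis))

/-- At most `n` edges in a set, unless there are more than `n` bad darts. -/
theorem ncard_le_of_forall {r : P.Region} {p : Sym2 V → Prop}
    {q : P.graph.Dart → Prop} (hpq : ∀ b : P.graph.Dart, P.side b = r → p b.edge → q b)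
    (hq : ¬ ∃ b b', q b ∧ q b' ∧ b ≠ b') : {f | f ∈ P.bd r ∧ p f}.ncard ≤ 1 := by
  by_contra hlt
  obtain ⟨_, ⟨⟨b, hb, rfl⟩, h1⟩, _, ⟨⟨b', hb', rfl⟩, h2⟩, hne⟩ :=
    (Set.one_lt_ncard (Set.toFinite _)).1 (not_le.1 hlt)
  exact hq ⟨b, b', hpq b hb h1, hpq b' hb' h2, fun he => hne (congrArg _ he)⟩

theorem conf17 (h : IsPrimeTarget P m) {d : P.graph.Dart} (h3 : ¬ Tri d) (h4 : ¬ Quad d)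
    (hp : 5 ≤ pm m d) :
    (∃ b, Far d b ∧ pm m b < 2) ∨
      ∃ b b', (Far d b ∧ ¬ Hv m 3 b) ∧ (Far d b' ∧ ¬ Hv m 3 b') ∧ b ≠ b' := by
  by_contra! hno
  apply h.not_conf17
  refine ⟨P.side d, five_le_length h h3 h4, d.edge, edge_mem_bd d, ?_, ?_, ?_⟩
  · rwa [mp_eq_pm h rfl]
  · rintro _ ⟨b, hb, rfl⟩ hdis
    rw [mp_eq_pm h hb]
    exact hno.1 b (far_of_edgeDisjoint hb hdis)
  · apply ncard_le_of_forall (q := fun b => Far d b ∧ ¬ Hv m 3 b)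
    · rintro b hb ⟨h1, h2⟩
      exact ⟨far_of_edgeDisjoint hb h1, fun h' => h2 (heavy_of_hv h hb h')⟩
    · rintro ⟨b, b', h1, h2, h3⟩
      exact h3 (hno.2 b b' h1 h2)

theorem conf19 (h : IsPrimeTarget P m) {d : P.graph.Dart} (h3 : ¬ Tri d) (h4 : ¬ Quad d)
    (hp : 5 ≤ pm m d) :
    (∃ b, Far d b ∧ ¬ Hv m 2 b) ∨
      ∃ a b c, (Far d a ∧ ¬ Hv m 3 a) ∧ (Far d b ∧ ¬ Hv m 3 b) ∧ (Far d c ∧ ¬ Hv m 3 c) ∧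
        a ≠ b ∧ a ≠ c ∧ b ≠ c := by
  by_contra! hno
  apply h.not_conf19
  refine ⟨P.side d, five_le_length h h3 h4, d.edge, edge_mem_bd d, ?_, ?_, ?_⟩
  · rwa [mp_eq_pm h rfl]
  · rintro _ ⟨b, hb, rfl⟩ hdis
    exact heavy_of_hv h hb (hno.1 b (far_of_edgeDisjoint hb hdis))
  · by_contra hlt
    obtain ⟨_, ⟨⟨a, ha, rfl⟩, a1, a2⟩, _, ⟨⟨b, hb, rfl⟩, b1, b2⟩, _, ⟨⟨c, hc, rfl⟩, c1, c2⟩,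
      n1, n2, n3⟩ := (Set.two_lt_ncard (Set.toFinite _)).1 (not_le.1 hlt)
    exact n3 (congrArg _ (hno.2 a b c
      ⟨far_of_edgeDisjoint ha a1, fun h' => a2 (heavy_of_hv h ha h')⟩
      ⟨far_of_edgeDisjoint hb b1, fun h' => b2 (heavy_of_hv h hb h')⟩
      ⟨far_of_edgeDisjoint hc c1, fun h' => c2 (heavy_of_hv h hc h')⟩
      (fun h' => n1 (congrArg _ h')) (fun h' => n2 (congrArg _ h'))))

theorem pm_across (h : IsPrimeTarget P m) {r : P.Region} {d : P.graph.Dart} {f : Sym2 V}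
    (hs : P.side d = r) (hf : f = d.edge) : P.mp m r f = pm m d := by
  rw [hf, mp_eq_pm h hs]

/-- The triangle across `d` is attached to the region of `d` at the tail of `d`. -/
theorem attached_tail (h : IsPrimeTarget P m) {d : P.graph.Dart} (ht : Tri d.symm)
    (h1 : m (P.nx.symm d.symm).edge ≤ m (P.nx d).edge)
    (h2 : m (P.fc.symm d).edge ≤ m (P.nx d).edge) :
    P.Attached m (P.side d) (P.side d.symm) d.fst d.snd (P.nx d).snd := by
  have e1 : s(d.fst, (P.nx d).snd) = (P.nx d).edge := by rw [P.edge_eq, nx_fst]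
  have e2 : s(d.snd, (P.nx d).snd) = (P.nx.symm d.symm).edge := by
    rw [← edge_fc_inv, ht.inv, ht.edge, Sym2.eq_swap, ← P.fc_symm]
    rfl
  refine ⟨(isSecond_iff h.threeConnected).2 rfl, ?_, ?_, ?_⟩
  · rw [← P.fc_symm]
    exact (ht.isTriangle h).flip
  · rwa [e1, e2]
  · rintro _ ⟨b, hb, rfl⟩ hu hne
    rw [e1]
    rcases P.mem_edge.1 hu with hu | hu
    · exact absurd (congrArg _ (P.eq_of_side_of_fst h.threeConnected hb hu.symm)) hne
    · have : b = P.fc.symm d :=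
        P.eq_of_side_of_snd h.threeConnected (by simpa using hb) (by simpa using hu.symm)
      rwa [this]

/-- The triangle across `d` is attached to the region of `d` at the head of `d`. -/
theorem attached_head (h : IsPrimeTarget P m) {d : P.graph.Dart} (ht : Tri d.symm)
    (h1 : m (P.nx d).edge ≤ m (P.nx.symm d.symm).edge)
    (h2 : m (P.fc d).edge ≤ m (P.nx.symm d.symm).edge) :
    P.Attached m (P.side d) (P.side d.symm) d.snd d.fst (P.nx d).snd := by
  have e1 : s(d.fst, (P.nx d).snd) = (P.nx d).edge := by rw [P.edge_eq, nx_fst]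
  have e2 : s(d.snd, (P.nx d).snd) = (P.nx.symm d.symm).edge := by
    rw [← edge_fc_inv, ht.inv, ht.edge, Sym2.eq_swap, ← P.fc_symm]
    rfl
  have e3 : s(d.snd, d.fst) = d.edge := Sym2.eq_swap
  refine ⟨e3 ▸ (isSecond_iff h.threeConnected).2 rfl, ?_, ?_, ?_⟩
  · rw [← P.fc_symm]
    exact ht.isTriangle h
  · rwa [e1, e2]
  · rintro _ ⟨b, hb, rfl⟩ hu hne
    rw [e2]
    rw [e3] at hne
    rcases P.mem_edge.1 hu with hu | hu
    · have : b = P.fc d :=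
        P.eq_of_side_of_fst h.threeConnected (by simpa using hb) (by simpa using hu.symm)
      rwa [this]
    · exact absurd (congrArg _ (P.eq_of_side_of_snd h.threeConnected hb hu.symm)) hne

theorem pm_tail (h : IsPrimeTarget P m) (d : P.graph.Dart) :
    P.mp m (P.side d.symm) s(d.fst, (P.nx d).snd) = pm m (P.nx d) :=
  pm_across h (P.side_nx d) (by rw [P.edge_eq, nx_fst])

theorem pm_head (h : IsPrimeTarget P m) {d : P.graph.Dart} (ht : Tri d.symm) :
    P.mp m (P.side d.symm) s(d.snd, (P.nx d).snd) = pm m (P.fc.symm d.symm) :=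
  pm_across h (P.side_fc_inv _) (by
    rw [ht.inv, ht.edge, Sym2.eq_swap, ← P.fc_symm]
    rfl)

/-- The distinguished end `u` of the configuration may be either end of the edge. Darts are
oriented, so each choice needs its own version. -/
theorem conf16_tail (h : IsPrimeTarget P m) {d : P.graph.Dart} (ht : Tri d.symm)
    (h1 : m (P.nx.symm d.symm).edge ≤ m (P.nx d).edge)
    (h2 : m (P.fc.symm d).edge ≤ m (P.nx d).edge) (h4 : 4 ≤ m d.edge + pm m (P.nx d)) :
    ∃ b, OffTail d b ∧ ¬ Hv m 3 b := by
  by_contra! hno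
  apply h.not_conf16
  refine ⟨_, _, _, _, _, attached_tail h ht h1 h2, ?_, ?_⟩
  · rw [pm_tail h]
    exact h4
  · rintro _ ⟨b, hb, rfl⟩ hu
    exact heavy_of_hv h hb (hno b (offTail_of_notMem hb hu))

theorem conf16_head (h : IsPrimeTarget P m) {d : P.graph.Dart} (ht : Tri d.symm)
    (h1 : m (P.nx d).edge ≤ m (P.nx.symm d.symm).edge)
    (h2 : m (P.fc d).edge ≤ m (P.nx.symm d.symm).edge)
    (h4 : 4 ≤ m d.edge + pm m (P.fc.symm d.symm)) :
    ∃ b, OffHead d b ∧ ¬ Hv m 3 b := by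
  by_contra! hno
  apply h.not_conf16
  refine ⟨_, _, _, _, _, attached_head h ht h1 h2, ?_, ?_⟩
  · rw [pm_head h ht, Sym2.eq_swap]
    exact h4
  · rintro _ ⟨b, hb, rfl⟩ hu
    exact heavy_of_hv h hb (hno b (offHead_of_notMem hb hu))

/-- Only alternative (b) of the configuration is needed. -/
theorem conf18_tail (h : IsPrimeTarget P m) {d : P.graph.Dart} (h3 : ¬ Tri d) (ht : Tri d.symm)
    (h1 : m (P.nx.symm d.symm).edge ≤ m (P.nx d).edge)
    (h2 : m (P.fc.symm d).edge ≤ m (P.nx d).edge) (h5 : 5 ≤ pm m (P.nx d) + m d.edge) :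
    (∃ b, OffTail d b ∧ pm m b < 2) ∨
      ∃ b b', (OffTail d b ∧ ¬ Hv m 3 b) ∧ (OffTail d b' ∧ ¬ Hv m 3 b') ∧ b ≠ b' := by
  by_contra! hno
  apply h.not_conf18
  refine ⟨_, _, _, _, _, four_le_length h h3, attached_tail h ht h1 h2, ?_, Or.inr ⟨?_, ?_⟩⟩
  · rw [pm_tail h]
    exact h5
  · rintro _ ⟨b, hb, rfl⟩ hu
    rw [mp_eq_pm h hb]
    exact hno.1 b (offTail_of_notMem hb hu)
  · apply ncard_le_of_forall (q := fun b => OffTail d b ∧ ¬ Hv m 3 b)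
    · rintro b hb ⟨h1, h2⟩
      exact ⟨offTail_of_notMem hb h1, fun h' => h2 (heavy_of_hv h hb h')⟩
    · rintro ⟨b, b', h1, h2, h3⟩
      exact h3 (hno.2 b b' h1 h2)

theorem conf18_head (h : IsPrimeTarget P m) {d : P.graph.Dart} (h3 : ¬ Tri d) (ht : Tri d.symm)
    (h1 : m (P.nx d).edge ≤ m (P.nx.symm d.symm).edge)
    (h2 : m (P.fc d).edge ≤ m (P.nx.symm d.symm).edge)
    (h5 : 5 ≤ pm m (P.fc.symm d.symm) + m d.edge) :
    (∃ b, OffHead d b ∧ pm m b < 2) ∨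
      ∃ b b', (OffHead d b ∧ ¬ Hv m 3 b) ∧ (OffHead d b' ∧ ¬ Hv m 3 b') ∧ b ≠ b' := by
  by_contra! hno
  apply h.not_conf18
  refine ⟨_, _, _, _, _, four_le_length h h3, attached_head h ht h1 h2, ?_, Or.inr ⟨?_, ?_⟩⟩
  · rw [pm_head h ht, Sym2.eq_swap (a := d.snd)]
    exact h5
  · rintro _ ⟨b, hb, rfl⟩ hu
    rw [mp_eq_pm h hb]
    exact hno.1 b (offHead_of_notMem hb hu)
  · apply ncard_le_of_forall (q := fun b => OffHead d b ∧ ¬ Hv m 3 b)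
    · rintro b hb ⟨h1, h2⟩
      exact ⟨offHead_of_notMem hb h1, fun h' => h2 (heavy_of_hv h hb h')⟩
    · rintro ⟨b, b', h1, h2, h3⟩
      exact h3 (hno.2 b b' h1 h2)

end PlaneGraph

/-! ### Configurations at triangles, squares and regions of length five. -/

namespace PlaneGraph

variable {V : Type*} {P : PlaneGraph V} {m : Sym2 V → ℕ}

theorem edge_tail (c : P.graph.Dart) : s(c.fst, (P.nx c).snd) = (P.nx c).edge := by
  rw [P.edge_eq, nx_fst]

theorem edge_head {c : P.graph.Dart} (hc : Tri c.symm) :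
    s(c.snd, (P.nx c).snd) = (P.nx.symm c.symm).edge := by
  rw [← edge_fc_inv, hc.inv, hc.edge, Sym2.eq_swap, ← P.fc_symm]
  rfl

variable [Finite V]

theorem conf4 (h : IsPrimeTarget P m) {d : P.graph.Dart} (hd : Quad d)
    (h8 : 8 ≤ m d.edge + m (P.fc d).edge + m (P.fc (P.fc (P.fc d))).edge) :
    m d.edge = 4 ∧ m (P.fc d).edge = 2 ∧ m (P.fc (P.fc d)).edge = 1 ∧
      m (P.fc (P.fc (P.fc d))).edge = 2 := by
  by_contra hno
  apply h.not_conf4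
  refine ⟨_, _, _, _, _, hd.isSquare h, ?_⟩
  rw [← edge_fc, ← edge_fc, Sym2.eq_swap (a := d.fst) (b := (P.fc (P.fc d)).snd), ← hd.edge,
    ← P.edge_eq]
  refine ⟨h8, fun heq => hno ?_⟩
  simpa using heq

theorem conf6 (h : IsPrimeTarget P m) {d : P.graph.Dart} (hd : Quad d) :
    pm m d + pm m (P.fc (P.fc d)) ≤ 6 := by
  by_contra hno
  apply h.not_conf6
  refine ⟨_, _, _, _, _, hd.isSquare h, ?_⟩
  rw [pm_across h rfl (P.edge_eq d).symm, ← edge_fc, mp_eq_pm h (by simp)]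
  omega

theorem isTriangle_across (h : IsPrimeTarget P m) {c : P.graph.Dart} (hc : Tri c.symm) :
    P.IsTriangle (P.side c.symm) c.fst c.snd (P.nx c).snd := by
  rw [← P.fc_symm]
  exact (hc.isTriangle h).flip

/-- The edge `c` is shared with the triangle and `d` is the edge facing it in the square. The second
conjunct comes from the reflected square and triangle. -/
theorem conf10 (h : IsPrimeTarget P m) {d c : P.graph.Dart} (hd : Quad d)
    (hdc : P.fc (P.fc d) = c) (hc : Tri c.symm) (h1 : m d.edge = 2) (h2 : m c.edge = 2) :
    ¬ (m (P.nx.symm c.symm).edge = 2 ∧ m (P.fc d).edge = 4) ∧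
      ¬ (m (P.nx c).edge = 2 ∧ m (P.fc c).edge = 4) := by
  have e1 : (P.fc d).snd = c.fst := fc_snd_of_fc_eq hdc
  have e2 : (P.fc (P.fc d)).snd = c.snd := by rw [hdc]
  have e3 := hd.edge
  rw [hdc] at e3
  have hsq := hd.isSquare h
  rw [e1, hdc] at hsq
  have ht := isTriangle_across h hc
  constructor
  · rintro ⟨h3, h4⟩
    apply h.not_conf10
    refine ⟨_, _, _, _, _, _, _, hsq, ht, h1, h2, ?_, ?_⟩
    · rwa [edge_head hc]
    · rwa [← e1, ← edge_fc]
  · rintro ⟨h3, h4⟩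
    apply h.not_conf10
    refine ⟨_, _, _, _, _, _, _, hsq.flip, ht.flip, ?_, ?_, ?_, ?_⟩
    · rwa [Sym2.eq_swap]
    · rwa [Sym2.eq_swap]
    · rwa [edge_tail]
    · rwa [Sym2.eq_swap, ← e3]

theorem conf11_tail (h : IsPrimeTarget P m) {d c : P.graph.Dart} (hd : Quad d)
    (hdc : P.fc (P.fc d) = c) (hc : Tri c.symm) :
    ¬ (3 ≤ m d.edge ∧ 3 ≤ m (P.nx c).edge ∧ m c.edge = 1 ∧ m (P.fc c).edge ≤ 3 ∧
      3 ≤ pm m (P.fc.symm c.symm)) := by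
  rintro ⟨h1, h2, h3, h4, h5⟩
  have e1 : (P.fc d).snd = c.fst := fc_snd_of_fc_eq hdc
  have e3 := hd.edge
  rw [hdc] at e3
  have hsq := hd.isSquare h
  rw [e1, hdc] at hsq
  apply h.not_conf11
  refine ⟨_, _, _, _, _, _, _, hsq, isTriangle_across h hc, h1, ?_, h3, ?_, ?_⟩
  · rwa [edge_tail]
  · rwa [Sym2.eq_swap, ← e3]
  · rwa [pm_head h hc]

theorem conf11_head (h : IsPrimeTarget P m) {d c : P.graph.Dart} (hd : Quad d)
    (hdc : P.fc (P.fc d) = c) (hc : Tri c.symm) :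
    ¬ (3 ≤ m d.edge ∧ 3 ≤ m (P.nx.symm c.symm).edge ∧ m c.edge = 1 ∧ m (P.fc d).edge ≤ 3 ∧
      3 ≤ pm m (P.nx c)) := by
  rintro ⟨h1, h2, h3, h4, h5⟩
  have e1 : (P.fc d).snd = c.fst := fc_snd_of_fc_eq hdc
  have e3 := hd.edge
  rw [hdc] at e3
  have hsq := hd.isSquare h
  rw [e1, hdc] at hsq
  apply h.not_conf11
  refine ⟨_, _, _, _, _, _, _, hsq.flip, (isTriangle_across h hc).flip, ?_, ?_, ?_, ?_, ?_⟩
  · rwa [Sym2.eq_swap]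
  · rwa [edge_head hc]
  · rwa [Sym2.eq_swap]
  · rwa [← e1, ← edge_fc]
  · rwa [pm_tail h]

theorem conf12_tail (h : IsPrimeTarget P m) {d c : P.graph.Dart} (hd : Quad d)
    (hdc : P.fc (P.fc d) = c) (hc : Tri c.symm) :
    ¬ (2 ≤ pm m d ∧ 2 ≤ m (P.fc d).edge ∧ m c.edge = 2 ∧ m (P.nx c).edge = 2 ∧
      m (P.fc c).edge ≤ 3 ∧ 3 ≤ pm m (P.fc.symm c.symm)) := by
  rintro ⟨h1, h2, h3, h4, h5, h6⟩
  have e1 : (P.fc d).snd = c.fst := fc_snd_of_fc_eq hdc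
  have e3 := hd.edge
  rw [hdc] at e3
  have hsq := hd.isSquare h
  rw [e1, hdc] at hsq
  apply h.not_conf12
  refine ⟨_, _, _, _, _, _, _, hsq, isTriangle_across h hc, ?_, ?_, h3, ?_, ?_, ?_⟩
  · rwa [pm_across h rfl (P.edge_eq d).symm]
  · rwa [← e1, ← edge_fc]
  · rwa [edge_tail]
  · rwa [Sym2.eq_swap, ← e3]
  · rwa [pm_head h hc]

theorem conf12_head (h : IsPrimeTarget P m) {d c : P.graph.Dart} (hd : Quad d)
    (hdc : P.fc (P.fc d) = c) (hc : Tri c.symm) :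
    ¬ (2 ≤ pm m d ∧ 2 ≤ m (P.fc c).edge ∧ m c.edge = 2 ∧ m (P.nx.symm c.symm).edge = 2 ∧
      m (P.fc d).edge ≤ 3 ∧ 3 ≤ pm m (P.nx c)) := by
  rintro ⟨h1, h2, h3, h4, h5, h6⟩
  have e1 : (P.fc d).snd = c.fst := fc_snd_of_fc_eq hdc
  have e3 := hd.edge
  rw [hdc] at e3
  have hsq := hd.isSquare h
  rw [e1, hdc] at hsq
  apply h.not_conf12
  refine ⟨_, _, _, _, _, _, _, hsq.flip, (isTriangle_across h hc).flip, ?_, ?_, ?_, ?_, ?_, ?_⟩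
  · rwa [Sym2.eq_swap, pm_across h rfl (P.edge_eq d).symm]
  · rwa [Sym2.eq_swap, ← e3]
  · rwa [Sym2.eq_swap]
  · rwa [edge_head hc]
  · rwa [← e1, ← edge_fc]
  · rwa [pm_tail h]

/-- The boundary is read from `d` in both directions. -/
theorem conf13 (h : IsPrimeTarget P m) {d : P.graph.Dart} (hd : Pent d)
    (h1 : m (P.fc d).edge ≤ m d.edge)
    (h2 : m (P.fc (P.fc (P.fc (P.fc d)))).edge ≤ m d.edge) :
    (8 ≤ m d.edge + m (P.fc d).edge + m (P.fc (P.fc d)).edge →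
      pm m d + pm m (P.fc (P.fc (P.fc d))) ≤ 6) ∧
    (8 ≤ m d.edge + m (P.fc (P.fc (P.fc (P.fc d)))).edge + m (P.fc (P.fc (P.fc d))).edge →
      pm m d + pm m (P.fc (P.fc d)) ≤ 6) := by
  have hp := hd.isPentagon h
  constructor <;> intro h8 <;> by_contra hno <;> apply h.not_conf13
  · refine ⟨_, _, _, _, _, _, hp, ?_, ?_, ?_⟩
    · rw [← edge_fc, ← hd.edge, ← P.edge_eq]
      exact max_le h1 h2
    · rwa [← edge_fc, ← edge_fc, ← P.edge_eq]
    · rw [pm_across h rfl (P.edge_eq d).symm, ← edge_fc, mp_eq_pm h (by simp)]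
      omega
  · refine ⟨_, _, _, _, _, _, hp.flip, ?_, ?_, ?_⟩
    · rw [Sym2.eq_swap (b := d.fst), Sym2.eq_swap (b := d.snd), Sym2.eq_swap (a := d.fst),
        ← edge_fc, ← hd.edge, ← P.edge_eq]
      exact max_le h2 h1
    · rw [Sym2.eq_swap (a := d.snd) (b := d.fst),
        Sym2.eq_swap (a := d.fst) (b := (P.fc (P.fc (P.fc d))).snd),
        Sym2.eq_swap (b := (P.fc (P.fc d)).snd), ← edge_fc, ← hd.edge, ← P.edge_eq]
      exact h8
    · rw [Sym2.eq_swap, pm_across h rfl (P.edge_eq d).symm, Sym2.eq_swap, ← edge_fc,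
        mp_eq_pm h (by simp)]
      omega

theorem conf3 (h : IsPrimeTarget P m) {d : P.graph.Dart} (h1 : Tri d) (h2 : Tri d.symm) :
    m d.edge + m (P.fc d).edge + m (P.fc (P.fc d)).edge + m (P.nx d).edge ≤ 7 ∧
      m d.edge + m (P.fc d).edge + m (P.fc (P.fc d)).edge + m (P.nx.symm d.symm).edge ≤ 7 := by
  constructor <;> by_contra hno <;> apply h.not_conf3
  · refine ⟨_, _, _, _, _, _, P.side_symm_ne h.threeConnected d, (h1.isTriangle h).flip.rotate,
      isTriangle_across h h2, ?_⟩
    rw [edge_tail, Sym2.eq_swap (a := d.fst) (b := (P.fc d).snd), ← h1.edge, ← P.edge_eq,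
      Sym2.eq_swap (b := d.snd), ← edge_fc]
    omega
  · refine ⟨_, _, _, _, _, _, P.side_symm_ne h.threeConnected d, (h1.isTriangle h).rotate,
      (isTriangle_across h h2).flip, ?_⟩
    rw [edge_head h2, ← h1.edge, ← edge_fc, Sym2.eq_swap (a := d.snd) (b := d.fst), ← P.edge_eq]
    omega

theorem conf5 (h : IsPrimeTarget P m) {d : P.graph.Dart} (h1 : Tri d) (h2 : Tri d.symm) :
    pm m (P.fc (P.fc d)) + m d.edge + pm m (P.fc.symm d.symm) ≤ 6 ∧
      pm m (P.fc d) + m d.edge + pm m (P.nx d) ≤ 6 := by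
  constructor <;> by_contra hno <;> apply h.not_conf5
  · refine ⟨_, _, _, _, _, _, P.side_symm_ne h.threeConnected d, (h1.isTriangle h).flip.rotate,
      isTriangle_across h h2, ?_⟩
    rw [Sym2.eq_swap (a := d.fst) (b := (P.fc d).snd), ← h1.edge, ← P.edge_eq,
      mp_eq_pm h (by simp), pm_head h h2]
    omega
  · refine ⟨_, _, _, _, _, _, P.side_symm_ne h.threeConnected d, (h1.isTriangle h).rotate,
      (isTriangle_across h h2).flip, ?_⟩
    rw [← edge_fc, Sym2.eq_swap (a := d.snd) (b := d.fst), ← P.edge_eq,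
      mp_eq_pm h (by simp), pm_tail h]
    omega

theorem conf7 (h : IsPrimeTarget P m) {d : P.graph.Dart} (h1 : Tri d) :
    pm m d + pm m (P.fc d) ≤ 6 := by
  by_contra hno
  apply h.not_conf7
  refine ⟨_, _, _, _, (h1.isTriangle h).flip, ?_⟩
  rw [← edge_fc, Sym2.eq_swap, ← P.edge_eq, mp_eq_pm h rfl, mp_eq_pm h (by simp)]
  omega

theorem conf1 (h : IsPrimeTarget P m) {d : P.graph.Dart} (h1 : Tri d) :
    ¬ (P.deg d.fst = 3 ∧ P.deg d.snd = 3) := fun hno =>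
  h.not_conf1 ⟨_, _, _, _, h1.isTriangle h, hno.1, hno.2⟩

theorem conf2 (h : IsPrimeTarget P m) {d x : P.graph.Dart} (h1 : Tri d) (hdeg : P.deg d.fst = 3)
    (hx : x.fst = d.fst) (hxd : x ≠ d) (hxd' : x ≠ (P.fc (P.fc d)).symm) :
    m d.edge + m (P.fc d).edge ≤ m x.edge ∧
      m (P.fc (P.fc d)).edge + m (P.fc d).edge ≤ m x.edge := by
  have ex : s(d.fst, x.snd) = x.edge := by rw [← hx, P.edge_eq]
  have hadj : P.graph.Adj d.fst x.snd := hx ▸ x.adj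
  have n1 : x.snd ≠ d.snd := fun h' => hxd (P.dart_ext hx h')
  have n2 : x.snd ≠ (P.fc d).snd := fun h' => hxd' (P.dart_ext
    (hx.trans (fc_snd_of_fc_eq (d := P.fc (P.fc d)) h1).symm)
    (h'.trans (P.fc_fst (P.fc d)).symm))
  constructor <;> by_contra hno <;> apply h.not_conf2
  · refine ⟨_, _, _, _, x.snd, (h1.isTriangle h).flip.rotate, hdeg, hadj, n2, n1, ?_⟩
    rw [ex, ← P.edge_eq, Sym2.eq_swap, ← edge_fc]
    omega
  · refine ⟨_, _, _, _, x.snd, h1.isTriangle h, hdeg, hadj, n1, n2, ?_⟩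
    rw [ex, ← edge_fc, Sym2.eq_swap, ← h1.edge]
    omega

theorem conf8 (h : IsPrimeTarget P m) {d e : P.graph.Dart} (h1 : Tri d) (hd : m d.edge = 3)
    (hd1 : m (P.fc d).edge = 2) (hd2 : m (P.fc (P.fc d)).edge = 2) (he : P.side e = P.side d) :
    ¬ P.NoDoorOff m (P.side e.symm) d.fst d.snd (P.fc d).snd := by
  intro hno
  apply h.not_conf8
  refine ⟨_, _, _, _, h1.isTriangle h, hd, ?_, ?_, e.edge, ⟨e, he, rfl⟩, _, ?_, hno⟩
  · rwa [Sym2.eq_swap, ← h1.edge]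
  · rwa [← edge_fc]
  · rw [← he]
    exact (isSecond_iff h.threeConnected).2 rfl

theorem conf9 (h : IsPrimeTarget P m) {d : P.graph.Dart} (h1 : Tri d) (hd : m d.edge = 2)
    (hd1 : m (P.fc d).edge = 2) (hd2 : m (P.fc (P.fc d)).edge = 2) (hdeg : 4 ≤ P.deg d.fst) :
    (2 ≤ {f | P.Door m (P.side d.symm) f}.ncard ∨
      ¬ P.NoDoorOff m (P.side d.symm) d.fst d.snd (P.fc d).snd) ∨
    (2 ≤ {f | P.Door m (P.side (P.fc (P.fc d)).symm) f}.ncard ∨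
      ¬ P.NoDoorOff m (P.side (P.fc (P.fc d)).symm) d.fst d.snd (P.fc d).snd) := by
  by_contra! hno
  apply h.not_conf9
  refine ⟨_, _, _, _, h1.isTriangle h, hd, ?_, ?_, hdeg, _, _,
    (isSecond_iff h.threeConnected).2 rfl, ?_, by omega, hno.1.2, ?_, hno.2.2⟩
  · rwa [Sym2.eq_swap, ← h1.edge]
  · rwa [← edge_fc]
  · rw [Sym2.eq_swap, ← h1.edge, ← P.side_fc d, ← P.side_fc (P.fc d)]
    exact (isSecond_iff h.threeConnected).2 rfl
  · have := hno.2.1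
    omega

theorem conf14 (h : IsPrimeTarget P m) {d : P.graph.Dart} (hd : 6 ≤ pm m d) :
    7 ≤ {f | P.Door m (P.side d) f ∧ EdgeDisjoint d.edge f}.ncard := by
  by_contra hno
  apply h.not_conf14
  refine ⟨_, _, edge_mem_bd d, ?_, by omega⟩
  rwa [mp_eq_pm h rfl]

/-- The odd cut around a triangle. -/
theorem tri_sum_le (h : IsPrimeTarget P m) {d : P.graph.Dart} (hd : Tri d) :
    m d.edge + m (P.fc d).edge + m (P.fc (P.fc d)).edge ≤ 7 := by
  classical
  have : Fintype V := Fintype.ofFinite V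
  have h3 := h.threeConnected
  set a := P.fc d with ha
  set b := P.fc a with hb
  have a1 : a.fst = d.snd := P.fc_fst d
  have b1 : b.fst = a.snd := P.fc_fst a
  have b2 : b.snd = d.fst := fc_snd_of_fc_eq hd
  have n1 : d.fst ≠ d.snd := d.adj.ne
  have n2 : d.snd ≠ a.snd := a1 ▸ a.adj.ne
  have n3 : d.fst ≠ a.snd := by
    rw [← b1, ← b2]
    exact b.adj.ne'
  let X : Finset V := {d.fst, d.snd, a.snd}
  have hX : X.card = 3 := by
    rw [Finset.card_insert_of_notMem (by simp [n1, n3]),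
      Finset.card_insert_of_notMem (by simp [n2]), Finset.card_singleton]
  have hc1 : (X : Set V).ncard = 3 := by rw [Set.ncard_coe_finset, hX]
  -- Six vertices leave at least three outside the triangle, so the stronger cut bound of ten
  -- applies.
  have hc2 : (X : Set V)ᶜ.ncard ≠ 1 := by
    have h1 := Set.ncard_add_ncard_compl (X : Set V)
    have h2 := h.six_le_card
    omega
  have hcut := h.oddCut X (by rw [hc1]; decide) (by omega) hc2
  rw [totalMult_cutEdges] at hcut
  -- The three vertices carry 24 in all, and the edges of the triangle are counted from both ends.
  -- So a triangle of total s leaves at most 24 − 2s for the cut, and ten are required.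
  have hall : ∑ e : P.graph.Dart with e.fst ∈ X, m e.edge = 24 := by
    have h1 : (Finset.univ.filter fun e : P.graph.Dart => e.fst ∈ X) =
        X.biUnion fun v => Finset.univ.filter fun e : P.graph.Dart => e.fst = v := by
      ext e; simp
    rw [h1, Finset.sum_biUnion, Finset.sum_congr rfl fun v _ => P.sum_at_vertex h.target v,
      Finset.sum_const, hX]
    · rfl
    · intro v _ w _ hvw
      rw [Function.onFun, Finset.disjoint_left]
      intro e he he'
      simp only [Finset.mem_filter, Finset.mem_univ, true_and] at he he'
      exact hvw (he.symm.trans he')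
  rw [← Finset.sum_filter_add_sum_filter_not _ (fun e : P.graph.Dart => e.snd ∈ X),
    Finset.filter_filter, Finset.filter_filter] at hall
  have hin : 2 * (m d.edge + m a.edge + m b.edge) ≤
      ∑ e : P.graph.Dart with e.fst ∈ X ∧ e.snd ∈ X, m e.edge := by
    have hsub : ({d, a, b} ∪ {d.symm, a.symm, b.symm} : Finset P.graph.Dart) ⊆
        Finset.univ.filter fun e : P.graph.Dart => e.fst ∈ X ∧ e.snd ∈ X := by
      intro e he
      simp only [Finset.mem_union, Finset.mem_insert, Finset.mem_singleton] at he
      rcases he with (rfl | rfl | rfl) | (rfl | rfl | rfl) <;> simp [X, a1, b1, b2]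
    refine le_trans (le_of_eq ?_) (Finset.sum_le_sum_of_subset hsub)
    have m1 : a ≠ d := P.fc_ne d
    have m2 : b ≠ a := P.fc_ne a
    have m3 : b ≠ d := P.fc_fc_ne h3 d
    have hsymm := (SimpleGraph.Dart.symm_involutive (G := P.graph)).injective
    rw [Finset.sum_union, Finset.sum_insert (by simp [m1.symm, m3.symm]),
      Finset.sum_insert (by simp [m2.symm]), Finset.sum_singleton,
      Finset.sum_insert (by simp [hsymm.eq_iff, m1.symm, m3.symm]),
      Finset.sum_insert (by simp [hsymm.eq_iff, m2.symm]), Finset.sum_singleton, SimpleGraph.Dart.edge_symm, SimpleGraph.Dart.edge_symm,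
      SimpleGraph.Dart.edge_symm]
    · ring
    · rw [Finset.disjoint_left]
      intro e he he'
      have s1 : P.side e = P.side d := by
        simp only [Finset.mem_insert, Finset.mem_singleton] at he
        rcases he with rfl | rfl | rfl <;> simp [ha, hb]
      have s2 : P.side e.symm = P.side d := by
        simp only [Finset.mem_insert, Finset.mem_singleton] at he'
        rcases he' with rfl | rfl | rfl <;> simp [ha, hb]
      exact P.side_symm_ne h3 e (s1.trans s2.symm)
  simp only [Finset.mem_coe] at hcut
  omega

end PlaneGraph

/-! ### A finite model of the boundary of a small region, and the exhaustive searches. -/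

/-- What a small region sees at one of its edges: the multiplicity `m`; the kind `k` of the region
across (`1`: big, `2`: a triangle that gives a charge, `0`: any other small region); and for a
triangle the multiplicities `l`, `r` of its other edges, at the tail and at the head, together with
the statuses `lb`, `rb` of the regions across these edges (`0`: small, `1`: big, `2`: unknown). -/
structure EdgeData where
  m : ℕ
  k : ℕ
  l : ℕ
  lb : ℕ
  r : ℕ
  rb : ℕ

namespace EdgeData

/-- Comparison, with a fast evaluation. -/
def leb (a b : ℕ) : Bool := Nat.ble a b

/-- Equality, with a fast evaluation. -/
def eqb (a b : ℕ) : Bool := Nat.beq a b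

/-- The number of a truth value. -/
def cnt (b : Bool) : ℕ := cond b 1 0

/-- Two statuses do not contradict each other. -/
def agree (x y : ℕ) : Bool := eqb x 2 || eqb y 2 || eqb x y

/-- The part of an edge of multiplicity `a` in what a big region gives away at a corner with an edge
of multiplicity `e`; the flag tells whether the first edge is a door. -/
def share (a e : ℕ) (door : Bool) : ℕ :=
  cond (eqb a 1) (cond door (cond (leb e 2) 1 0) (cond (leb e 3) 2 1)) <|
  cond (eqb a 2) (cond (leb e 3) 2 (cond (leb e 4) 1 0)) <|
  cond (eqb a 3) (cond (leb e 1) 2 (cond (leb e 3) 1 0)) <|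
  cond (leb a 5) 1 0

variable (t u : EdgeData)

/-- The value `m⁺` of the edge. -/
def pm : ℕ := cond (eqb t.k 1) t.m (t.m + 1)

/-- The edge is `i`-heavy. -/
def heavy (i : ℕ) : Bool := leb i t.m || (eqb t.k 2 && leb i (t.m + min t.l t.r))

/-- A lower bound for `m⁺` of the edge of the triangle at the tail. -/
def pl : ℕ := cond (eqb t.lb 0) (t.l + 1) t.l

/-- A lower bound for `m⁺` of the edge of the triangle at the head. -/
def pr : ℕ := cond (eqb t.rb 0) (t.r + 1) t.r

/-- What a small region receives over an edge from the triangle across it. The flags tell whether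
the neighbouring edges of the region have multiplicity four, or one, and whether the region has two
doors or a door disjoint from the triangle. -/
def recv (nl4 nr4 nl1 nr1 elig : Bool) : ℕ :=
  cond (eqb t.m 1)
    (cond (eqb t.l t.r) 2 <|
    cond (eqb t.l 4 || eqb t.r 4) 2 <|
    cond (eqb t.l 3)
      (cond (eqb t.lb 0) (cond nl4 0 2) (cond (nl4 || eqb t.r 2) 1 0)) <|
    cond (eqb t.rb 0) (cond nr4 0 2) (cond (nr4 || eqb t.l 2) 1 0)) <|
  cond (eqb t.l t.r)
    (cond (eqb t.lb 0 && eqb t.rb 0) (cond (nl4 || nr4 || elig) 2 0)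
      (cond ((eqb t.lb 1 && nl4) || (eqb t.rb 1 && nr4)) 1 0)) <|
  cond (eqb t.l 2 || eqb t.r 2) 2 <|
  cond (eqb t.l 3) (cond nl1 1 0) (cond nr1 1 0)

/-- The triangles that give a charge. -/
def senders : List EdgeData :=
  [⟨1, 2, 3, 0, 1, 2⟩, ⟨1, 2, 3, 1, 1, 2⟩, ⟨1, 2, 4, 1, 1, 2⟩,
   ⟨1, 2, 1, 2, 3, 0⟩, ⟨1, 2, 1, 2, 3, 1⟩, ⟨1, 2, 1, 2, 4, 1⟩,
   ⟨1, 2, 2, 0, 2, 0⟩, ⟨1, 2, 3, 1, 3, 1⟩,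
   ⟨1, 2, 3, 1, 2, 0⟩, ⟨1, 2, 3, 0, 2, 1⟩, ⟨1, 2, 4, 1, 2, 1⟩,
   ⟨1, 2, 2, 0, 3, 1⟩, ⟨1, 2, 2, 1, 3, 0⟩, ⟨1, 2, 2, 1, 4, 1⟩,
   ⟨2, 2, 2, 0, 2, 0⟩, ⟨2, 2, 2, 1, 2, 0⟩, ⟨2, 2, 2, 0, 2, 1⟩, ⟨2, 2, 2, 1, 2, 1⟩,
   ⟨2, 2, 3, 1, 2, 2⟩, ⟨2, 2, 2, 2, 3, 1⟩, ⟨2, 2, 3, 1, 1, 2⟩, ⟨2, 2, 1, 2, 3, 1⟩]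

/-- All the data of edges of small regions. -/
def all : List EdgeData :=
  [⟨1, 0, 0, 0, 0, 0⟩, ⟨2, 0, 0, 0, 0, 0⟩, ⟨3, 0, 0, 0, 0, 0⟩, ⟨4, 0, 0, 0, 0, 0⟩,
   ⟨1, 1, 0, 0, 0, 0⟩, ⟨2, 1, 0, 0, 0, 0⟩, ⟨3, 1, 0, 0, 0, 0⟩, ⟨4, 1, 0, 0, 0, 0⟩,
   ⟨5, 1, 0, 0, 0, 0⟩] ++ senders

/-- A lower bound for the share at the corner of `t` with an edge with data `u`, where `f` is the
multiplicity of the third edge of the triangle across `u` at that corner. -/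
def shareBound (f : ℕ) (door : Bool) : ℕ :=
  share t.m (cond (eqb u.k 2)
    (cond (eqb (t.m + u.m + f) 8) f (8 - (t.m + u.m + f))) (8 - (t.m + u.m))) door

/-- A lower bound for what an edge takes from the charge of its region; `p` and `n` describe the
previous and the next edge. -/
def cost (p n : EdgeData) (door elig : Bool) : ℕ :=
  cond (eqb t.k 1) (8 + (shareBound t p p.r door + shareBound t n n.l door) - 2 * t.m)
    (8 - 2 * t.m -
      cond (eqb t.k 2) (recv t (eqb p.m 4) (eqb n.m 4) (eqb p.m 1) (eqb n.m 1) elig) 0)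

/-- A lower bound for what an edge takes from the charge of its region. -/
def lo : ℕ :=
  cond (eqb t.k 0) (8 - 2 * t.m) <|
  cond (eqb t.k 1) (cond (eqb t.m 5) 0 <| cond (eqb t.m 4) 2 <| 8 - 2 * t.m) <|
  cond (eqb t.m 1)
    (cond (!eqb t.l t.r && ((eqb t.l 3 && eqb t.lb 1) || (eqb t.r 3 && eqb t.rb 1))) 5 4) <|
  cond ((eqb t.l t.r && (!eqb t.lb 0 || !eqb t.rb 0)) || eqb t.l 1 || eqb t.r 1) 3 2

/-- Can `u` be next to `t`? -/
def fits : Bool :=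
  leb (t.m + u.m) 7 &&
  cond (eqb t.k 2)
    (cond (eqb u.k 2)
      (leb (t.m + u.m + t.r + u.l) 7 ||
        (eqb (t.m + u.m + t.r + u.l) 8 && agree t.rb u.lb) ||
        (eqb t.r u.l && eqb (t.m + u.m + t.r) 8 && agree t.rb 0 && agree u.lb 0 &&
          leb (max t.m t.r + t.l) u.m && leb (max u.m u.l + u.r) t.m))
      (leb (t.m + u.m + t.r) 7 || (eqb (t.m + u.m + t.r) 8 && agree t.rb (cnt (eqb u.k 1)) &&
        leb (max t.m t.r + t.l) u.m)))
    (cond (eqb u.k 2)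
      (leb (t.m + u.m + u.l) 7 || (eqb (t.m + u.m + u.l) 8 && agree u.lb (cnt (eqb t.k 1)) &&
        leb (max u.m u.l + u.r) t.m))
      true)

/-- Can the edge be a door for its region? -/
def isDoor : Bool := eqb t.m 1 && !eqb t.k 2

/-- A triangle with multiplicities two, two, three. -/
def isH : Bool := eqb t.k 2 && eqb t.m 2 && eqb (t.l + t.r) 5

/-- The edge `a` of a square is excluded by the opposite edge `c`. -/
def badPair (a c : EdgeData) : Bool := leb 7 (a.pm + c.pm) || (leb 4 a.pm && c.heavy 3)

/-- The square with edges `a`, `b`, `c`, `d` is excluded by its sides `a`, `b` and `d`. -/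
def badPath (a b c d : EdgeData) : Bool :=
  leb 8 (a.m + b.m + d.m) && !(eqb a.m 4 && eqb b.m 2 && eqb c.m 1 && eqb d.m 2)

/-- The square is excluded by the triangle across its edge `a`. -/
def badTri (a b c d : EdgeData) : Bool :=
  (leb a.r a.l && leb d.m a.l && ((leb 4 (a.m + a.pl) && b.heavy 3 && c.heavy 3) ||
    (leb 5 (a.m + a.pl) && leb 2 b.pm && leb 2 c.pm && (b.heavy 3 || c.heavy 3)))) ||
  (leb a.l a.r && leb b.m a.r && ((leb 4 (a.m + a.pr) && c.heavy 3 && d.heavy 3) ||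
    (leb 5 (a.m + a.pr) && leb 2 c.pm && leb 2 d.pm && (c.heavy 3 || d.heavy 3)))) ||
  (isH a && !isDoor c) ||
  (eqb a.m 2 && eqb c.m 2 && ((eqb a.r 2 && eqb d.m 4) || (eqb a.l 2 && eqb b.m 4))) ||
  (eqb a.m 1 && leb 3 c.m && ((leb 3 a.l && leb b.m 3 && leb 3 a.pr) ||
    (leb 3 a.r && leb d.m 3 && leb 3 a.pl))) ||
  (eqb a.m 2 && leb 2 c.pm && ((leb 2 d.m && eqb a.l 2 && leb b.m 3 && leb 3 a.pr) ||
    (leb 2 b.m && eqb a.r 2 && leb d.m 3 && leb 3 a.pl)))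

/-- The cost of the edge `a` of a square. -/
def cost4 (a b c d : EdgeData) : ℕ :=
  cost a d b (eqb c.m 1) (isDoor c ||
    leb 2 (cnt (isDoor a) + cnt (isDoor b) + cnt (isDoor c) + cnt (isDoor d)))

/-- The cost of an edge, without information about doors. -/
def cost0 (p t n : EdgeData) : ℕ := cost t p n true true

/-- The edges that can be between `a` and `c` in a square in which `a` has the least `lo`. -/
def mid4 (a x y : EdgeData) : List EdgeData :=
  all.filter fun b => leb (lo a) (lo b) && (fits x b && fits b y)

/-- Every admissible square whose first edge has the least `lo` is excluded or takes enough. -/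
def check4 : Bool :=
  all.all fun a => (all.filter fun c => leb (lo a) (lo c) && (!badPair a c && !badPair c a)).all
    fun c => (mid4 a a c).all fun b => leb 16 (lo a + cost0 a b c + lo c + lo a) ||
      (mid4 a c a).all fun d =>
        leb 16 (lo a + cost0 a b c + lo c + cost0 c d a) ||
        leb 16 (cost0 d a b + cost0 a b c + cost0 b c d + cost0 c d a) ||
        badPath a b c d || badPath b c d a || badPath c d a b || badPath d a b c ||
        badPair b d || badPair d b ||
        (eqb a.k 2 && badTri a b c d) || (eqb b.k 2 && badTri b c d a) ||
        (eqb c.k 2 && badTri c d a b) || (eqb d.k 2 && badTri d a b c) ||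
        leb 16 (cost4 a b c d + cost4 b c d a + cost4 c d a b + cost4 d a b c)

/-- The edge `a` of a region of length five is excluded by the disjoint edges `c` and `d`. -/
def badFar (a c d : EdgeData) : Bool :=
  (leb 4 a.pm && c.heavy 3 && d.heavy 3) ||
  (leb 5 a.pm && ((leb 2 c.pm && leb 2 d.pm && (c.heavy 3 || d.heavy 3)) ||
    (c.heavy 2 && d.heavy 2)))

/-- The region of length five is excluded by three consecutive edges. -/
def badPath5 (a b c d e : EdgeData) : Bool :=
  leb b.m a.m && leb e.m a.m && ((leb 8 (a.m + b.m + c.m) && leb 7 (a.pm + d.pm)) ||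
    (leb 8 (a.m + e.m + d.m) && leb 7 (a.pm + c.pm)))

/-- The region of length five is excluded by the triangle across its edge `a`. -/
def badTri5 (a b c d e : EdgeData) : Bool :=
  (leb a.r a.l && leb e.m a.l && ((leb 4 (a.m + a.pl) && b.heavy 3 && c.heavy 3 && d.heavy 3) ||
    (leb 5 (a.m + a.pl) && leb 2 b.pm && leb 2 c.pm && leb 2 d.pm &&
      leb 2 (cnt (b.heavy 3) + cnt (c.heavy 3) + cnt (d.heavy 3))))) ||
  (leb a.l a.r && leb b.m a.r && ((leb 4 (a.m + a.pr) && c.heavy 3 && d.heavy 3 && e.heavy 3) ||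
    (leb 5 (a.m + a.pr) && leb 2 c.pm && leb 2 d.pm && leb 2 e.pm &&
      leb 2 (cnt (c.heavy 3) + cnt (d.heavy 3) + cnt (e.heavy 3))))) ||
  (isH a && !isDoor c && !isDoor d)

/-- The region of length five is excluded. -/
def bad5 (a b c d e : EdgeData) : Bool :=
  badFar a c d || badPath5 a b c d e || (eqb a.k 2 && badTri5 a b c d e)

/-- The cost of the edge `a` of a region of length five. -/
def cost5 (a b c d e : EdgeData) : ℕ :=
  cost a e b (eqb c.m 1 || eqb d.m 1) (isDoor c || isDoor d || leb 2 (cnt (isDoor a) +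
    cnt (isDoor b) + cnt (isDoor c) + cnt (isDoor d) + cnt (isDoor e)))

/-- The edges that can follow `x`, and are `3`-heavy or not as told by the flag. -/
def next5 (q : Bool) (x : EdgeData) : List EdgeData :=
  all.filter fun y => (y.heavy 3 == q) && fits x y

/-- The `3`-heavy edges that can be between `x` and `y`. -/
def mid5 (x y : EdgeData) : List EdgeData :=
  all.filter fun z => z.heavy 3 && (fits x z && fits z y)

/-- Every admissible region of length five with exactly two edges that are not `3`-heavy, with `a`
one of them and `b` the other or a `3`-heavy edge as told by the flag, is excluded or takes
enough. -/
def check5 (q : Bool) : Bool :=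
  all.all fun a => a.heavy 3 || (next5 q a).all fun b => (next5 (!q) b).all fun c =>
    leb 16 (lo a + cost0 a b c + lo c) || (next5 true c).all fun d =>
      badFar a c d || leb 16 (lo a + cost0 a b c + cost0 b c d + lo d) ||
      (mid5 d a).all fun e =>
        leb 16 (cost0 e a b + cost0 a b c + cost0 b c d + cost0 c d e + cost0 d e a) ||
        bad5 a b c d e || bad5 b c d e a || bad5 c d e a b || bad5 d e a b c ||
        bad5 e a b c d ||
        leb 16 (cost5 a b c d e + cost5 b c d e a + cost5 c d e a b + cost5 d e a b c +
          cost5 e a b c d)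

/-- The triangle with edges `a`, `b`, `c` is excluded by the triangle across `a`. -/
def badTri3 (a b c : EdgeData) : Bool :=
  leb 8 (a.m + b.m + c.m + a.l) || leb 8 (a.m + b.m + c.m + a.r) ||
  leb 8 (a.m + a.l + a.r + b.m) || leb 8 (a.m + a.l + a.r + c.m) ||
  leb 7 (c.pm + a.m + a.pr) || leb 7 (b.pm + a.m + a.pl) || isH a ||
  (leb a.r a.l && leb c.m a.l && leb 4 (a.m + a.pl) && b.heavy 3) ||
  (leb a.l a.r && leb b.m a.r && leb 4 (a.m + a.pr) && c.heavy 3)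

/-- Every admissible triangle that receives a charge over its first edge is excluded or takes
enough. -/
def check3 : Bool :=
  senders.all fun a => (all.filter fun b => fits a b && leb (a.pm + b.pm) 6).all fun b =>
    (all.filter fun c => fits b c && fits c a && leb (b.pm + c.pm) 6 && leb (c.pm + a.pm) 6).all
      fun c => leb 8 (a.m + b.m + c.m) || badTri3 a b c || (eqb b.k 2 && badTri3 b c a) ||
        (eqb c.k 2 && badTri3 c a b) ||
        leb 16 (cost a c b false true + cost b a c false true + cost c b a false true)

/-- Is the data that of a triangle that gives a charge? -/
def sends : Bool :=
  senders.any fun s => eqb t.m s.m && eqb t.l s.l && eqb t.r s.r && agree t.lb s.lb &&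
    agree t.rb s.rb

/-- What a triangle with edges of multiplicity `a`, `b`, `c`, where `b`, `c` are next to the head
and the tail of `a`, gives over the edge `a`, or receives from the big region across it. The
statuses of the edges are `sa`, `sb`, `sc`, the next edges of the region across `a` have
multiplicities `x` and `y`. -/
def give (a sa b sb c sc x y : ℕ) (elig : Bool) : ℕ :=
  cond (eqb sa 1) (share a x false + share a y false)
    (cond (sends ⟨a, 2, b, sb, c, sc⟩)
      (recv ⟨a, 2, b, sb, c, sc⟩ (eqb x 4) (eqb y 4) (eqb x 1) (eqb y 1) elig) 0)

/-- The possible multiplicities of the edges next to the corner of a triangle between edges of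
multiplicities `a` and `b`, with `c` the multiplicity of the third edge. The flag tells that the
corner has degree three. -/
def corners (a b c : ℕ) : List (ℕ × ℕ × Bool) :=
  cond (leb (max a b + c) (8 - (a + b))) [(8 - (a + b), 8 - (a + b), true)] [] ++
  ([1, 2, 3, 4, 5, 6].flatMap fun x => ([1, 2, 3, 4, 5, 6].filter fun y =>
    leb (a + b + x + y) 8).map fun y => (x, y, false))

/-- Every triangle with a largest edge `a` gives at most what it can. -/
def check1 : Bool :=
  [1, 2, 3, 4, 5].all fun a => ([1, 2, 3, 4, 5].filter fun b => leb b a).all fun b =>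
    ([1, 2, 3, 4, 5].filter fun c => leb c a && leb 5 (a + b + c) && leb (a + b + c) 7).all fun c =>
    [0, 1].all fun sa => ([0, 1].filter fun sb => leb (a + b) (4 + sa + sb)).all fun sb =>
    ([0, 1].filter fun sc => leb (a + c) (4 + sa + sc) && leb (b + c) (4 + sb + sc)).all fun sc =>
    (corners a b c).all fun p => (corners c a b).all fun r => (p.2.2 && r.2.2) ||
    [true, false].all fun ea =>
    leb (2 * (a + b + c)) (8 + give a sa b sb c sc p.1 r.2.1 ea) ||
    (corners b c a).all fun q => ((p.2.2 || r.2.2) && q.2.2) ||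
    [true, false].all fun eb => [true, false].all fun ec =>
    (eqb a 2 && eqb b 2 && eqb c 2 && !((p.2.2 || ea || eb) && (q.2.2 || eb || ec) &&
      (r.2.2 || ec || ea))) ||
    leb (2 * (a + b + c)) (8 + (give a sa b sb c sc p.1 r.2.1 ea +
      give b sb c sc a sa q.1 p.2.1 eb + give c sc a sa b sb r.1 q.2.1 ec))

set_option maxRecDepth 100000 in
-- The searches are closed Boolean terms for the kernel to evaluate. Their size is controlled by
-- testing cheap partial sums before further edges are chosen, and by normalising the first edge: a
-- largest edge in `check1`, one across which charge is received in `check3`, one with least `lo` in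
-- `check4`, a light one in `check5`.
theorem check1_eq : check1 = true := by decide +kernel

set_option maxRecDepth 100000 in
theorem check3_eq : check3 = true := by decide +kernel

set_option maxRecDepth 100000 in
theorem check4_eq : check4 = true := by decide +kernel

set_option maxRecDepth 100000 in
theorem check5_true : check5 true = true := by decide +kernel

set_option maxRecDepth 100000 in
theorem check5_false : check5 false = true := by decide +kernel

end EdgeData

/-! ### From the model to the graph: the discharging rule. -/

namespace EdgeData

theorem leb_iff {a b : ℕ} : leb a b = true ↔ a ≤ b := iff_of_eq Nat.ble_eq

theorem eqb_iff {a b : ℕ} : eqb a b = true ↔ a = b := iff_of_eq Nat.beq_eq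

/-- The data `e` of an actual triangle fit to an entry `s` of the list of triangles. -/
def Matches (e s : EdgeData) : Prop :=
  e.m = s.m ∧ e.l = s.l ∧ e.r = s.r ∧ agree e.lb s.lb = true ∧ agree e.rb s.rb = true

/-- The charge that a corner of a big region keeps, for edges of multiplicities `a` and `e`, is at
most zero, and smaller if there are doors. The flags `da`, `de` tell whether the edges are doors, and
`ga`, `ge` whether the regions across them are small. -/
def cornerFine (a e : ℕ) (da de ga ge : Bool) : Bool :=
  leb 8 (a + e) || (da && !eqb a 1) || (de && !eqb e 1) ||
    (leb (cnt da + cnt de + a + cond ga (share a e da) 0 + e + cond ge (share e a de) 0) 8 &&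
      ((da && leb 6 (cond ge (e + 1) e)) || (de && leb 6 (cond ga (a + 1) a)) ||
        leb (2 * (cnt da + cnt de) + a + cond ga (share a e da) 0 + e +
          cond ge (share e a de) 0) 8))

/-- The arguments are shifted because multiplicities run from one to six. This is the numerical
content of `big_region`. -/
theorem corner_charge (da de ga ge : Bool) : ∀ a < 6, ∀ e < 6,
    cornerFine (a + 1) (e + 1) da de ga ge = true := by
  cases da <;> cases de <;> cases ga <;> cases ge <;> decide +kernel

end EdgeData

namespace PlaneGraph

open EdgeData

variable {V : Type*} {P : PlaneGraph V} (m : Sym2 V → ℕ)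

open Classical in
/-- The status of the region across the edge of `d`. -/
noncomputable def st (d : P.graph.Dart) : ℕ := if Bg m d then 1 else 0

open Classical in
/-- The data of the edge of `d`, as seen from the region on the side of `d`. -/
noncomputable def ed (d : P.graph.Dart) : EdgeData where
  m := m d.edge
  k := if Bg m d then 1 else if Tri d.symm then 2 else 0
  l := m (P.nx d).edge
  lb := st m (P.nx d)
  r := m (P.nx.symm d.symm).edge
  rb := st m (P.fc.symm d.symm)

/-- The region on the side of `d` has two doors, or a door disjoint from the triangle across `d`. -/
def Elig (d : P.graph.Dart) : Prop :=
  2 ≤ {f | P.Door m (P.side d) f}.ncard ∨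
    ¬ P.NoDoorOff m (P.side d) d.fst d.snd (P.nx d).snd

open Classical in
/-- What the region of `d` receives over the edge of `d` if both its regions are small. -/
noncomputable def recvD (d : P.graph.Dart) : ℕ :=
  if Tri d.symm ∧ ∃ s ∈ senders, Matches (ed m d) s then
    (ed m d).recv (eqb (m (P.fc.symm d).edge) 4) (eqb (m (P.fc d).edge) 4)
      (eqb (m (P.fc.symm d).edge) 1) (eqb (m (P.fc d).edge) 1) (decide (Elig m d))
  else 0

open Classical in
/-- What the region of `d` gives away over the edge of `d` if it is big and the other is small. -/
noncomputable def out (d : P.graph.Dart) : ℕ :=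
  share (m d.edge) (m (P.fc.symm d).edge) (decide (P.Door m (P.side d) d.edge)) +
    share (m d.edge) (m (P.fc d).edge) (decide (P.Door m (P.side d) d.edge))

open Classical in
/-- The charge that crosses the edge of `d` out of its region. -/
noncomputable def beta (d : P.graph.Dart) : ℤ :=
  if P.Big m (P.side d) then (if Bg m d then 0 else out m d)
  else if Bg m d then - out m d.symm else recvD m d - recvD m d.symm

/-- Antisymmetry means that the exchange across each edge conserves charge, as
`exists_positive_region` demands. -/
theorem beta_symm (d : P.graph.Dart) : beta m d.symm = - beta m d := by
  unfold beta Bg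
  rw [SimpleGraph.Dart.symm_symm]
  by_cases h1 : P.Big m (P.side d) <;> by_cases h2 : P.Big m (P.side d.symm) <;> simp [h1, h2]

variable {m}

open Classical in
theorem pm_eq_cond (d : P.graph.Dart) :
    pm m d = cond (decide (¬ Bg m d)) (m d.edge + 1) (m d.edge) := by
  unfold pm
  by_cases hb : Bg m d <;> simp [hb]

end PlaneGraph

namespace EdgeData

theorem leb_false {a b : ℕ} : leb a b = false ↔ b < a := by
  rw [← Bool.not_eq_true, leb_iff, not_le]

theorem eqb_false {a b : ℕ} : eqb a b = false ↔ a ≠ b := by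
  rw [← Bool.not_eq_true, eqb_iff]

end EdgeData

/-! ### Big regions. -/

namespace PlaneGraph

open EdgeData

variable {V : Type*} [Finite V] {P : PlaneGraph V} {m : Sym2 V → ℕ}

theorem mult_le (h : IsPrimeTarget P m) (d : P.graph.Dart) : m d.edge ≤ 6 :=
  h.mult_le _ d.edge_mem

/-- The common end has a third edge, of multiplicity at least one. -/
theorem adjacent_le (h : IsPrimeTarget P m) (d : P.graph.Dart) :
    m d.edge + m (P.fc d).edge ≤ 7 := by
  have h1 := mult_pos h (P.nx.symm d.symm)
  rcases corner h d with h' | h' <;> omega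

/-- `P.fc` permutes the darts of a region, so contributions placed at tails of edges can be
regrouped with those at the preceding heads. -/
theorem sum_faceDarts_fc (r : P.Region) (f : P.graph.Dart → ℤ) :
    ∑ d ∈ faceDarts r, f (P.fc d) = ∑ d ∈ faceDarts r, f d :=
  Finset.sum_equiv P.fc (by simp) fun _ _ => rfl

open Classical in
theorem ncard_doors_le (r : P.Region) :
    {f | P.Door m r f}.ncard ≤
      ((faceDarts r).filter fun d => P.Door m r d.edge).card := by
  have hsub : {f | P.Door m r f} ⊆
      (((faceDarts r).filter fun d => P.Door m r d.edge).image fun d => d.edge :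
        Finset (Sym2 V)) := by
    intro f hf
    obtain ⟨⟨d, hd, rfl⟩, -⟩ := id hf
    simp only [Finset.coe_image, Set.mem_image, Finset.mem_coe, Finset.mem_filter, mem_faceDarts]
    exact ⟨d, ⟨hd, hf⟩, rfl⟩
  calc _ ≤ _ := Set.ncard_le_ncard hsub (Finset.finite_toSet _)
    _ ≤ _ := by
      rw [Set.ncard_coe_finset]
      exact Finset.card_image_le

/-- If a door is next to an edge with large `m⁺`, then there are at least eight doors. -/
theorem eight_doors (h : IsPrimeTarget P m) {r : P.Region} {d e : P.graph.Dart}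
    (hd : P.side d = r) (hp : 6 ≤ pm m d) (he : P.Door m r e.edge)
    (hde : e = P.fc d ∨ e = P.fc.symm d) : 8 ≤ {f | P.Door m r f}.ncard := by
  subst hd
  have h1 := conf14 h hp
  have h2 : e.edge ∉ {f | P.Door m (P.side d) f ∧ EdgeDisjoint d.edge f} := by
    rintro ⟨-, hdis⟩
    rcases hde with rfl | rfl
    · exact (ne_of_edgeDisjoint hdis).2.1 rfl
    · exact (ne_of_edgeDisjoint hdis).2.2 rfl
  have h3 := Set.ncard_insert_of_notMem h2 (Set.toFinite _)
  have h4 : insert e.edge {f | P.Door m (P.side d) f ∧ EdgeDisjoint d.edge f} ⊆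
      {f | P.Door m (P.side d) f} := by
    rintro f (rfl | hf)
    · exact he
    · exact hf.1
  have h5 := Set.ncard_le_ncard h4 (Set.toFinite _)
  omega

open Classical in
theorem corner_fine (h : IsPrimeTarget P m) (d : P.graph.Dart) :
    cornerFine (m d.edge) (m (P.fc d).edge) (decide (P.Door m (P.side d) d.edge))
      (decide (P.Door m (P.side d) (P.fc d).edge)) (decide (¬ Bg m d))
      (decide (¬ Bg m (P.fc d))) = true := by
  have h1 := mult_pos h d
  have h2 := mult_le h d
  have h3 := mult_pos h (P.fc d)
  have h4 := mult_le h (P.fc d)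
  have := corner_charge (decide (P.Door m (P.side d) d.edge))
      (decide (P.Door m (P.side d) (P.fc d).edge)) (decide (¬ Bg m d))
      (decide (¬ Bg m (P.fc d))) (m d.edge - 1) (by omega) (m (P.fc d).edge - 1) (by omega)
  rwa [Nat.sub_add_cancel h1, Nat.sub_add_cancel h3] at this

open Classical in
/-- A big region does not keep a positive charge. -/
theorem big_region (h : IsPrimeTarget P m) {r : P.Region} (hb : P.Big m r) :
    16 ≤ ∑ d ∈ faceDarts r, (8 - 2 * (m d.edge : ℤ) - beta m d) := by
  have hD : 4 ≤ {f | P.Door m r f}.ncard := hb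
  have hDle := ncard_doors_le (m := m) r
  let w : P.graph.Dart → ℤ := fun d => cnt (decide (P.Door m r d.edge))
  have hw : ∑ d ∈ faceDarts r, w d =
      (((faceDarts r).filter fun d => P.Door m r d.edge).card : ℤ) := by
    rw [Finset.card_filter, Nat.cast_sum]
    apply Finset.sum_congr rfl
    intro d _
    by_cases hd : P.Door m r d.edge <;> simp [w, hd, cnt]
  -- The contribution of an edge is halved: `s₁` sits at its tail and `s₂` at its head, each with
  -- its own `share`. A corner then carries `s₂ d + s₁ (P.fc d)`.
  let s₁ : P.graph.Dart → ℤ := fun d => 4 - m d.edge -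
    cond (decide (¬ Bg m d)) (share (m d.edge) (m (P.fc.symm d).edge)
      (decide (P.Door m r d.edge)) : ℤ) 0
  let s₂ : P.graph.Dart → ℤ := fun d => 4 - m d.edge -
    cond (decide (¬ Bg m d)) (share (m d.edge) (m (P.fc d).edge)
      (decide (P.Door m r d.edge)) : ℤ) 0
  have hsum : ∑ d ∈ faceDarts r, (8 - 2 * (m d.edge : ℤ) - beta m d) =
      ∑ d ∈ faceDarts r, (s₂ d + s₁ (P.fc d)) := by
    rw [Finset.sum_add_distrib, sum_faceDarts_fc, ← Finset.sum_add_distrib]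
    apply Finset.sum_congr rfl
    intro d hd
    have hd' : P.side d = r := mem_faceDarts.1 hd
    simp only [beta, s₁, s₂, out, hd', if_pos hb]
    by_cases hg : Bg m d
    · simp only [hg, if_true, not_true_eq_false, decide_false, cond_false]
      ring
    · simp only [hg, if_false, not_false_eq_true, decide_true, cond_true]
      push_cast
      ring
  have hws : ∑ d ∈ faceDarts r, (w d + w (P.fc d)) = 2 * ∑ d ∈ faceDarts r, w d := by
    rw [Finset.sum_add_distrib, sum_faceDarts_fc]
    ring
  -- A corner is worth at least the number of doors among its two edges, and twice that number when
  -- there are fewer than eight doors: the only exceptions in `cornerFine` have a door next to an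
  -- edge with `m⁺` at least six, where `eight_doors` applies. Each door lies at two corners, which
  -- gives 2·8 or 4·4.
  have key : ∀ d ∈ faceDarts r, w d + w (P.fc d) ≤ s₂ d + s₁ (P.fc d) ∧
      (({f | P.Door m r f}.ncard < 8) → 2 * (w d + w (P.fc d)) ≤ s₂ d + s₁ (P.fc d)) := by
    intro d hd
    have hd' : P.side d = r := mem_faceDarts.1 hd
    have hfine := corner_fine h d
    have hadj := adjacent_le h d
    have e1 : ∀ x : ℕ, ∀ b : Bool, (cond b (x : ℤ) 0) = ((cond b x 0 : ℕ) : ℤ) := by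
      intro x b; cases b <;> rfl
    simp only [cornerFine, Bool.or_eq_true, Bool.and_eq_true, leb_iff, Bool.not_eq_true', eqb_false,
      ← pm_eq_cond, hd', decide_eq_true_eq] at hfine
    simp only [w, s₁, s₂, Equiv.symm_apply_apply, e1]
    rcases hfine with ((h1 | h1) | h1) | ⟨h1, h2⟩
    · omega
    · exact absurd h1.1.2.1 h1.2
    · exact absurd h1.1.2.1 h1.2
    · refine ⟨by omega, fun hlt => ?_⟩
      rcases h2 with (h2 | h2) | h2
      · have := eight_doors h (d := P.fc d) (by simpa using hd') h2.2 h2.1 (Or.inr (by simp))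
        omega
      · have := eight_doors h (d := d) hd' h2.2 h2.1 (Or.inl rfl)
        omega
      · omega
  rw [hsum]
  by_cases h8 : {f | P.Door m r f}.ncard < 8
  · have := Finset.sum_le_sum fun d hd => (key d hd).2 h8
    rw [← Finset.mul_sum, hws, hw] at this
    omega
  · have := Finset.sum_le_sum fun d hd => (key d hd).1
    rw [hws, hw] at this
    omega

end PlaneGraph

/-! ### Monotonicity and tables for the model. -/

namespace EdgeData

/-- An upper bound on the neighbouring edge of the big region thus bounds the share from below. Only
threshold comparisons of `e` occur, so once their implications are recorded the claim is one about
truth values. -/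
theorem share_antitone {e e' : ℕ} {b b' : Bool} (a : ℕ) (he : e ≤ e') (hb : b = true → b' = true) :
    share a e' b' ≤ share a e b := by
  have key : ∀ i : ℕ, leb e' i = true → leb e i = true := fun i hi =>
    leb_iff.2 (he.trans (leb_iff.1 hi))
  have k1 := key 1
  have k2 := key 2
  have k3 := key 3
  have k4 := key 4
  have k34 : leb e 3 = true → leb e 4 = true := fun hi =>
    leb_iff.2 ((leb_iff.1 hi).trans (by norm_num))
  have k13 : leb e 1 = true → leb e 3 = true := fun hi =>
    leb_iff.2 ((leb_iff.1 hi).trans (by norm_num))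
  have k23 : leb e 2 = true → leb e 3 = true := fun hi =>
    leb_iff.2 ((leb_iff.1 hi).trans (by norm_num))
  unfold share
  generalize eqb a 1 = a1
  generalize eqb a 2 = a2
  generalize eqb a 3 = a3
  generalize leb a 5 = a5
  generalize leb e 1 = e1 at *
  generalize leb e 2 = e2 at *
  generalize leb e 3 = e3 at *
  generalize leb e 4 = e4 at *
  generalize leb e' 1 = f1 at *
  generalize leb e' 2 = f2 at *
  generalize leb e' 3 = f3 at *
  generalize leb e' 4 = f4 at *
  cases a1
  · cases a2
    · cases a3
      · exact le_rfl
      · cases f1 <;> cases f3 <;> cases e1 <;> cases e3 <;> simp_all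
    · cases f3 <;> cases f4 <;> cases e3 <;> cases e4 <;> simp_all
  · cases b <;> cases b' <;> cases f2 <;> cases f3 <;> cases e2 <;> cases e3 <;> simp_all

theorem agree_zero {x : ℕ} (hx : x ≤ 1) : agree x 0 = true ↔ x = 0 := by
  interval_cases x <;> decide

theorem agree_one {x : ℕ} (hx : x ≤ 1) : agree x 1 = true ↔ x = 1 := by
  interval_cases x <;> decide

theorem agree_trans {x y z : ℕ} (hx : x ≤ 1) (h : agree x y = true) (h' : x = z) :
    agree y z = true := by
  subst h'
  simp only [agree, Bool.or_eq_true, eqb_iff] at h ⊢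
  omega

theorem agree_of_agree {x y z : ℕ} (hx : x ≤ 1) (h : agree x y = true) (h' : agree x z = true) :
    agree y z = true := by
  simp only [agree, Bool.or_eq_true, eqb_iff] at h h' ⊢
  omega

theorem senders_kind : ∀ s ∈ senders, s.k = 2 := by
  intro s hs
  fin_cases hs <;> rfl

/-- An entry of `senders` leaves a status unknown only where `recv` does not depend on it, so the
entry can replace the actual data. -/
theorem recv_of_matches {e : EdgeData} (hl : e.lb ≤ 1) (hr : e.rb ≤ 1) {s : EdgeData}
    (hs : s ∈ senders) (h : Matches e s) (a b c d f : Bool) :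
    e.recv a b c d f = s.recv a b c d f := by
  obtain ⟨m, k, l, lb, r, rb⟩ := e
  obtain ⟨h1, h2, h3, h4, h5⟩ := h
  simp only at h1 h2 h3 h4 h5 hl hr
  subst h1 h2 h3
  fin_cases hs <;>
  simp only [agree_zero hl, agree_zero hr, agree_one hl, agree_one hr] at h4 h5 <;>
  (try subst h4) <;> (try subst h5) <;> rfl

/-- A table of bounds over all triangles that give a charge. -/
def sendersFine : Bool :=
  senders.all fun s => [true, false].all fun a => [true, false].all fun b =>
    [true, false].all fun c => [true, false].all fun d => [true, false].all fun f =>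
      leb (s.recv a b c d f + lo s) (8 - 2 * s.m) && leb (s.recv a b c d false) (s.recv a b c d f)

theorem senders_fine : sendersFine = true := by decide +kernel

/-- The first bound justifies `lo` and keeps the natural subtraction in `cost` from truncating. The
second makes it safe to assume eligibility when nothing is known about it. -/
theorem recv_bounds {s : EdgeData} (hs : s ∈ senders) (a b c d f : Bool) :
    s.recv a b c d f + lo s ≤ 8 - 2 * s.m ∧ s.recv a b c d false ≤ s.recv a b c d f := by
  have hB : ∀ b : Bool, b ∈ [true, false] := by decide
  have := senders_fine
  simp only [sendersFine, List.all_eq_true, Bool.and_eq_true, leb_iff] at this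
  exact this s hs a (hB a) b (hB b) c (hB c) d (hB d) f (hB f)

theorem mem_all_cases {t : EdgeData} (ht : t ∈ all) (h2 : t.k = 2) : t ∈ senders := by
  rw [all, List.mem_append] at ht
  rcases ht with ht | ht
  · exfalso
    fin_cases ht <;> exact absurd h2 (by decide)
  · exact ht

theorem mem_all_kind {t : EdgeData} (ht : t ∈ all) :
    (t.k = 0 ∧ 1 ≤ t.m ∧ t.m ≤ 4) ∨ (t.k = 1 ∧ 1 ≤ t.m ∧ t.m ≤ 5) ∨
      (t.k = 2 ∧ 1 ≤ t.m ∧ t.m ≤ 2) := by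
  fin_cases ht <;> decide

end EdgeData

/-! ### What a small region sees. -/

namespace PlaneGraph

open EdgeData

variable {V : Type*} {P : PlaneGraph V} {m : Sym2 V → ℕ}

theorem st_le_one (d : P.graph.Dart) : st m d ≤ 1 := by
  unfold st
  split_ifs <;> norm_num

theorem st_eq {d e : P.graph.Dart} (h : P.side d.symm = P.side e.symm) : st m d = st m e := by
  unfold st Bg
  rw [h]

open Classical in
theorem st_eq_cnt (d : P.graph.Dart) : st m d = cnt (decide (Bg m d)) := by
  unfold st
  by_cases h : Bg m d <;> simp [h, cnt]

variable (m) in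
open Classical in
/-- The entry `t` of the list describes the edge of `d`. -/
structure Sees (d : P.graph.Dart) (t : EdgeData) : Prop where
  mem : t ∈ all
  hm : t.m = m d.edge
  big : t.k = 1 ↔ Bg m d
  tri : t.k = 2 → Tri d.symm ∧ Matches (ed m d) t
  recv : ¬ Bg m d → recvD m d = cond (eqb t.k 2) (t.recv (eqb (m (P.fc.symm d).edge) 4)
    (eqb (m (P.fc d).edge) 4) (eqb (m (P.fc.symm d).edge) 1) (eqb (m (P.fc d).edge) 1)
    (decide (Elig m d))) 0

theorem Sees.pm_eq {d : P.graph.Dart} {t : EdgeData} (hs : Sees m d t) : t.pm = pm m d := by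
  unfold EdgeData.pm PlaneGraph.pm
  by_cases hb : Bg m d
  · rw [if_pos hb, eqb_iff.2 (hs.big.2 hb), cond_true, hs.hm]
  · rw [if_neg hb, eqb_false.2 (fun h => hb (hs.big.1 h)), cond_false, hs.hm]

theorem Sees.hv {d : P.graph.Dart} {t : EdgeData} (hs : Sees m d t) {i : ℕ}
    (ht : t.heavy i = true) : Hv m i d := by
  simp only [EdgeData.heavy, Bool.or_eq_true, Bool.and_eq_true, leb_iff, eqb_iff] at ht
  rcases ht with ht | ⟨hk, ht⟩
  · exact Or.inl (hs.hm ▸ ht)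
  · obtain ⟨htri, h1, h2, h3, -, -⟩ := hs.tri hk
    right
    refine ⟨htri, ?_⟩
    rw [← h1, ← h2, ← h3] at ht
    exact ht

theorem Sees.pl_le {d : P.graph.Dart} {t : EdgeData} (hs : Sees m d t) (hk : t.k = 2) :
    t.pl ≤ pm m (P.nx d) := by
  obtain ⟨htri, h1, h2, h3, h4, h5⟩ := hs.tri hk
  unfold EdgeData.pl PlaneGraph.pm
  have h2' : m (P.nx d).edge = t.l := h2
  rw [h2']
  by_cases hb : Bg m (P.nx d)
  · have : (ed m d).lb = 1 := by simp [ed, st, hb]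
    rw [this] at h4
    have h0 : eqb t.lb 0 = false := by
      rw [eqb_false]
      simp only [agree, Bool.or_eq_true, eqb_iff] at h4
      omega
    rw [h0, if_pos hb, cond_false]
  · rw [if_neg hb]
    cases eqb t.lb 0 <;> simp

theorem Sees.pr_le {d : P.graph.Dart} {t : EdgeData} (hs : Sees m d t) (hk : t.k = 2) :
    t.pr ≤ pm m (P.fc.symm d.symm) := by
  obtain ⟨htri, h1, h2, h3, h4, h5⟩ := hs.tri hk
  unfold EdgeData.pr PlaneGraph.pm
  have h3' : m (P.fc.symm d.symm).edge = t.r := by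
    rw [edge_fc_inv]
    exact h3
  rw [h3']
  by_cases hb : Bg m (P.fc.symm d.symm)
  · have : (ed m d).rb = 1 := by simp [ed, st, hb]
    rw [this] at h5
    have h0 : eqb t.rb 0 = false := by
      rw [eqb_false]
      simp only [agree, Bool.or_eq_true, eqb_iff] at h5
      omega
    rw [h0, if_pos hb, cond_false]
  · rw [if_neg hb]
    cases eqb t.rb 0 <;> simp

variable [Finite V]

/-- An edge with larger `m⁺` would force seven doors by `conf14`, while four already make a region
big. -/
theorem pm_le_five (h : IsPrimeTarget P m) {d : P.graph.Dart} (hs : ¬ P.Big m (P.side d)) :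
    pm m d ≤ 5 := by
  by_contra hp
  have h1 := conf14 h (d := d) (by omega)
  have h2 : {f | P.Door m (P.side d) f ∧ EdgeDisjoint d.edge f} ⊆ {f | P.Door m (P.side d) f} :=
    fun f hf => hf.1
  have h3 := Set.ncard_le_ncard h2 (Set.toFinite _)
  exact hs (show 4 ≤ _ by omega)

/-- By `pm_le_five` the multiplicity is at most five if the region across is big and at most four if
it is small, so the list `all` is complete. A small triangle that matches no sender gets kind zero,
since nothing comes across from it. -/
theorem exists_sees (h : IsPrimeTarget P m) {d : P.graph.Dart} (hs : ¬ P.Big m (P.side d)) :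
    ∃ t, Sees m d t := by
  classical
  have h1 := pm_le_five h hs
  have h2 := mult_pos h d
  unfold pm at h1
  by_cases hb : Bg m d
  · rw [if_pos hb] at h1
    refine ⟨⟨m d.edge, 1, 0, 0, 0, 0⟩, ?_, rfl, by simp [hb], fun h => absurd h (by simp),
      fun h => absurd hb h⟩
    generalize m d.edge = a at *
    interval_cases a <;> simp [EdgeData.all]
  · rw [if_neg hb] at h1
    by_cases ht : Tri d.symm ∧ ∃ s ∈ senders, Matches (ed m d) s
    · obtain ⟨ht, s, hs, hm⟩ := id ht
      have hk := senders_kind s hs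
      refine ⟨s, List.mem_append.2 (Or.inr hs), hm.1.symm, by simp [hk, hb], fun _ => ⟨ht, hm⟩,
        fun _ => ?_⟩
      rw [hk, recvD, if_pos ⟨ht, s, hs, hm⟩,
        recv_of_matches (st_le_one _) (st_le_one _) hs hm]
      rfl
    · refine ⟨⟨m d.edge, 0, 0, 0, 0, 0⟩, ?_, rfl, by simp [hb], fun h => absurd h (by simp),
        fun _ => by rw [recvD, if_neg ht]; rfl⟩
      generalize m d.edge = a at *
      have : a ≤ 4 := by omega
      interval_cases a <;> simp [EdgeData.all]

theorem fc_ne_inv (h3 : ThreeConnected P.graph) (d : P.graph.Dart) :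
    P.nx.symm d.symm ≠ P.fc d := by
  intro h'
  apply P.nx_nx_ne h3 (P.nx.symm d.symm)
  rw [Equiv.apply_symm_apply]
  exact h'.symm

/-- A triangle across `d` with a corner of degree three at the head of `d`. -/
theorem conf2_head (h : IsPrimeTarget P m) {d : P.graph.Dart} (ht : Tri d.symm)
    (hdeg : P.deg d.snd = 3) :
    m d.edge + m (P.nx d).edge ≤ m (P.fc d).edge ∧
      m (P.nx.symm d.symm).edge + m (P.nx d).edge ≤ m (P.fc d).edge := by
  have e : P.fc (P.fc d.symm) = (P.nx.symm d.symm).symm := by rw [← ht.inv, fc_inv_apply]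
  have h2 := conf2 h ht hdeg (x := P.fc d) (P.fc_fst d) (P.nx_ne h.threeConnected d.symm) (by
    rw [e, SimpleGraph.Dart.symm_symm]
    exact (fc_ne_inv h.threeConnected d).symm)
  rwa [e, SimpleGraph.Dart.edge_symm, SimpleGraph.Dart.edge_symm, fc_symm] at h2

/-- A triangle across `fc d` with a corner of degree three at the head of `d`. -/
theorem conf2_tail (h : IsPrimeTarget P m) {d : P.graph.Dart} (ht : Tri (P.fc d).symm)
    (hdeg : P.deg d.snd = 3) :
    m (P.fc d).edge + m (P.nx.symm (P.fc d).symm).edge ≤ m d.edge ∧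
      m (P.nx (P.fc d)).edge + m (P.nx.symm (P.fc d).symm).edge ≤ m d.edge := by
  have ht' := ht.fc
  rw [fc_symm] at ht'
  have e1 : P.fc (P.nx (P.fc d)) = (P.nx.symm (P.fc d).symm).symm := by
    rw [← fc_inv_apply, ht.inv, fc_symm]
  have e2 : P.fc (P.fc (P.nx (P.fc d))) = (P.fc d).symm := by
    rw [e1, ← fc_inv_apply, Equiv.apply_symm_apply]
  have hf : (P.nx (P.fc d)).fst = d.snd := by simp
  have h2 := conf2 h ht' (hf ▸ hdeg) (x := d.symm) hf.symm
    (fun h' => P.nx_nx_ne h.threeConnected d.symm h'.symm)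
    (by
      rw [e2, SimpleGraph.Dart.symm_symm]
      exact (P.nx_ne h.threeConnected d.symm).symm)
  rw [e2, e1, SimpleGraph.Dart.edge_symm, SimpleGraph.Dart.edge_symm,
    SimpleGraph.Dart.edge_symm] at h2
  exact ⟨h2.2, h2.1⟩

/-- The cases are those of `corner`. At a corner of degree three the third edge is common to both
regions across, the three multiplicities total eight, and `conf2` constrains the triangles.
Otherwise four different edges total at most eight; if exactly eight, there are no further edges,
the two outer ones border a common region, and their statuses agree. -/
theorem Sees.fits (h : IsPrimeTarget P m) {d : P.graph.Dart} {t u : EdgeData} (hd : Sees m d t)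
    (he : Sees m (P.fc d) u) : EdgeData.fits t u = true := by
  classical
  have hadj := adjacent_le h d
  have hx := mult_pos h (P.nx.symm d.symm)
  have hy := mult_pos h (P.nx (P.fc d))
  set x := P.nx.symm d.symm with hxdef
  set e := P.fc d with hedef
  set y := P.nx e with hydef
  have hstx : st m (P.fc.symm d.symm) = st m x.symm := by rw [fc_inv_apply]
  have tm := hd.hm
  have um := he.hm
  have tt : t.k = 2 → Tri d.symm ∧ t.r = m x.edge ∧ t.l = m (P.nx d).edge ∧
      agree (st m x.symm) t.rb = true := fun hk =>
    ⟨(hd.tri hk).1, (hd.tri hk).2.2.2.1.symm, (hd.tri hk).2.2.1.symm,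
      hstx ▸ (hd.tri hk).2.2.2.2.2⟩
  have ut : u.k = 2 → Tri e.symm ∧ u.l = m y.edge ∧ u.r = m (P.nx.symm e.symm).edge ∧
      agree (st m y) u.lb = true := fun hk =>
    ⟨(he.tri hk).1, (he.tri hk).2.2.1.symm, (he.tri hk).2.2.2.1.symm,
      (he.tri hk).2.2.2.2.1⟩
  have ukb : cnt (eqb u.k 1) = st m e := by
    rw [st_eq_cnt]
    congr 1
    rw [Bool.eq_iff_iff, eqb_iff, he.big, decide_eq_true_eq]
  have tkb : cnt (eqb t.k 1) = st m d := by
    rw [st_eq_cnt]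
    congr 1
    rw [Bool.eq_iff_iff, eqb_iff, hd.big, decide_eq_true_eq]
  have ub0 : u.k = 2 → st m e = 0 := fun hk => by
    rw [← ukb, hk]; rfl
  have tb0 : t.k = 2 → st m d = 0 := fun hk => by
    rw [← tkb, hk]; rfl
  have hc2 := conf2_head h (d := d)
  have hc2' := conf2_tail h (d := d)
  have hcor := corner h d
  rw [← hxdef, ← hedef] at hc2 hcor
  rw [← hedef, ← hydef] at hc2'
  rw [← hydef] at hcor
  simp only [EdgeData.fits, Bool.and_eq_true, leb_iff]
  refine ⟨by omega, ?_⟩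
  rcases hcor with ⟨hxy, hsum, hdeg⟩ | ⟨hsum, -, heq⟩
  -- Seen from the region across `d`, the far side of the third edge is the region across `e`, and
  -- conversely.
  · have s1 : st m x.symm = st m e := st_eq (by
      rw [SimpleGraph.Dart.symm_symm, hxy, hydef, side_nx])
    have s2 : st m y = st m d := st_eq (by
      rw [← hxy, ← P.side_nx x, hxdef, Equiv.apply_symm_apply])
    by_cases hk : t.k = 2
    · obtain ⟨t1, t2, t3, t4⟩ := tt hk
      have := hc2 t1 hdeg
      rw [eqb_iff.2 hk, cond_true]
      by_cases hk' : u.k = 2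
      · obtain ⟨u1, u2, u3, u4⟩ := ut hk'
        have := hc2' u1 hdeg
        rw [eqb_iff.2 hk', cond_true]
        simp only [Bool.or_eq_true, Bool.and_eq_true, leb_iff, eqb_iff]
        right
        refine ⟨⟨⟨⟨⟨?_, ?_⟩, ?_⟩, ?_⟩, ?_⟩, ?_⟩
        · rw [t2, u2, hxy]
        · omega
        · exact agree_trans (st_le_one _) t4 (s1.trans (ub0 hk'))
        · exact agree_trans (st_le_one _) u4 (s2.trans (tb0 hk))
        · rw [um, tm, t2, t3]
          omega
        · rw [um, tm, u2, u3]
          omega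
      · rw [eqb_false.2 hk', cond_false]
        simp only [Bool.or_eq_true, Bool.and_eq_true, leb_iff, eqb_iff]
        right
        refine ⟨⟨by omega, ?_⟩, ?_⟩
        · exact agree_trans (st_le_one _) t4 (s1.trans ukb.symm)
        · rw [um, tm, t2, t3]
          omega
    · rw [eqb_false.2 hk, cond_false]
      by_cases hk' : u.k = 2
      · obtain ⟨u1, u2, u3, u4⟩ := ut hk'
        have := hc2' u1 hdeg
        rw [eqb_iff.2 hk', cond_true]
        simp only [Bool.or_eq_true, Bool.and_eq_true, leb_iff, eqb_iff]
        right
        refine ⟨⟨?_, ?_⟩, ?_⟩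
        · rw [u2, ← hxy]; omega
        · exact agree_trans (st_le_one _) u4 (s2.trans tkb.symm)
        · rw [um, tm, u2, u3]
          omega
      · rw [eqb_false.2 hk', cond_false]
  · by_cases hk : t.k = 2
    · obtain ⟨t1, t2, t3, t4⟩ := tt hk
      rw [eqb_iff.2 hk, cond_true]
      by_cases hk' : u.k = 2
      · obtain ⟨u1, u2, u3, u4⟩ := ut hk'
        rw [eqb_iff.2 hk', cond_true]
        simp only [Bool.or_eq_true, Bool.and_eq_true, leb_iff, eqb_iff]
        left
        by_cases h8 : m x.edge + m d.edge + m e.edge + m y.edge = 8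
        · right
          refine ⟨by omega, ?_⟩
          have s1 : st m x.symm = st m y := st_eq (by
            rw [SimpleGraph.Dart.symm_symm, ← heq h8, side_nx])
          exact agree_of_agree (st_le_one _) t4 (s1 ▸ u4)
        · left; omega
      · rw [eqb_false.2 hk', cond_false]
        simp only [Bool.or_eq_true, leb_iff]
        left; omega
    · rw [eqb_false.2 hk, cond_false]
      by_cases hk' : u.k = 2
      · obtain ⟨u1, u2, u3, u4⟩ := ut hk'
        rw [eqb_iff.2 hk', cond_true]
        simp only [Bool.or_eq_true, leb_iff]
        left; omega
      · rw [eqb_false.2 hk', cond_false]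

end PlaneGraph

/-! ### Lower bounds for the toll of an edge. -/

namespace EdgeData

theorem share_four (e : ℕ) (b : Bool) : share 4 e b = 1 := rfl

theorem share_five (e : ℕ) (b : Bool) : share 5 e b = 1 := rfl

end EdgeData

namespace PlaneGraph

open EdgeData

variable {V : Type*} {P : PlaneGraph V} {m : Sym2 V → ℕ}

variable (m) in
/-- What the edge of `d` takes from the charge of its region. -/
noncomputable def toll (d : P.graph.Dart) : ℤ := 8 - 2 * (m d.edge : ℤ) - beta m d

theorem toll_eq_of_big {d : P.graph.Dart} (hs : ¬ P.Big m (P.side d)) (hb : Bg m d) :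
    toll m d = 8 - 2 * (m d.edge : ℤ) + out m d.symm := by
  rw [toll, beta, if_neg hs, if_pos hb]
  ring

theorem toll_eq_of_small {d : P.graph.Dart} (hs : ¬ P.Big m (P.side d)) (hb : ¬ Bg m d) :
    toll m d = 8 - 2 * (m d.edge : ℤ) - recvD m d + recvD m d.symm := by
  rw [toll, beta, if_neg hs, if_neg hb]
  ring

/-- Next to a big region, an edge of multiplicity four or five has share one at both ends whatever
its neighbours, which lifts 8 − 2m to two or zero. For a giving triangle the bound is the table
`recv_bounds`. -/
theorem Sees.lo_le {d : P.graph.Dart} (hs : ¬ P.Big m (P.side d))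
    {t : EdgeData} (ht : Sees m d t) : (lo t : ℤ) ≤ toll m d := by
  classical
  have hk := mem_all_kind ht.mem
  have hm := ht.hm
  by_cases hb : Bg m d
  · have hk1 := ht.big.2 hb
    rw [toll_eq_of_big hs hb, lo, eqb_false.2 (by omega), cond_false, eqb_iff.2 hk1, cond_true, out,
      SimpleGraph.Dart.edge_symm, hm]
    have h5 : m d.edge ≤ 5 := by omega
    by_cases h3 : m d.edge ≤ 3
    · rw [eqb_false.2 (by omega), eqb_false.2 (by omega), cond_false, cond_false]
      omega
    · have : m d.edge = 4 ∨ m d.edge = 5 := by omega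
      rcases this with h4 | h4 <;> rw [h4]
      · rw [share_four, share_four, eqb_false.2 (by norm_num), eqb_iff.2 rfl]
        rfl
      · rw [share_five, share_five, eqb_iff.2 rfl]
        rfl
  · have hk1 : t.k ≠ 1 := fun h1 => hb (ht.big.1 h1)
    rw [toll_eq_of_small hs hb, ht.recv hb]
    by_cases hk2 : t.k = 2
    · rw [eqb_iff.2 hk2, cond_true]
      have hsend := mem_all_cases ht.mem hk2
      have := (recv_bounds hsend (eqb (m (P.fc.symm d).edge) 4) (eqb (m (P.fc d).edge) 4)
          (eqb (m (P.fc.symm d).edge) 1) (eqb (m (P.fc d).edge) 1) (decide (Elig m d))).1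
      omega
    · have hk0 : t.k = 0 := by omega
      rw [eqb_false.2 hk2, cond_false, lo, hk0, eqb_iff.2 rfl, cond_true]
      omega

variable [Finite V]

/-- The share depends on the edge of the big region at this corner. Either the vertex has degree
three and that edge is the one seen in the triangle across the next edge, or the total of eight at
the vertex bounds it. -/
theorem Sees.share_head (h : IsPrimeTarget P m) {d : P.graph.Dart} {t n : EdgeData}
    (ht : Sees m d t) (hn : Sees m (P.fc d) n) {b b' : Bool} (hb : b = true → b' = true) :
    shareBound t n n.l b' ≤ share (m d.edge) (m (P.fc.symm d.symm).edge) b := by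
  rw [shareBound, ht.hm, hn.hm, edge_fc_inv]
  apply share_antitone _ _ hb
  have hy := mult_pos h (P.nx (P.fc d))
  have hx := mult_pos h (P.nx.symm d.symm)
  have hl : n.k = 2 → n.l = m (P.nx (P.fc d)).edge := fun hk => (hn.tri hk).2.2.1.symm
  by_cases hk : n.k = 2
  · rw [eqb_iff.2 hk, cond_true, hl hk]
    rcases corner h d with ⟨hxy, hsum, -⟩ | ⟨hsum, -, -⟩
    · rw [hxy] at hsum ⊢
      rw [eqb_iff.2 (by omega), cond_true]
    · rw [eqb_false.2 (by omega), cond_false]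
      omega
  · rw [eqb_false.2 hk, cond_false]
    rcases corner h d with ⟨hxy, hsum, -⟩ | ⟨hsum, -, -⟩ <;> omega

theorem Sees.share_tail (h : IsPrimeTarget P m) {d : P.graph.Dart} {t p : EdgeData}
    (ht : Sees m d t) (hp : Sees m (P.fc.symm d) p) {b b' : Bool} (hb : b = true → b' = true) :
    shareBound t p p.r b' ≤ share (m d.edge) (m (P.fc d.symm).edge) b := by
  set c := P.fc.symm d with hc
  have hcd : P.fc c = d := by rw [hc, Equiv.apply_symm_apply]
  rw [shareBound, ht.hm, hp.hm, fc_symm]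
  apply share_antitone _ _ hb
  have hcor := corner h c
  rw [hcd] at hcor
  have hx := mult_pos h (P.nx.symm c.symm)
  have hr : p.k = 2 → p.r = m (P.nx.symm c.symm).edge := fun hk => (hp.tri hk).2.2.2.1.symm
  by_cases hk : p.k = 2
  · rw [eqb_iff.2 hk, cond_true, hr hk]
    rcases hcor with ⟨hxy, hsum, -⟩ | ⟨hsum, -, -⟩
    · rw [← hxy]
      rw [eqb_iff.2 (by omega), cond_true]
    · rw [eqb_false.2 (by have := mult_pos h (P.nx d); omega), cond_false]
      omega
  · rw [eqb_false.2 hk, cond_false]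
    rcases hcor with ⟨hxy, hsum, -⟩ | ⟨hsum, -, -⟩
    · rw [hxy] at hsum
      omega
    · omega

/-- What the region itself sends to a small neighbour only raises the toll and is dropped. Setting a
flag too generously is safe: `door` lowers shares and `elig` raises receipts. -/
theorem Sees.cost_le (h : IsPrimeTarget P m) {d : P.graph.Dart} (hs : ¬ P.Big m (P.side d))
    {t p n : EdgeData} (ht : Sees m d t) (hp : Sees m (P.fc.symm d) p) (hn : Sees m (P.fc d) n)
    {door elig : Bool} (hdoor : Bg m d → P.Door m (P.side d.symm) d.edge → door = true)
    (helig : Elig m d → elig = true) : (cost t p n door elig : ℤ) ≤ toll m d := by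
  classical
  have hk := mem_all_kind ht.mem
  have hm := ht.hm
  by_cases hb : Bg m d
  · rw [toll_eq_of_big hs hb, cost, eqb_iff.2 (ht.big.2 hb), cond_true, out,
      SimpleGraph.Dart.edge_symm]
    have hb' : decide (P.Door m (P.side d.symm) d.edge) = true → door = true := fun hd =>
      hdoor hb (of_decide_eq_true hd)
    have h1 := ht.share_head h hn hb'
    have h2 := ht.share_tail h hp hb'
    have h3 : 2 * m d.edge ≤ 8 + (share (m d.edge) (m (P.fc.symm d.symm).edge)
        (decide (P.Door m (P.side d.symm) d.edge)) + share (m d.edge) (m (P.fc d.symm).edge)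
        (decide (P.Door m (P.side d.symm) d.edge))) := by
      by_cases h5 : m d.edge ≤ 4
      · omega
      · have : m d.edge = 5 := by omega
        rw [this, share_five, share_five]
    push_cast
    omega
  · have hk1 : t.k ≠ 1 := fun h1 => hb (ht.big.1 h1)
    rw [toll_eq_of_small hs hb, cost, eqb_false.2 hk1, cond_false, ht.recv hb]
    by_cases hk2 : t.k = 2
    · rw [eqb_iff.2 hk2, cond_true, cond_true, hp.hm, hn.hm]
      have hsend := mem_all_cases ht.mem hk2
      have hle : t.recv (eqb (m (P.fc.symm d).edge) 4) (eqb (m (P.fc d).edge) 4)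
          (eqb (m (P.fc.symm d).edge) 1) (eqb (m (P.fc d).edge) 1) (decide (Elig m d)) ≤
          t.recv (eqb (m (P.fc.symm d).edge) 4) (eqb (m (P.fc d).edge) 4)
          (eqb (m (P.fc.symm d).edge) 1) (eqb (m (P.fc d).edge) 1) elig := by
        by_cases he : Elig m d
        · rw [helig he, decide_eq_true he]
        · rw [decide_eq_false he]
          exact (recv_bounds hsend _ _ _ _ _).2
      have := (recv_bounds hsend (eqb (m (P.fc.symm d).edge) 4) (eqb (m (P.fc d).edge) 4)
          (eqb (m (P.fc.symm d).edge) 1) (eqb (m (P.fc d).edge) 1) elig).1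
      omega
    · rw [eqb_false.2 hk2, cond_false, cond_false]
      omega

end PlaneGraph

/-! ### Doors. -/

namespace PlaneGraph

open EdgeData

variable {V : Type*} {P : PlaneGraph V} {m : Sym2 V → ℕ}

theorem far_of_notMem {d b : P.graph.Dart} (hs : P.side b = P.side d) (h1 : d.fst ∉ b.edge)
    (h2 : d.snd ∉ b.edge) : Far d b := by
  refine ⟨hs, ?_, ?_, ?_⟩ <;> rintro rfl
  · exact h1 (P.mem_edge.2 (Or.inl rfl))
  · exact h2 (P.mem_edge.2 (Or.inl (by simp)))
  · exact h1 (P.mem_edge.2 (Or.inr (by simp)))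

theorem exists_of_not_noDoorOff {r : P.Region} {u v w : V} (hn : ¬ P.NoDoorOff m r u v w)
    {d : P.graph.Dart} (hr : P.side d = r) (hu : d.fst = u ∨ d.fst = v ∨ d.fst = w)
    (hv : d.snd = u ∨ d.snd = v ∨ d.snd = w) : ∃ b, Far d b ∧ P.Door m (P.side d) b.edge := by
  subst hr
  unfold NoDoorOff at hn
  rw [not_not] at hn
  obtain ⟨f, hf, h1, h2, h3⟩ := hn
  obtain ⟨⟨b, hb, rfl⟩, -⟩ := id hf
  refine ⟨b, far_of_notMem hb ?_ ?_, hf⟩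
  · rcases hu with h' | h' | h' <;> rwa [h']
  · rcases hv with h' | h' | h' <;> rwa [h']

theorem Elig.cases {d : P.graph.Dart} (he : Elig m d) :
    2 ≤ {f | P.Door m (P.side d) f}.ncard ∨ ∃ b, Far d b ∧ P.Door m (P.side d) b.edge :=
  he.imp id fun hn => exists_of_not_noDoorOff hn rfl (Or.inl rfl) (Or.inr (Or.inl rfl))

theorem side_door {d b : P.graph.Dart} (hb : Far d b) (hd : P.Door m (P.side d) b.edge) :
    P.Door m (P.side b) b.edge := by
  rwa [hb.1]

variable [Finite V]

/-- If an edge is a door for the region across it, then its own region has a disjoint edge of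
multiplicity one. -/
theorem exists_far_of_door_across (h : IsPrimeTarget P m) {d : P.graph.Dart}
    (hd : P.Door m (P.side d.symm) d.edge) : ∃ b, Far d b ∧ m b.edge = 1 := by
  obtain ⟨-, -, r', hr', f, ⟨b, hb, rfl⟩, hdis, hm⟩ := hd
  rw [← SimpleGraph.Dart.edge_symm, isSecond_iff h.threeConnected,
    SimpleGraph.Dart.symm_symm] at hr'
  exact ⟨b, far_of_edgeDisjoint (hb.trans hr') hdis, hm⟩

/-- A door needs a disjoint edge on the region across, and a triangle has none. -/
theorem not_tri_of_door (h : IsPrimeTarget P m) {b : P.graph.Dart}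
    (hd : P.Door m (P.side b) b.edge) : ¬ Tri b.symm := by
  intro ht
  obtain ⟨-, -, r', hr', f, ⟨c, hc, rfl⟩, hdis, -⟩ := hd
  rw [isSecond_iff h.threeConnected] at hr'
  rw [← SimpleGraph.Dart.edge_symm] at hdis
  have := ne_of_edgeDisjoint hdis
  rcases ht.side_eq_iff.1 (hc.trans hr') with rfl | rfl | rfl
  · exact this.1 rfl
  · exact this.2.1 rfl
  · exact this.2.2 ht.inv.symm

theorem Sees.isDoor (h : IsPrimeTarget P m) {b : P.graph.Dart} {t : EdgeData} (ht : Sees m b t)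
    (hd : P.Door m (P.side b) b.edge) : t.isDoor = true := by
  have h1 := not_tri_of_door h hd
  have h2 : t.k ≠ 2 := fun hk => h1 (ht.tri hk).1
  rw [EdgeData.isDoor, eqb_iff.2 (ht.hm.trans hd.2.1), eqb_false.2 h2]
  rfl

/-- A triangle with multiplicities two, two, three across an edge of multiplicity two. -/
theorem exists_door_of_conf8 (h : IsPrimeTarget P m) {d : P.graph.Dart} (ht : Tri d.symm)
    (h1 : m d.edge = 2) (h2 : (m (P.nx d).edge = 3 ∧ m (P.nx.symm d.symm).edge = 2) ∨
      (m (P.nx d).edge = 2 ∧ m (P.nx.symm d.symm).edge = 3)) :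
    ∃ b, Far d b ∧ P.Door m (P.side d) b.edge := by
  have e : P.fc (P.fc d.symm) = (P.nx.symm d.symm).symm := by rw [← ht.inv, fc_inv_apply]
  have e' : P.fc (P.fc (P.fc d.symm)) = d.symm := ht
  rcases h2 with ⟨h2, h3⟩ | ⟨h2, h3⟩
  · have := conf8 h (d := P.fc d.symm) (e := d.symm) ht.fc (by rwa [fc_symm])
      (by rw [e, SimpleGraph.Dart.edge_symm, h3]) (by rw [e', SimpleGraph.Dart.edge_symm, h1])
      (by simp)
    rw [SimpleGraph.Dart.symm_symm] at this
    exact exists_of_not_noDoorOff this rfl (Or.inl (by simp)) (Or.inr (Or.inr (by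
      rw [← P.fc_fst (P.fc (P.fc d.symm)), e']; rfl)))
  · have := conf8 h (d := P.fc (P.fc d.symm)) (e := d.symm) ht.fc.fc
      (by rw [e, SimpleGraph.Dart.edge_symm, h3]) (by rw [e', SimpleGraph.Dart.edge_symm, h1])
      (by rw [e', fc_symm, h2]) (by simp)
    rw [SimpleGraph.Dart.symm_symm] at this
    refine exists_of_not_noDoorOff this rfl (Or.inr (Or.inr ?_)) (Or.inr (Or.inl ?_))
    · rw [e']; rfl
    · rw [← P.fc_fst (P.fc (P.fc d.symm)), e']; rfl

open Classical in
theorem doors_le_sum {r : P.Region} {f : P.graph.Dart → ℤ}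
    (hf : ∀ d ∈ faceDarts r, (P.Door m r d.edge → 1 ≤ f d) ∧ 0 ≤ f d) :
    ({f | P.Door m r f}.ncard : ℤ) ≤ ∑ d ∈ faceDarts r, f d := by
  have h1 := ncard_doors_le (m := m) r
  have h2 : (((faceDarts r).filter fun d => P.Door m r d.edge).card : ℤ) ≤
      ∑ d ∈ faceDarts r, f d := by
    rw [Finset.card_filter, Nat.cast_sum]
    apply Finset.sum_le_sum
    intro d hd
    have := hf d hd
    split_ifs with hdoor
    · exact_mod_cast this.1 hdoor
    · exact_mod_cast this.2
  omega

theorem senders_isH : ∀ s ∈ senders, isH s = true →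
    s.m = 2 ∧ ((s.l = 3 ∧ s.r = 2) ∨ (s.l = 2 ∧ s.r = 3)) := by
  decide

theorem Sees.exists_door_of_isH (h : IsPrimeTarget P m) {d : P.graph.Dart} {t : EdgeData}
    (ht : Sees m d t) (hH : isH t = true) : ∃ b, Far d b ∧ P.Door m (P.side d) b.edge := by
  have hk : t.k = 2 := by
    simp only [isH, Bool.and_eq_true, eqb_iff] at hH
    exact hH.1.1
  obtain ⟨h1, h2⟩ := senders_isH t (mem_all_cases ht.mem hk) hH
  obtain ⟨htri, -, h3, h4, -⟩ := ht.tri hk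
  refine exists_door_of_conf8 h htri (ht.hm ▸ h1) ?_
  rw [← h3, ← h4] at h2
  exact h2

end PlaneGraph

/-! ### Squares. -/

namespace EdgeData

/-- The alternatives are the successive cut-offs of the search. In the first one the final `lo a`
stands in for the edge not yet chosen, whose `lo` is no smaller. -/
theorem check4_spec {a b c d : EdgeData} (ha : a ∈ all) (hb : b ∈ all) (hc : c ∈ all) (hd : d ∈ all)
    (lb : lo a ≤ lo b) (lc : lo a ≤ lo c) (ld : lo a ≤ lo d) (fab : fits a b = true)
    (fbc : fits b c = true) (fcd : fits c d = true) (fda : fits d a = true)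
    (pac : badPair a c = false) (pca : badPair c a = false) (pbd : badPair b d = false)
    (pdb : badPair d b = false) (qa : badPath a b c d = false) (qb : badPath b c d a = false)
    (qc : badPath c d a b = false) (qd : badPath d a b c = false)
    (ta : a.k = 2 → badTri a b c d = false) (tb : b.k = 2 → badTri b c d a = false)
    (tc : c.k = 2 → badTri c d a b = false) (td : d.k = 2 → badTri d a b c = false) :
    16 ≤ lo a + cost0 a b c + lo c + lo a ∨ 16 ≤ lo a + cost0 a b c + lo c + cost0 c d a ∨
      16 ≤ cost0 d a b + cost0 a b c + cost0 b c d + cost0 c d a ∨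
      16 ≤ cost4 a b c d + cost4 b c d a + cost4 c d a b + cost4 d a b c := by
  have key := check4_eq
  simp only [check4, mid4, List.all_eq_true, List.mem_filter, Bool.and_eq_true, Bool.or_eq_true,
    Bool.not_eq_true', leb_iff, eqb_iff] at key
  have k1 := key a ha c ⟨hc, lc, pac, pca⟩ b ⟨hb, lb, fab, fbc⟩
  rcases k1 with k1 | k1
  · exact Or.inl k1
  have k2 := k1 d ⟨hd, ld, fcd, fda⟩
  rw [pbd, pdb, qa, qb, qc, qd] at k2
  rcases k2 with ((((((((((((k2 | k2) | k2) | k2) | k2) | k2) | k2) | k2) | k2) | k2) | k2) | k2) | k2)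
  · exact Or.inr (Or.inl k2)
  · exact Or.inr (Or.inr (Or.inl k2))
  · exact absurd k2 Bool.false_ne_true
  · exact absurd k2 Bool.false_ne_true
  · exact absurd k2 Bool.false_ne_true
  · exact absurd k2 Bool.false_ne_true
  · exact absurd k2 Bool.false_ne_true
  · exact absurd k2 Bool.false_ne_true
  · exact absurd k2.2 (by simp [ta k2.1])
  · exact absurd k2.2 (by simp [tb k2.1])
  · exact absurd k2.2 (by simp [tc k2.1])
  · exact absurd k2.2 (by simp [td k2.1])
  · exact Or.inr (Or.inr (Or.inr k2))

end EdgeData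

namespace PlaneGraph

open EdgeData

variable {V : Type*} [Finite V] {P : PlaneGraph V} {m : Sym2 V → ℕ}

theorem Quad.far_iff (h : IsPrimeTarget P m) {d b : P.graph.Dart} (hq : Quad d) :
    Far d b ↔ b = P.fc (P.fc d) := by
  unfold Far
  rw [hq.side_eq_iff, hq.inv]
  constructor
  · rintro ⟨hb, h1, h2, h3⟩
    tauto
  · rintro rfl
    exact ⟨by tauto, P.fc_fc_ne h.threeConnected d, P.fc_ne _, (P.fc_ne _).symm⟩

theorem Quad.offTail {d b : P.graph.Dart} (hq : Quad d) (hb : OffTail d b) :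
    b = P.fc d ∨ b = P.fc (P.fc d) := by
  unfold OffTail at hb
  rw [hq.side_eq_iff, hq.inv] at hb
  tauto

theorem Quad.offHead {d b : P.graph.Dart} (hq : Quad d) (hb : OffHead d b) :
    b = P.fc (P.fc d) ∨ b = P.fc (P.fc (P.fc d)) := by
  unfold OffHead at hb
  rw [hq.side_eq_iff] at hb
  tauto

/-- Only the opposite edge is far, so `conf15` becomes a condition on a single edge; `conf6` is the
other source. -/
theorem Quad.badPair_eq_false (h : IsPrimeTarget P m) {d : P.graph.Dart} (hq : Quad d)
    {a c : EdgeData} (ha : Sees m d a) (hc : Sees m (P.fc (P.fc d)) c) : badPair a c = false := by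
  rw [← Bool.not_eq_true]
  simp only [badPair, Bool.or_eq_true, Bool.and_eq_true, leb_iff, ha.pm_eq, hc.pm_eq]
  rintro (h1 | ⟨h1, h2⟩)
  · have := conf6 h hq
    omega
  · obtain ⟨b, hb, hb'⟩ := conf15 h (fc_fc_fc_ne_of_quad hq) h1
    rw [hq.far_iff h] at hb
    subst hb
    exact hb' (hc.hv h2)

theorem Quad.badPath_eq_false (h : IsPrimeTarget P m) {d : P.graph.Dart} (hq : Quad d)
    {a b c e : EdgeData} (ha : Sees m d a) (hb : Sees m (P.fc d) b)
    (hc : Sees m (P.fc (P.fc d)) c) (he : Sees m (P.fc (P.fc (P.fc d))) e) :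
    badPath a b c e = false := by
  rw [← Bool.not_eq_true]
  simp only [badPath, Bool.and_eq_true, leb_iff, ha.hm, hb.hm, hc.hm, he.hm, Bool.not_eq_true']
  rintro ⟨h1, h2⟩
  obtain ⟨k1, k2, k3, k4⟩ := conf4 h hq h1
  rw [k1, k2, k3, k4] at h2
  exact absurd h2 (by decide)

/-- The disjuncts of `badTri` are the configurations involving the triangle across `a`: `conf16` and
`conf18` from either end, `conf8` through `isH`, then `conf10`, `conf11` and `conf12`. -/
theorem Quad.badTri_eq_false (h : IsPrimeTarget P m) {d : P.graph.Dart} (hq : Quad d)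
    {a b c e : EdgeData} (ha : Sees m d a) (hb : Sees m (P.fc d) b)
    (hc : Sees m (P.fc (P.fc d)) c) (he : Sees m (P.fc (P.fc (P.fc d))) e) (hk : a.k = 2) :
    badTri a b c e = false := by
  obtain ⟨ht, -, hl, hr, -⟩ := ha.tri hk
  have hpl := ha.pl_le hk
  have hpr := ha.pr_le hk
  have hn : ¬ Tri d := fc_fc_fc_ne_of_quad hq
  have hl' : a.l = m (P.nx d).edge := hl.symm
  have hr' : a.r = m (P.nx.symm d.symm).edge := hr.symm
  have hf : Far d (P.fc (P.fc d)) := (hq.far_iff h).2 rfl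
  have hinv := hq.inv
  have hq2 := hq.fc.fc
  have h4 : P.fc (P.fc (P.fc (P.fc d))) = d := hq
  rw [← Bool.not_eq_true]
  simp only [badTri, Bool.or_eq_true, Bool.and_eq_true, leb_iff, eqb_iff, ha.hm, hb.hm, hc.hm,
    he.hm, hb.pm_eq, hc.pm_eq, he.pm_eq, hl', hr', Bool.not_eq_true']
  rintro (((((h1 | h1) | h1) | h1) | h1) | h1)
  · obtain ⟨⟨h1, h2⟩, h5⟩ := h1
    rcases h5 with ⟨⟨h5, h6⟩, h7⟩ | ⟨⟨⟨h5, h6⟩, h7⟩, h8⟩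
    · obtain ⟨x, hx, hx'⟩ := conf16_tail h ht h1 (hinv ▸ h2) (by omega)
      rcases hq.offTail hx with rfl | rfl
      · exact hx' (hb.hv h6)
      · exact hx' (hc.hv h7)
    · rcases conf18_tail h hn ht h1 (hinv ▸ h2) (by omega) with ⟨x, hx, hx'⟩ |
        ⟨x, y, ⟨hx, hx'⟩, ⟨hy, hy'⟩, hxy⟩
      · rcases hq.offTail hx with rfl | rfl <;> omega
      · rcases hq.offTail hx with rfl | rfl <;> rcases hq.offTail hy with rfl | rfl <;>
        rcases h8 with h8 | h8 <;>
        first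
          | exact hxy rfl
          | exact hx' (hb.hv h8)
          | exact hx' (hc.hv h8)
          | exact hy' (hb.hv h8)
          | exact hy' (hc.hv h8)
  · obtain ⟨⟨h1, h2⟩, h5⟩ := h1
    rcases h5 with ⟨⟨h5, h6⟩, h7⟩ | ⟨⟨⟨h5, h6⟩, h7⟩, h8⟩
    · obtain ⟨x, hx, hx'⟩ := conf16_head h ht h1 h2 (by omega)
      rcases hq.offHead hx with rfl | rfl
      · exact hx' (hc.hv h6)
      · exact hx' (he.hv h7)
    · rcases conf18_head h hn ht h1 h2 (by omega) with ⟨x, hx, hx'⟩ |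
        ⟨x, y, ⟨hx, hx'⟩, ⟨hy, hy'⟩, hxy⟩
      · rcases hq.offHead hx with rfl | rfl <;> omega
      · rcases hq.offHead hx with rfl | rfl <;> rcases hq.offHead hy with rfl | rfl <;>
        rcases h8 with h8 | h8 <;>
        first
          | exact hxy rfl
          | exact hx' (he.hv h8)
          | exact hx' (hc.hv h8)
          | exact hy' (he.hv h8)
          | exact hy' (hc.hv h8)
  · obtain ⟨x, hx, hx'⟩ := ha.exists_door_of_isH h h1.1
    rw [hq.far_iff h] at hx
    subst hx
    exact absurd (hc.isDoor h (side_door hf hx')) (by simp [h1.2])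
  · obtain ⟨⟨h1, h2⟩, h3⟩ := h1
    have := conf10 h hq2 h4 ht h2 h1
    rcases h3 with h3 | h3
    · exact this.1 h3
    · exact this.2 h3
  · obtain ⟨⟨h1, h2⟩, h3⟩ := h1
    rcases h3 with ⟨⟨h3, h5⟩, h6⟩ | ⟨⟨h3, h5⟩, h6⟩
    · exact conf11_tail h hq2 h4 ht ⟨h2, h3, h1, h5, by omega⟩
    · exact conf11_head h hq2 h4 ht ⟨h2, h3, h1, h5, by omega⟩
  · obtain ⟨⟨h1, h2⟩, h3⟩ := h1
    rcases h3 with ⟨⟨⟨h3, h5⟩, h6⟩, h7⟩ | ⟨⟨⟨h3, h5⟩, h6⟩, h7⟩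
    · exact conf12_tail h hq2 h4 ht ⟨h2, h3, h1, h5, h6, by omega⟩
    · exact conf12_head h hq2 h4 ht ⟨h2, h3, h1, h5, h6, by omega⟩

/-- With a unique disjoint edge both flags can be read off the records. The edge of `d` is a door
for the region across only if the opposite edge has multiplicity one; eligibility needs the opposite
edge to be a door, or two doors in all. -/
theorem Quad.cost4_le (h : IsPrimeTarget P m) {d : P.graph.Dart} (hs : ¬ P.Big m (P.side d))
    (hq : Quad d) {a b c e : EdgeData} (ha : Sees m d a) (hb : Sees m (P.fc d) b)
    (hc : Sees m (P.fc (P.fc d)) c) (he : Sees m (P.fc (P.fc (P.fc d))) e) :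
    (cost4 a b c e : ℤ) ≤ toll m d := by
  classical
  have hf : Far d (P.fc (P.fc d)) := (hq.far_iff h).2 rfl
  refine ha.cost_le h hs (hq.inv ▸ he) hb (fun _ hd => ?_) (fun hel => ?_)
  · obtain ⟨x, hx, hx'⟩ := exists_far_of_door_across h hd
    rw [hq.far_iff h] at hx
    subst hx
    exact eqb_iff.2 (hc.hm.trans hx')
  · rw [Bool.or_eq_true, leb_iff]
    rcases hel.cases with h2 | ⟨x, hx, hx'⟩
    · right
      have key := doors_le_sum (m := m) (r := P.side d) (f := fun x =>
        if P.Door m (P.side d) x.edge then 1 else 0) (fun x _ => by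
          constructor
          · intro hx; rw [if_pos hx]
          · split_ifs <;> norm_num)
      rw [hq.sum h] at key
      have cn : ∀ (x : P.graph.Dart) (t : EdgeData), P.side x = P.side d → Sees m x t →
          (if P.Door m (P.side d) x.edge then 1 else 0 : ℤ) ≤ cnt t.isDoor := by
        intro x t hx ht
        split_ifs with hd
        · rw [ht.isDoor h (by rwa [hx])]
          norm_num [cnt]
        · positivity
      have c1 := cn _ _ rfl ha
      have c2 := cn _ _ (by simp) hb
      have c3 := cn _ _ (by simp) hc
      have c4 := cn _ _ (by simp) he
      omega
    · left
      rw [hq.far_iff h] at hx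
      subst hx
      exact hc.isDoor h (side_door hf hx')

theorem Sees.cost0_le (h : IsPrimeTarget P m) {d : P.graph.Dart} (hs : ¬ P.Big m (P.side d))
    {p t n : EdgeData} (hp : Sees m (P.fc.symm d) p) (ht : Sees m d t) (hn : Sees m (P.fc d) n) :
    (cost0 p t n : ℤ) ≤ toll m d :=
  ht.cost_le h hs hp hn (fun _ _ => rfl) (fun _ => rfl)

theorem exists_sees_all (h : IsPrimeTarget P m) {r : P.Region} (hs : ¬ P.Big m r) :
    ∃ t : P.graph.Dart → EdgeData, ∀ d, P.side d = r → Sees m d (t d) := by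
  classical
  have : ∀ d : P.graph.Dart, ∃ t, P.side d = r → Sees m d t := by
    intro d
    by_cases hd : P.side d = r
    · obtain ⟨t, ht⟩ := exists_sees h (d := d) (hd ▸ hs)
      exact ⟨t, fun _ => ht⟩
    · exact ⟨⟨0, 0, 0, 0, 0, 0⟩, fun h' => absurd h' hd⟩
  choose t ht using this
  exact ⟨t, ht⟩

theorem Quad.sum_toll_of_least (h : IsPrimeTarget P m) {d : P.graph.Dart}
    (hs : ¬ P.Big m (P.side d)) (hq : Quad d) {a b c e : EdgeData} (ha : Sees m d a)
    (hb : Sees m (P.fc d) b) (hc : Sees m (P.fc (P.fc d)) c)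
    (he : Sees m (P.fc (P.fc (P.fc d))) e) (lb : lo a ≤ lo b) (lc : lo a ≤ lo c)
    (le : lo a ≤ lo e) : 16 ≤ ∑ x ∈ faceDarts (P.side d), toll m x := by
  have h4 : P.fc (P.fc (P.fc (P.fc d))) = d := hq
  have i1 : P.fc.symm d = P.fc (P.fc (P.fc d)) := hq.inv
  have ha' : Sees m (P.fc (P.fc (P.fc (P.fc d)))) a := by rwa [h4]
  have hb' : Sees m (P.fc (P.fc (P.fc (P.fc (P.fc d))))) b := by rwa [h4]
  have hc' : Sees m (P.fc (P.fc (P.fc (P.fc (P.fc (P.fc d)))))) c := by rwa [h4]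
  have s1 : ¬ P.Big m (P.side (P.fc d)) := by rwa [side_fc]
  have s2 : ¬ P.Big m (P.side (P.fc (P.fc d))) := by rwa [side_fc]
  have s3 : ¬ P.Big m (P.side (P.fc (P.fc (P.fc d)))) := by rwa [side_fc]
  have key := check4_spec ha.mem hb.mem hc.mem he.mem lb lc le (ha.fits h hb) (hb.fits h hc)
    (hc.fits h he) (he.fits h ha') (hq.badPair_eq_false h ha hc)
    (hq.fc.fc.badPair_eq_false h hc ha') (hq.fc.badPair_eq_false h hb he)
    (hq.fc.fc.fc.badPair_eq_false h he hb') (hq.badPath_eq_false h ha hb hc he)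
    (hq.fc.badPath_eq_false h hb hc he ha') (hq.fc.fc.badPath_eq_false h hc he ha' hb')
    (hq.fc.fc.fc.badPath_eq_false h he ha' hb' hc') (hq.badTri_eq_false h ha hb hc he)
    (hq.fc.badTri_eq_false h hb hc he ha') (hq.fc.fc.badTri_eq_false h hc he ha' hb')
    (hq.fc.fc.fc.badTri_eq_false h he ha' hb' hc')
  have l1 := ha.lo_le hs
  have l2 := hc.lo_le s2
  have l3 := he.lo_le s3
  have c1 := Sees.cost0_le h hs (by rwa [i1]) ha hb
  have c2 := Sees.cost0_le h s1 (by simpa using ha) hb hc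
  have c3 := Sees.cost0_le h s2 (by simpa using hb) hc he
  have c4 := Sees.cost0_le h s3 (by simpa using hc) he ha'
  have f1 := hq.cost4_le h hs ha hb hc he
  have f2 := hq.fc.cost4_le h s1 hb hc he ha'
  have f3 := hq.fc.fc.cost4_le h s2 hc he ha' hb'
  have f4 := hq.fc.fc.fc.cost4_le h s3 he ha' hb' hc'
  rw [hq.sum h]
  omega

/-- A small square does not keep a positive charge. -/
theorem Quad.sum_toll (h : IsPrimeTarget P m) {d : P.graph.Dart}
    (hs : ¬ P.Big m (P.side d)) (hq : Quad d) : 16 ≤ ∑ x ∈ faceDarts (P.side d), toll m x := by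
  obtain ⟨t, ht⟩ := exists_sees_all h hs
  -- The search assumes that its first edge has the least `lo`, so the square is read from such an
  -- edge.
  obtain ⟨x, hx, hmin⟩ := (faceDarts (P.side d)).exists_min_image (fun x => lo (t x))
    ⟨d, mem_faceDarts.2 rfl⟩
  rw [mem_faceDarts] at hx
  have hqx : Quad x := by
    rcases hq.side_eq_iff.1 hx with rfl | rfl | rfl | rfl
    exacts [hq, hq.fc, hq.fc.fc, hq.fc.fc.fc]
  rw [← hx] at hs ⊢
  have hm : ∀ y : P.graph.Dart, P.side y = P.side d → lo (t x) ≤ lo (t y) := fun y hy =>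
    hmin y (mem_faceDarts.2 hy)
  have e1 : P.side (P.fc x) = P.side d := by simpa using hx
  have e2 : P.side (P.fc (P.fc x)) = P.side d := by simpa using hx
  have e3 : P.side (P.fc (P.fc (P.fc x))) = P.side d := by simpa using hx
  exact hqx.sum_toll_of_least h hs (ht _ hx) (ht _ e1) (ht _ e2) (ht _ e3) (hm _ e1) (hm _ e2)
    (hm _ e3)

end PlaneGraph

/-! ### Triangles. -/

namespace EdgeData

theorem check3_spec {a b c : EdgeData} (ha : a ∈ senders) (hb : b ∈ all) (hc : c ∈ all)
    (fab : fits a b = true) (fbc : fits b c = true) (fca : fits c a = true)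
    (pab : a.pm + b.pm ≤ 6) (pbc : b.pm + c.pm ≤ 6) (pca : c.pm + a.pm ≤ 6)
    (hsum : a.m + b.m + c.m ≤ 7) (ta : badTri3 a b c = false)
    (tb : b.k = 2 → badTri3 b c a = false) (tc : c.k = 2 → badTri3 c a b = false) :
    16 ≤ cost a c b false true + cost b a c false true + cost c b a false true := by
  have key := check3_eq
  simp only [check3, List.all_eq_true, List.mem_filter, Bool.and_eq_true, Bool.or_eq_true,
    leb_iff, eqb_iff] at key
  rcases key a ha b ⟨hb, fab, pab⟩ c ⟨hc, ⟨⟨fbc, fca⟩, pbc⟩, pca⟩ with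
    (((k | k) | k) | k) | k
  · omega
  · exact absurd k (by simp [ta])
  · exact absurd k.2 (by simp [tb k.1])
  · exact absurd k.2 (by simp [tc k.1])
  · exact k

/-- The hypotheses `pab`, `pac`, `pbc` express `conf7`; since `m⁺` is m + 1 minus the status, the
bound six becomes four plus statuses. `pr`, `pq`, `rq` express `conf1`, and `he` expresses `conf9`.
-/
theorem check1_spec {a b c sa sb sc : ℕ} {p q r : ℕ × ℕ × Bool} {ea eb ec : Bool} (hb1 : 1 ≤ b)
    (hc1 : 1 ≤ c) (hba : b ≤ a) (hca : c ≤ a) (h5 : 5 ≤ a + b + c) (h7 : a + b + c ≤ 7)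
    (hsa : sa ≤ 1) (hsb : sb ≤ 1) (hsc : sc ≤ 1) (pab : a + b ≤ 4 + sa + sb)
    (pac : a + c ≤ 4 + sa + sc) (pbc : b + c ≤ 4 + sb + sc) (hp : p ∈ corners a b c)
    (hr : r ∈ corners c a b) (hq : q ∈ corners b c a) (pr : ¬ (p.2.2 = true ∧ r.2.2 = true))
    (pq : ¬ (p.2.2 = true ∧ q.2.2 = true)) (rq : ¬ (r.2.2 = true ∧ q.2.2 = true))
    (he : a = 2 → b = 2 → c = 2 → (p.2.2 = true ∨ ea = true ∨ eb = true) ∧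
      (q.2.2 = true ∨ eb = true ∨ ec = true) ∧ (r.2.2 = true ∨ ec = true ∨ ea = true)) :
    2 * (a + b + c) ≤ 8 + (give a sa b sb c sc p.1 r.2.1 ea +
      give b sb c sc a sa q.1 p.2.1 eb + give c sc a sa b sb r.1 q.2.1 ec) := by
  have mem5 : ∀ {x : ℕ}, 1 ≤ x → x ≤ 5 → x ∈ [1, 2, 3, 4, 5] := by
    intro x h1 h2
    interval_cases x <;> decide
  have mem1 : ∀ {x : ℕ}, x ≤ 1 → x ∈ [0, 1] := by
    intro x h1
    interval_cases x <;> decide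
  have memB : ∀ b : Bool, b ∈ [true, false] := by decide
  have key := check1_eq
  simp only [check1, List.all_eq_true, List.mem_filter, Bool.and_eq_true, Bool.or_eq_true,
    leb_iff, eqb_iff, Bool.not_eq_true', ← Bool.not_eq_true] at key
  have k1 := key a (mem5 (by omega) (by omega)) b ⟨mem5 hb1 (by omega), hba⟩ c
    ⟨mem5 hc1 (by omega), ⟨hca, h5⟩, h7⟩ sa (mem1 hsa) sb ⟨mem1 hsb, pab⟩ sc ⟨mem1 hsc, pac, pbc⟩
    p hp r hr
  rcases k1 with k1 | k1
  · exact absurd k1 pr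
  rcases k1 ea (memB _) with k1 | k1
  · omega
  rcases k1 q hq with k1 | k1
  · rcases k1 with ⟨k1 | k1, k2⟩
    · exact absurd ⟨k1, k2⟩ pq
    · exact absurd ⟨k1, k2⟩ rq
  rcases k1 eb (memB _) ec (memB _) with k1 | k1
  · exfalso
    have := he k1.1.1.1 k1.1.1.2 k1.1.2
    apply k1.2
    obtain ⟨h1, h2, h3⟩ := this
    exact ⟨⟨or_assoc.2 h1, or_assoc.2 h2⟩, or_assoc.2 h3⟩
  · exact k1

theorem mem_corners {a b c x y : ℕ} {f : Bool} (hx : 1 ≤ x) (hy : 1 ≤ y) (hab : 2 ≤ a + b)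
    (h : (f = true ∧ x = y ∧ a + b + x = 8 ∧ max a b + c ≤ x) ∨ (f = false ∧ a + b + x + y ≤ 8)) :
    (x, y, f) ∈ corners a b c := by
  have mem6 : ∀ {x : ℕ}, 1 ≤ x → x ≤ 6 → x ∈ [1, 2, 3, 4, 5, 6] := by
    intro x h1 h2
    interval_cases x <;> decide
  rw [corners, List.mem_append]
  rcases h with ⟨rfl, rfl, h1, h2⟩ | ⟨rfl, h1⟩
  · left
    have e : 8 - (a + b) = x := by omega
    rw [e, leb_iff.2 h2, cond_true]
    exact List.mem_singleton.2 rfl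
  · right
    simp only [List.mem_flatMap, List.mem_map, List.mem_filter, leb_iff]
    exact ⟨x, mem6 hx (by omega), y, ⟨mem6 hy (by omega), h1⟩, rfl⟩

end EdgeData

namespace PlaneGraph

open EdgeData

variable {V : Type*} {P : PlaneGraph V} {m : Sym2 V → ℕ}

theorem noDoorOff_perm {r : P.Region} {u v w u' v' w' : V} (h : P.NoDoorOff m r u v w)
    (hp : ∀ f : Sym2 V, u' ∉ f → v' ∉ f → w' ∉ f → u ∉ f ∧ v ∉ f ∧ w ∉ f) :
    P.NoDoorOff m r u' v' w' := by
  rintro ⟨f, hf, h1, h2, h3⟩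
  exact h ⟨f, hf, hp f h1 h2 h3⟩

theorem pm_add_st (d : P.graph.Dart) : pm m d + st m d = m d.edge + 1 := by
  unfold pm st
  split_ifs <;> rfl

variable [Finite V]

theorem Tri.not_far {d b : P.graph.Dart} (ht : Tri d) : ¬ Far d b := by
  unfold Far
  rw [ht.side_eq_iff, ht.inv]
  tauto

/-- `conf3`, `conf5` and `conf16` apply to the two triangles sharing the edge of `d`. The case `isH`
is impossible outright, as it would give a far edge, and a triangle has none. -/
theorem Tri.badTri3_eq_false (h : IsPrimeTarget P m) {d : P.graph.Dart} (hd : Tri d)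
    {a b c : EdgeData} (ha : Sees m d a) (hb : Sees m (P.fc d) b)
    (hc : Sees m (P.fc (P.fc d)) c) (hk : a.k = 2) : badTri3 a b c = false := by
  obtain ⟨ht, -, hl, hr, -⟩ := ha.tri hk
  have hpl := ha.pl_le hk
  have hpr := ha.pr_le hk
  have hl' : a.l = m (P.nx d).edge := hl.symm
  have hr' : a.r = m (P.nx.symm d.symm).edge := hr.symm
  have c3 := conf3 h hd ht
  have c3' := conf3 h (d := d.symm) ht (by rwa [SimpleGraph.Dart.symm_symm])
  have c5 := conf5 h hd ht
  rw [← ht.inv, fc_symm, SimpleGraph.Dart.symm_symm, edge_fc_inv, ← edge_fc_inv (d := d), hd.inv,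
    ← fc_apply, SimpleGraph.Dart.edge_symm] at c3'
  rw [← Bool.not_eq_true]
  simp only [badTri3, Bool.or_eq_true, Bool.and_eq_true, leb_iff, ha.hm, hb.hm, hc.hm, hb.pm_eq,
    hc.pm_eq, hl', hr']
  rintro ((((((((h1 | h1) | h1) | h1) | h1) | h1) | h1) | h1) | h1)
  · omega
  · omega
  · omega
  · omega
  · omega
  · omega
  · obtain ⟨x, hx, -⟩ := ha.exists_door_of_isH h h1
    exact hd.not_far hx
  · obtain ⟨⟨⟨h1, h2⟩, h3⟩, h4⟩ := h1
    obtain ⟨x, hx, hx'⟩ := conf16_tail h ht h1 (hd.inv ▸ h2) (by omega)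
    have : x = P.fc d := by
      unfold OffTail at hx
      rw [hd.side_eq_iff, hd.inv] at hx
      tauto
    exact hx' (this ▸ hb.hv h4)
  · obtain ⟨⟨⟨h1, h2⟩, h3⟩, h4⟩ := h1
    obtain ⟨x, hx, hx'⟩ := conf16_head h ht h1 h2 (by omega)
    have : x = P.fc (P.fc d) := by
      unfold OffHead at hx
      rw [hd.side_eq_iff] at hx
      tauto
    exact hx' (this ▸ hc.hv h4)

/-- A small triangle that receives a charge over an edge does not keep a positive charge. -/
theorem Tri.sum_toll_of_receives (h : IsPrimeTarget P m) {d : P.graph.Dart}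
    (hs : ¬ P.Big m (P.side d)) (hd : Tri d) {a b c : EdgeData} (ha : Sees m d a)
    (hb : Sees m (P.fc d) b) (hc : Sees m (P.fc (P.fc d)) c) (hk : a.k = 2) :
    16 ≤ ∑ x ∈ faceDarts (P.side d), toll m x := by
  have h3 : P.fc (P.fc (P.fc d)) = d := hd
  have ha' : Sees m (P.fc (P.fc (P.fc d))) a := by rwa [h3]
  have hb' : Sees m (P.fc (P.fc (P.fc (P.fc d)))) b := by rwa [h3]
  have s1 : ¬ P.Big m (P.side (P.fc d)) := by rwa [side_fc]
  have s2 : ¬ P.Big m (P.side (P.fc (P.fc d))) := by rwa [side_fc]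
  have p1 := conf7 h hd
  have p2 := conf7 h hd.fc
  have p3 := conf7 h hd.fc.fc
  rw [h3] at p3
  rw [← ha.pm_eq, ← hb.pm_eq] at p1
  rw [← hb.pm_eq, ← hc.pm_eq] at p2
  rw [← ha.pm_eq, ← hc.pm_eq] at p3
  have hsum := tri_sum_le h hd
  rw [← ha.hm, ← hb.hm, ← hc.hm] at hsum
  have key := check3_spec (mem_all_cases ha.mem hk) hb.mem hc.mem (ha.fits h hb) (hb.fits h hc)
    (hc.fits h ha') p1 p2 p3 hsum (hd.badTri3_eq_false h ha hb hc hk)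
    (hd.fc.badTri3_eq_false h hb hc ha') (hd.fc.fc.badTri3_eq_false h hc ha' hb')
  -- No edge of a triangle is a door for the region across, so the larger shares apply.
  have hdoor : ∀ x : P.graph.Dart, Tri x → Bg m x → P.Door m (P.side x.symm) x.edge →
      false = true := fun x hx _ hdoor => by
    obtain ⟨b, hb, -⟩ := exists_far_of_door_across h hdoor
    exact absurd hb hx.not_far
  have c1 := ha.cost_le h hs (p := c) (n := b) (by rwa [hd.inv]) hb (hdoor d hd)
    (elig := true) fun _ => rfl
  have c2 := hb.cost_le h s1 (p := a) (n := c) (by simpa using ha) hc (hdoor _ hd.fc)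
    (elig := true) fun _ => rfl
  have c3 := hc.cost_le h s2 (p := b) (n := a) (by simpa using hb) ha' (hdoor _ hd.fc.fc)
    (elig := true) fun _ => rfl
  rw [hd.sum h]
  omega

open Classical in
-- The two outer edges at a corner coincide when its degree is three, and then `conf2` bounds them
-- from below. Otherwise all four edges there total at most eight.
theorem Tri.mem_corners (h : IsPrimeTarget P m) {d : P.graph.Dart} (hd : Tri d) :
    (m (P.nx.symm d.symm).edge, m (P.nx (P.fc d)).edge, decide (P.deg d.snd = 3)) ∈
      corners (m d.edge) (m (P.fc d).edge) (m (P.fc (P.fc d)).edge) := by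
  have h3 : P.fc (P.fc (P.fc d)) = d := hd
  have k1 := mult_pos h d
  have k2 := mult_pos h (P.fc d)
  apply EdgeData.mem_corners (mult_pos h _) (mult_pos h _) (by omega)
  rcases corner h d with ⟨hxy, hsum, hdeg⟩ | ⟨hsum, hdeg, -⟩
  · left
    have := conf2 h hd.fc (x := P.nx.symm d.symm) (by simpa using hdeg) (by simp)
      (fc_ne_inv h.threeConnected d) (by
        rw [h3]
        intro h'
        rw [Equiv.symm_apply_eq] at h'
        exact P.nx_ne h.threeConnected _ h'.symm)
    rw [h3] at this
    exact ⟨decide_eq_true hdeg, by rw [hxy], by omega, by omega⟩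
  · right
    exact ⟨decide_eq_false (by omega), by omega⟩

open Classical in
-- For a triangle that receives nothing the toll is computed exactly, because what it sends away is
-- what brings its charge down.
theorem Tri.toll_eq (h : IsPrimeTarget P m) {d : P.graph.Dart}
    (hs : ¬ P.Big m (P.side d)) (hd : Tri d) {a : EdgeData} (ha : Sees m d a) (hk : a.k ≠ 2) :
    toll m d = 8 - 2 * (m d.edge : ℤ) + give (m d.edge) (st m d) (m (P.fc d).edge) (st m (P.fc d))
      (m (P.fc (P.fc d)).edge) (st m (P.fc (P.fc d))) (m (P.nx.symm d.symm).edge)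
      (m (P.nx d).edge) (decide (Elig m d.symm)) := by
  by_cases hb : Bg m d
  · have hst : st m d = 1 := by rw [st, if_pos hb]
    have hno : ¬ P.Door m (P.side d.symm) d.edge := fun hdoor => by
      obtain ⟨b, hb, -⟩ := exists_far_of_door_across h hdoor
      exact hd.not_far hb
    rw [toll_eq_of_big hs hb, out, give, hst, eqb_iff.2 rfl, cond_true,
      SimpleGraph.Dart.edge_symm, decide_eq_false hno, edge_fc_inv, fc_symm]
  · have hst : st m d = 0 := by rw [st, if_neg hb]
    have hr := ha.recv hb
    rw [eqb_false.2 hk, cond_false] at hr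
    rw [toll_eq_of_small hs hb, hr, give, hst, eqb_false.2 (by norm_num), cond_false]
    have hsend : sends ⟨m d.edge, 2, m (P.fc d).edge, st m (P.fc d), m (P.fc (P.fc d)).edge,
        st m (P.fc (P.fc d))⟩ = true ↔ ∃ s ∈ senders, Matches (ed m d.symm) s := by
      simp only [sends, List.any_eq_true, Bool.and_eq_true, eqb_iff, Matches, ed,
        SimpleGraph.Dart.edge_symm, SimpleGraph.Dart.symm_symm, ← fc_apply, ← hd.inv, edge_fc_inv]
      apply exists_congr
      intro s
      tauto
    by_cases hm : ∃ s ∈ senders, Matches (ed m d.symm) s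
    · rw [hsend.2 hm, cond_true, recvD, if_pos ⟨by rwa [SimpleGraph.Dart.symm_symm], hm⟩,
        edge_fc_inv, fc_symm]
      have : (ed m d.symm) = ⟨m d.edge, (ed m d.symm).k, m (P.fc d).edge, st m (P.fc d),
          m (P.fc (P.fc d)).edge, st m (P.fc (P.fc d))⟩ := by
        rw [← hd.inv]
        simp only [ed, SimpleGraph.Dart.edge_symm, SimpleGraph.Dart.symm_symm, ← fc_apply,
          edge_fc_inv]
      rw [this, Nat.cast_zero, sub_zero]
      rfl
    · have : sends ⟨m d.edge, 2, m (P.fc d).edge, st m (P.fc d), m (P.fc (P.fc d)).edge,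
          st m (P.fc (P.fc d))⟩ = false := by
        rw [← Bool.not_eq_true, hsend]
        exact hm
      rw [this, cond_false, recvD, if_neg (fun h' => hm h'.2)]
      simp

/-- This is `conf9` at the corner between `d` and `P.fc d`; the second regions of that configuration
are the regions across these two edges. -/
theorem Tri.elig_or (h : IsPrimeTarget P m) {d : P.graph.Dart} (hd : Tri d) (h1 : m d.edge = 2)
    (h2 : m (P.fc d).edge = 2) (h3 : m (P.fc (P.fc d)).edge = 2) :
    P.deg d.snd = 3 ∨ Elig m d.symm ∨ Elig m (P.fc d).symm := by
  have h4 : P.fc (P.fc (P.fc d)) = d := hd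
  have hv : (P.fc (P.fc d)).snd = d.fst := by
    rw [← P.fc_fst (P.fc (P.fc d)), h4]
  by_cases hdeg : 4 ≤ P.deg d.snd
  · right
    have := conf9 h hd.fc h2 h3 (by rwa [h4]) (by simpa using hdeg)
    rw [h4, hv] at this
    rcases this with (h' | h') | (h' | h')
    · exact Or.inr (Or.inl h')
    · refine Or.inr (Or.inr fun hn => h' (noDoorOff_perm hn fun f k1 k2 k3 => ⟨k2, k1, ?_⟩))
      rw [← fc_apply, hv]
      exact k3
    · exact Or.inl (Or.inl h')
    · refine Or.inl (Or.inr fun hn => h' (noDoorOff_perm hn fun f k1 k2 k3 => ⟨?_, k3, ?_⟩))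
      · rw [fc_fst] at k1
        exact k1
      · rw [← fc_apply]
        exact k2
  · left
    rcases corner h d with h' | h'
    · exact h'.2.2
    · exact absurd h'.2.1 hdeg

open Classical in
/-- A small triangle that receives nothing does not keep a positive charge. -/
theorem Tri.sum_toll_of_not_receives (h : IsPrimeTarget P m) {d : P.graph.Dart}
    (hs : ¬ P.Big m (P.side d)) (hd : Tri d) {a b c : EdgeData} (ha : Sees m d a)
    (hb : Sees m (P.fc d) b) (hc : Sees m (P.fc (P.fc d)) c) (ka : a.k ≠ 2) (kb : b.k ≠ 2)
    (kc : c.k ≠ 2) (hba : m (P.fc d).edge ≤ m d.edge) (hca : m (P.fc (P.fc d)).edge ≤ m d.edge) :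
    16 ≤ ∑ x ∈ faceDarts (P.side d), toll m x := by
  have h3 : P.fc (P.fc (P.fc d)) = d := hd
  have s1 : ¬ P.Big m (P.side (P.fc d)) := by rwa [side_fc]
  have s2 : ¬ P.Big m (P.side (P.fc (P.fc d))) := by rwa [side_fc]
  have t1 := hd.toll_eq h hs ha ka
  have t2 := hd.fc.toll_eq h s1 hb kb
  have t3 := hd.fc.fc.toll_eq h s2 hc kc
  rw [hd.sum h]
  rw [h3] at t2 t3
  have hsum := tri_sum_le h hd
  -- A total of at most four gives 24 − 8 = 16 even if nothing is sent.
  by_cases h5 : m d.edge + m (P.fc d).edge + m (P.fc (P.fc d)).edge ≤ 4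
  · omega
  have p1 := conf7 h hd
  have p2 := conf7 h hd.fc
  have p3 := conf7 h hd.fc.fc
  rw [h3] at p3
  have q1 := pm_add_st (m := m) d
  have q2 := pm_add_st (m := m) (P.fc d)
  have q3 := pm_add_st (m := m) (P.fc (P.fc d))
  have d1 := conf1 h hd
  have d2 := conf1 h hd.fc
  have d3 := conf1 h hd.fc.fc
  rw [fc_fst] at d2 d3
  have e1 := hd.elig_or h
  have e2 := hd.fc.elig_or h
  have e3 := hd.fc.fc.elig_or h
  rw [h3] at e2 e3
  have hv : (P.fc (P.fc d)).snd = d.fst := by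
    rw [← P.fc_fst (P.fc (P.fc d)), h3]
  rw [hv] at d3 e3
  have c1 := hd.mem_corners h
  have c2 := hd.fc.mem_corners h
  have c3 := hd.fc.fc.mem_corners h
  rw [h3] at c2 c3
  rw [hv] at c3
  have key := check1_spec (mult_pos h _) (mult_pos h _) hba hca (by omega) hsum (st_le_one (m := m) d)
    (st_le_one (m := m) (P.fc d)) (st_le_one (m := m) (P.fc (P.fc d))) (by omega) (by omega) (by omega) c1 c3 c2
    (by simpa using fun h1 h2 => d1 ⟨h2, h1⟩) (by simpa using fun h1 h2 => d2 ⟨h1, h2⟩)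
    (by simpa using fun h1 h2 => d3 ⟨h2, h1⟩) (ea := decide (Elig m d.symm))
    (eb := decide (Elig m (P.fc d).symm)) (ec := decide (Elig m (P.fc (P.fc d)).symm))
    (fun h1 h2 h3 => by
      simp only [decide_eq_true_eq]
      exact ⟨e1 h1 h2 h3, e2 h2 h3 h1, e3 h3 h1 h2⟩)
  simp only at key
  omega

/-- A small triangle does not keep a positive charge. -/
theorem Tri.sum_toll (h : IsPrimeTarget P m) {d : P.graph.Dart}
    (hs : ¬ P.Big m (P.side d)) (hd : Tri d) : 16 ≤ ∑ x ∈ faceDarts (P.side d), toll m x := by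
  obtain ⟨t, ht⟩ := exists_sees_all h hs
  have hside : ∀ {x : P.graph.Dart}, P.side x = P.side d → Tri x := by
    intro x hx
    rcases hd.side_eq_iff.1 hx with rfl | rfl | rfl
    exacts [hd, hd.fc, hd.fc.fc]
  -- A receiving triangle is read from an edge over which it receives, and its own gifts to small
  -- regions are ignored. Any other triangle is read from a largest edge, with these gifts counted.
  by_cases hk : ∃ x ∈ faceDarts (P.side d), (t x).k = 2
  · obtain ⟨x, hx, hk⟩ := hk
    rw [mem_faceDarts] at hx
    have e1 : P.side (P.fc x) = P.side d := by simpa using hx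
    have e2 : P.side (P.fc (P.fc x)) = P.side d := by simpa using hx
    rw [← hx] at hs ⊢
    exact (hside hx).sum_toll_of_receives h hs (ht _ hx) (ht _ e1) (ht _ e2) hk
  · push Not at hk
    obtain ⟨x, hx, hmax⟩ := (faceDarts (P.side d)).exists_max_image (fun x => m x.edge)
      ⟨d, mem_faceDarts.2 rfl⟩
    rw [mem_faceDarts] at hx
    have e1 : P.side (P.fc x) = P.side d := by simpa using hx
    have e2 : P.side (P.fc (P.fc x)) = P.side d := by simpa using hx
    have hk' : ∀ y : P.graph.Dart, P.side y = P.side d → (t y).k ≠ 2 := fun y hy =>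
      hk y (mem_faceDarts.2 hy)
    have hm : ∀ y : P.graph.Dart, P.side y = P.side d → m y.edge ≤ m x.edge := fun y hy =>
      hmax y (mem_faceDarts.2 hy)
    rw [← hx] at hs ⊢
    exact (hside hx).sum_toll_of_not_receives h hs (ht _ hx) (ht _ e1) (ht _ e2) (hk' _ hx)
      (hk' _ e1) (hk' _ e2) (hm _ e1) (hm _ e2)

end PlaneGraph

/-! ### Regions of length at least five: local tables. -/

namespace EdgeData

/-- A condition that holds for all data of three consecutive edges that fit. -/
def triples (q : EdgeData → EdgeData → EdgeData → Bool) : Bool :=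
  all.all fun p => all.all fun t => !fits p t || all.all fun n => !fits t n || q p t n

theorem triples_spec {q : EdgeData → EdgeData → EdgeData → Bool} (hq : triples q = true)
    {p t n : EdgeData} (hp : p ∈ all) (ht : t ∈ all) (hn : n ∈ all) (hpt : fits p t = true)
    (htn : fits t n = true) : q p t n = true := by
  simp only [triples, List.all_eq_true, Bool.or_eq_true, Bool.not_eq_true'] at hq
  rcases hq p hp t ht with h' | h'
  · exact absurd (hpt.symm.trans h') (by decide)
  rcases h' n hn with h' | h'
  · exact absurd (htn.symm.trans h') (by decide)
  · exact h'

/-- The triangle across `t` is attached at its tail, with weight at least `i`. -/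
def attTail (i : ℕ) (p t : EdgeData) : Bool :=
  eqb t.k 2 && (leb t.r t.l && leb p.m t.l && leb i (t.m + t.pl))

/-- The triangle across `t` is attached at its head, with weight at least `i`. -/
def attHead (i : ℕ) (t n : EdgeData) : Bool :=
  eqb t.k 2 && (leb t.l t.r && leb n.m t.r && leb i (t.m + t.pr))

/-- In a region without edges that are not `3`-heavy, every edge takes at least four. -/
def allHeavy (p t n : EdgeData) : Bool :=
  !(p.heavy 3 && t.heavy 3 && n.heavy 3 && leb p.pm 3 && leb t.pm 3 && leb n.pm 3) ||
    (isH t || attTail 4 p t || attHead 4 t n || leb 4 (cost t p n true false))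

/-- What the edge `t` takes after an edge `p` that is the only one that is not `3`-heavy. -/
def afterLight (p t n : EdgeData) : Bool :=
  !(!p.heavy 3 && t.heavy 3 && n.heavy 3 && leb t.pm 3) ||
    (isH t || attTail 4 p t || cond (leb p.pm 1)
      (leb 3 (cost0 p t n) && leb 4 (shareBound p t t.l false + cost0 p t n))
      (attTail 5 p t || attHead 5 t n || leb 4 (cost0 p t n) ||
        (leb 6 (lo p) && leb 3 (cost0 p t n))))

/-- What the edge `t` takes before an edge `n` that is the only one that is not `3`-heavy. -/
def beforeLight (p t n : EdgeData) : Bool :=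
  !(p.heavy 3 && t.heavy 3 && !n.heavy 3 && leb t.pm 3) ||
    (isH t || attHead 4 t n || cond (leb n.pm 1)
      (leb 3 (cost0 p t n) && leb 4 (shareBound n t t.r false + cost0 p t n))
      (attTail 5 p t || attHead 5 t n || leb 4 (cost0 p t n) ||
        (leb 6 (lo n) && leb 3 (cost0 p t n))))

/-- What an edge takes between two edges with large `m⁺`, and an edge that is no door for the big
region across it. -/
def lightCost (p t n : EdgeData) : Bool :=
  (!(leb 5 p.pm && leb 5 n.pm && !t.heavy 3 && leb t.m 1) || leb 6 (cost0 p t n)) &&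
    (!leb t.pm 1 || leb 8 (cost t p n false true))

/-- The length of the region is unbounded here, so a search over whole boundaries is replaced by
tables over three consecutive edges. -/
theorem allHeavy_true : triples allHeavy = true := by decide +kernel

theorem afterLight_true : triples afterLight = true := by decide +kernel

theorem beforeLight_true : triples beforeLight = true := by decide +kernel

theorem lightCost_true : triples lightCost = true := by decide +kernel

/-- A table of properties of a single edge. -/
def single (t : EdgeData) : Bool :=
  (t.heavy 3 || leb 4 (lo t)) && (t.heavy 2 || leb 6 (lo t)) &&
  (leb 2 t.pm || (leb 6 (lo t) && !t.heavy 3 && eqb t.m 1 && eqb t.k 1)) &&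
  (leb 2 (lo t) || (leb 5 t.pm && leb 4 t.m && t.heavy 3)) &&
  (!t.heavy 3 || !leb t.m 1 || leb 4 (lo t)) && (!isDoor t || !t.heavy 3) &&
  (!t.heavy 3 || t.heavy 2)

theorem single_true : ∀ t ∈ all, single t = true := by decide +kernel

/-- The thresholds match the configurations. Four is the standard amount of a light edge, and six
that of the exceptional edges in `conf17` and `conf19`. An edge with `lo` below two, called cheap
below, always has `m⁺` at least five, so both of these apply to it. -/
theorem single_spec {t : EdgeData} (ht : t ∈ all) :
    (t.heavy 3 = false → 4 ≤ lo t) ∧ (t.heavy 2 = false → 6 ≤ lo t ∧ t.heavy 3 = false) ∧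
      (t.pm < 2 → 6 ≤ lo t ∧ t.heavy 3 = false ∧ t.m = 1 ∧ t.k = 1) ∧
      (lo t < 2 → 5 ≤ t.pm ∧ 4 ≤ t.m ∧ t.heavy 3 = true) ∧
      (t.heavy 3 = true → t.m = 1 → 4 ≤ lo t) ∧ (t.isDoor = true → t.heavy 3 = false) := by
  have key := single_true t ht
  simp only [single, Bool.and_eq_true, Bool.or_eq_true, leb_iff, eqb_iff, Bool.not_eq_true',
    ← Bool.not_eq_true] at key ⊢
  obtain ⟨⟨⟨⟨⟨⟨h1, h2⟩, h3⟩, h4⟩, h5⟩, h6⟩, h7⟩ := key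
  refine ⟨fun k => h1.resolve_left k, fun k => ⟨h2.resolve_left k, fun k' => ?_⟩, fun k => ?_,
    fun k => ?_, fun k k' => ?_, fun k => ?_⟩
  · exact h7.elim (fun h => h k') k
  · obtain ⟨⟨⟨a, b⟩, c⟩, d⟩ := h3.resolve_left (by omega)
    exact ⟨a, b, c, d⟩
  · obtain ⟨⟨a, b⟩, c⟩ := h4.resolve_left (by omega)
    exact ⟨a, b, c⟩
  · rcases h5 with (h5 | h5) | h5
    · exact absurd k h5
    · exact absurd k'.le h5
    · exact h5
  · exact h6.elim (fun h => absurd k h) id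

end EdgeData

/-! ### Light edges and excess. -/

namespace PlaneGraph

open EdgeData

variable {V : Type*} {P : PlaneGraph V} {m : Sym2 V → ℕ}

variable (m) in
/-- A small region of length at least five, with the data of its edges. -/
structure LargeRegion (r : P.Region) (t : P.graph.Dart → EdgeData) : Prop where
  small : ¬ P.Big m r
  sees : ∀ d, P.side d = r → Sees m d (t d)
  not_tri : ∀ d, P.side d = r → ¬ Tri d
  not_quad : ∀ d, P.side d = r → ¬ Quad d

variable (m) in
/-- What the edge of `d` takes, diminished by four if the edge is not `3`-heavy. -/
noncomputable def excess (t : P.graph.Dart → EdgeData) (d : P.graph.Dart) : ℤ :=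
  toll m d - cond ((t d).heavy 3) 0 4

/-- The edge of `d` is an edge of the region `r` that is not `3`-heavy. -/
def Light (r : P.Region) (t : P.graph.Dart → EdgeData) (d : P.graph.Dart) : Prop :=
  P.side d = r ∧ (t d).heavy 3 = false

variable {r : P.Region} {t : P.graph.Dart → EdgeData}

theorem Far.side {d b : P.graph.Dart} (hb : Far d b) (hd : P.side d = r) : P.side b = r :=
  hb.1.trans hd

theorem LargeRegion.lo_le (L : LargeRegion m r t) {d : P.graph.Dart} (hd : P.side d = r) :
    (lo (t d) : ℤ) ≤ toll m d :=
  (L.sees d hd).lo_le (hd ▸ L.small)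

theorem excess_light {d : P.graph.Dart} (hd : Light r t d) : excess m t d = toll m d - 4 := by
  rw [excess, hd.2]
  rfl

theorem excess_heavy {d : P.graph.Dart} (hd : (t d).heavy 3 = true) :
    excess m t d = toll m d := by
  rw [excess, hd, cond_true, sub_zero]

theorem LargeRegion.excess_nonneg (L : LargeRegion m r t) {d : P.graph.Dart} (hd : P.side d = r) :
    0 ≤ excess m t d := by
  have h1 := L.lo_le hd
  have h2 := (single_spec (L.sees d hd).mem).1
  unfold excess
  cases hh : (t d).heavy 3
  · have := h2 hh
    rw [cond_false]
    omega
  · rw [cond_true]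
    omega

theorem heavy_of_not_light {d : P.graph.Dart} (hd : P.side d = r) (hl : ¬ Light r t d) :
    (t d).heavy 3 = true := by
  rw [← Bool.not_eq_false]
  exact fun h => hl ⟨hd, h⟩

theorem LargeRegion.not_hv (L : LargeRegion m r t) {b : P.graph.Dart} (hb : P.side b = r) {i : ℕ}
    (hh : ¬ Hv m i b) : (t b).heavy i = false := by
  rw [← Bool.not_eq_true]
  exact fun h => hh ((L.sees b hb).hv h)

theorem LargeRegion.light_of_pm (L : LargeRegion m r t) {b : P.graph.Dart} (hb : P.side b = r)
    (hp : (t b).pm < 2) : Light r t b :=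
  ⟨hb, ((single_spec (L.sees b hb).mem).2.2.1 hp).2.1⟩

variable [Finite V]

/-- The edges of a region that are not `3`-heavy. -/
noncomputable def lights (r : P.Region) (t : P.graph.Dart → EdgeData) : Finset P.graph.Dart :=
  (faceDarts r).filter fun d => (t d).heavy 3 = false

theorem mem_lights {d : P.graph.Dart} : d ∈ lights r t ↔ Light r t d := by
  rw [lights, Finset.mem_filter, mem_faceDarts, Light]

theorem length_le_lights {l : List P.graph.Dart} (hl : l.Nodup) (h : ∀ x ∈ l, Light r t x) :
    l.length ≤ (lights r t).card := by
  classical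
  rw [← List.toFinset_card_of_nodup hl]
  exact Finset.card_le_card fun x hx => mem_lights.2 (h x (List.mem_toFinset.1 hx))

theorem mem_of_light {l : List P.graph.Dart} (hl : l.Nodup) (h : ∀ x ∈ l, Light r t x)
    (hc : (lights r t).card ≤ l.length) {x : P.graph.Dart} (hx : Light r t x) : x ∈ l := by
  classical
  by_contra hxl
  have := length_le_lights (l := x :: l) (List.nodup_cons.2 ⟨hxl, hl⟩) (by
    intro y hy
    rcases List.mem_cons.1 hy with rfl | hy
    · exact hx
    · exact h y hy)
  simp only [List.length_cons] at this
  omega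

/-- There are `3`-heavy edges outside a short list. -/
theorem exists_heavy (l : List P.graph.Dart) (hc : l.length + (lights r t).card < (faceDarts r).card) :
    ∃ x, P.side x = r ∧ (t x).heavy 3 = true ∧ x ∉ l := by
  classical
  by_contra! hno
  have hsub : faceDarts r ⊆ l.toFinset ∪ lights r t := by
    intro x hx
    rw [mem_faceDarts] at hx
    rw [Finset.mem_union, List.mem_toFinset, mem_lights]
    by_cases hl : Light r t x
    · exact Or.inr hl
    · exact Or.inl (hno x hx (heavy_of_not_light hx hl))
  have h1 := Finset.card_le_card hsub
  have h2 := Finset.card_union_le l.toFinset (lights r t)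
  have h3 := l.toFinset_card_le
  omega

/-- Light edges contribute four each and all excesses are nonnegative, so any distinct darts may be
selected. With n light edges it remains to find an excess of 16 − 4n. -/
theorem LargeRegion.le_sum (L : LargeRegion m r t) {l : List P.graph.Dart} (hl : l.Nodup)
    (h : ∀ x ∈ l, P.side x = r) :
    4 * ((lights r t).card : ℤ) + (l.map (excess m t)).sum ≤ ∑ d ∈ faceDarts r, toll m d := by
  classical
  have h1 : ∑ d ∈ faceDarts r, toll m d =
      4 * ((lights r t).card : ℤ) + ∑ d ∈ faceDarts r, excess m t d := by
    rw [lights, Finset.card_filter, Nat.cast_sum, Finset.mul_sum, ← Finset.sum_add_distrib]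
    apply Finset.sum_congr rfl
    intro d _
    unfold excess
    cases (t d).heavy 3 <;> simp
  have h2 : (l.map (excess m t)).sum = ∑ d ∈ l.toFinset, excess m t d :=
    (List.sum_toFinset _ hl).symm
  have h3 : ∑ d ∈ l.toFinset, excess m t d ≤ ∑ d ∈ faceDarts r, excess m t d := by
    apply Finset.sum_le_sum_of_subset_of_nonneg
    · intro x hx
      exact mem_faceDarts.2 (h x (List.mem_toFinset.1 hx))
    · intro x hx _
      exact L.excess_nonneg (mem_faceDarts.1 hx)
  omega

theorem LargeRegion.nodup (L : LargeRegion m r t) (h3 : ThreeConnected P.graph)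
    {c : P.graph.Dart} (hc : P.side c = r) :
    [c, P.fc c, P.fc (P.fc c), P.fc (P.fc (P.fc c)), P.fc (P.fc (P.fc (P.fc c)))].Nodup := by
  have n1 := P.fc_ne
  have n2 := P.fc_fc_ne h3
  have n3 : ∀ d, P.side d = r → P.fc (P.fc (P.fc d)) ≠ d := L.not_tri
  have n4 : ∀ d, P.side d = r → P.fc (P.fc (P.fc (P.fc d))) ≠ d := L.not_quad
  simp only [List.nodup_cons, List.mem_cons, List.not_mem_nil, or_false, not_or, not_false_eq_true,
    List.nodup_nil, and_true]
  exact ⟨⟨(n1 _).symm, (n2 _).symm, (n3 _ hc).symm, (n4 _ hc).symm⟩,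
    ⟨(n1 _).symm, (n2 _).symm, (n3 _ (by simpa using hc)).symm⟩,
    ⟨(n1 _).symm, (n2 _).symm⟩, (n1 _).symm⟩

theorem LargeRegion.five_le_card (L : LargeRegion m r t) (h3 : ThreeConnected P.graph) :
    5 ≤ (faceDarts r).card := by
  classical
  obtain ⟨c, hc⟩ := P.exists_side r
  have h1 := L.nodup h3 hc
  rw [show 5 = ([c, P.fc c, P.fc (P.fc c), P.fc (P.fc (P.fc c)),
    P.fc (P.fc (P.fc (P.fc c)))] : List _).length from rfl, ← List.toFinset_card_of_nodup h1]
  apply Finset.card_le_card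
  intro x hx
  simp only [List.mem_toFinset, List.mem_cons, List.not_mem_nil, or_false] at hx
  rw [mem_faceDarts]
  rcases hx with rfl | rfl | rfl | rfl | rfl <;> simpa using hc

namespace LargeRegion

theorem conf15 (L : LargeRegion m r t) (h : IsPrimeTarget P m) {d : P.graph.Dart}
    (hd : P.side d = r) (hp : 4 ≤ (t d).pm) : ∃ b, Far d b ∧ Light r t b := by
  rw [(L.sees d hd).pm_eq] at hp
  obtain ⟨b, hb, hh⟩ := PlaneGraph.conf15 h (L.not_tri d hd) hp
  exact ⟨b, hb, hb.side hd, L.not_hv (hb.side hd) hh⟩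

theorem conf17 (L : LargeRegion m r t) (h : IsPrimeTarget P m) {d : P.graph.Dart}
    (hd : P.side d = r) (hp : 5 ≤ (t d).pm) : (∃ b, Far d b ∧ (t b).pm < 2) ∨
      ∃ b b', (Far d b ∧ Light r t b) ∧ (Far d b' ∧ Light r t b') ∧ b ≠ b' := by
  rw [(L.sees d hd).pm_eq] at hp
  rcases PlaneGraph.conf17 h (L.not_tri d hd) (L.not_quad d hd) hp with ⟨b, hb, hh⟩ |
    ⟨b, b', ⟨hb, hh⟩, ⟨hb', hh'⟩, hne⟩
  · exact Or.inl ⟨b, hb, by rwa [(L.sees b (hb.side hd)).pm_eq]⟩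
  · exact Or.inr ⟨b, b', ⟨hb, hb.side hd, L.not_hv (hb.side hd) hh⟩,
      ⟨hb', hb'.side hd, L.not_hv (hb'.side hd) hh'⟩, hne⟩

theorem conf19 (L : LargeRegion m r t) (h : IsPrimeTarget P m) {d : P.graph.Dart}
    (hd : P.side d = r) (hp : 5 ≤ (t d).pm) : (∃ b, Far d b ∧ Light r t b ∧ 6 ≤ lo (t b)) ∨
      ∃ a b c, (Far d a ∧ Light r t a) ∧ (Far d b ∧ Light r t b) ∧ (Far d c ∧ Light r t c) ∧
        a ≠ b ∧ a ≠ c ∧ b ≠ c := by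
  rw [(L.sees d hd).pm_eq] at hp
  rcases PlaneGraph.conf19 h (L.not_tri d hd) (L.not_quad d hd) hp with ⟨b, hb, hh⟩ |
    ⟨a, b, c, ha, hb, hc, h1, h2, h3⟩
  · have hs := hb.side hd
    have := (single_spec (L.sees b hs).mem).2.1 (L.not_hv hs hh)
    exact Or.inl ⟨b, hb, ⟨hs, this.2⟩, this.1⟩
  · exact Or.inr ⟨a, b, c, ⟨ha.1, ha.1.side hd, L.not_hv (ha.1.side hd) ha.2⟩,
      ⟨hb.1, hb.1.side hd, L.not_hv (hb.1.side hd) hb.2⟩,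
      ⟨hc.1, hc.1.side hd, L.not_hv (hc.1.side hd) hc.2⟩, h1, h2, h3⟩

theorem attTail (L : LargeRegion m r t) (h : IsPrimeTarget P m) {d : P.graph.Dart}
    (hd : P.side d = r) :
    (attTail 4 (t (P.fc.symm d)) (t d) = true → ∃ b, OffTail d b ∧ Light r t b) ∧
      (attTail 5 (t (P.fc.symm d)) (t d) = true → (∃ b, OffTail d b ∧ (t b).pm < 2) ∨
        ∃ b b', (OffTail d b ∧ Light r t b) ∧ (OffTail d b' ∧ Light r t b') ∧ b ≠ b') := by
  have hs := L.sees d hd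
  have hp := (L.sees (P.fc.symm d) (by simpa using hd)).hm
  constructor
  · intro ha
    simp only [EdgeData.attTail, Bool.and_eq_true, leb_iff, eqb_iff] at ha
    obtain ⟨hk, ⟨h1, h2⟩, h3⟩ := ha
    obtain ⟨ht, -, hl, hr, -⟩ := hs.tri hk
    have hpl := hs.pl_le hk
    rw [← hl, ← hr] at h1
    rw [hp, ← hl] at h2
    rw [hs.hm] at h3
    obtain ⟨b, hb, hh⟩ := conf16_tail h ht h1 h2 (by omega)
    exact ⟨b, hb, hb.1.trans hd, L.not_hv (hb.1.trans hd) hh⟩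
  · intro ha
    simp only [EdgeData.attTail, Bool.and_eq_true, leb_iff, eqb_iff] at ha
    obtain ⟨hk, ⟨h1, h2⟩, h3⟩ := ha
    obtain ⟨ht, -, hl, hr, -⟩ := hs.tri hk
    have hpl := hs.pl_le hk
    rw [← hl, ← hr] at h1
    rw [hp, ← hl] at h2
    rw [hs.hm] at h3
    rcases conf18_tail h (L.not_tri d hd) ht h1 h2 (by omega) with ⟨b, hb, hh⟩ |
      ⟨b, b', ⟨hb, hh⟩, ⟨hb', hh'⟩, hne⟩
    · exact Or.inl ⟨b, hb, by rwa [(L.sees b (hb.1.trans hd)).pm_eq]⟩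
    · exact Or.inr ⟨b, b', ⟨hb, hb.1.trans hd, L.not_hv (hb.1.trans hd) hh⟩,
        ⟨hb', hb'.1.trans hd, L.not_hv (hb'.1.trans hd) hh'⟩, hne⟩

theorem attHead (L : LargeRegion m r t) (h : IsPrimeTarget P m) {d : P.graph.Dart}
    (hd : P.side d = r) :
    (attHead 4 (t d) (t (P.fc d)) = true → ∃ b, OffHead d b ∧ Light r t b) ∧
      (attHead 5 (t d) (t (P.fc d)) = true → (∃ b, OffHead d b ∧ (t b).pm < 2) ∨
        ∃ b b', (OffHead d b ∧ Light r t b) ∧ (OffHead d b' ∧ Light r t b') ∧ b ≠ b') := by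
  have hs := L.sees d hd
  have hp := (L.sees (P.fc d) (by simpa using hd)).hm
  constructor
  · intro ha
    simp only [EdgeData.attHead, Bool.and_eq_true, leb_iff, eqb_iff] at ha
    obtain ⟨hk, ⟨h1, h2⟩, h3⟩ := ha
    obtain ⟨ht, -, hl, hr, -⟩ := hs.tri hk
    have hpr := hs.pr_le hk
    rw [← hl, ← hr] at h1
    rw [hp, ← hr] at h2
    rw [hs.hm] at h3
    obtain ⟨b, hb, hh⟩ := conf16_head h ht h1 h2 (by omega)
    exact ⟨b, hb, hb.1.trans hd, L.not_hv (hb.1.trans hd) hh⟩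
  · intro ha
    simp only [EdgeData.attHead, Bool.and_eq_true, leb_iff, eqb_iff] at ha
    obtain ⟨hk, ⟨h1, h2⟩, h3⟩ := ha
    obtain ⟨ht, -, hl, hr, -⟩ := hs.tri hk
    have hpr := hs.pr_le hk
    rw [← hl, ← hr] at h1
    rw [hp, ← hr] at h2
    rw [hs.hm] at h3
    rcases conf18_head h (L.not_tri d hd) ht h1 h2 (by omega) with ⟨b, hb, hh⟩ |
      ⟨b, b', ⟨hb, hh⟩, ⟨hb', hh'⟩, hne⟩
    · exact Or.inl ⟨b, hb, by rwa [(L.sees b (hb.1.trans hd)).pm_eq]⟩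
    · exact Or.inr ⟨b, b', ⟨hb, hb.1.trans hd, L.not_hv (hb.1.trans hd) hh⟩,
        ⟨hb', hb'.1.trans hd, L.not_hv (hb'.1.trans hd) hh'⟩, hne⟩

/-- A door has multiplicity one and no triangle across it, so nothing can make it `3`-heavy. -/
theorem light_of_door (L : LargeRegion m r t) (h : IsPrimeTarget P m) {b : P.graph.Dart}
    (hb : P.side b = r) (hd : P.Door m (P.side b) b.edge) : Light r t b :=
  ⟨hb, (single_spec (L.sees b hb).mem).2.2.2.2.2 ((L.sees b hb).isDoor h hd)⟩

theorem isH (L : LargeRegion m r t) (h : IsPrimeTarget P m) {d : P.graph.Dart}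
    (hd : P.side d = r) (hH : isH (t d) = true) : ∃ b, Far d b ∧ Light r t b := by
  obtain ⟨b, hb, hdoor⟩ := (L.sees d hd).exists_door_of_isH h hH
  exact ⟨b, hb, L.light_of_door h (hb.side hd) (side_door hb hdoor)⟩

theorem fits (L : LargeRegion m r t) (h : IsPrimeTarget P m) {d : P.graph.Dart}
    (hd : P.side d = r) : fits (t d) (t (P.fc d)) = true :=
  (L.sees d hd).fits h (L.sees _ (by simpa using hd))

theorem triples (L : LargeRegion m r t) (h : IsPrimeTarget P m)
    {q : EdgeData → EdgeData → EdgeData → Bool} (hq : triples q = true) {d : P.graph.Dart}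
    (hd : P.side d = r) : q (t (P.fc.symm d)) (t d) (t (P.fc d)) = true := by
  have hp : P.side (P.fc.symm d) = r := by simpa using hd
  have h1 := L.fits h hp
  rw [Equiv.apply_symm_apply] at h1
  exact triples_spec hq (L.sees _ hp).mem (L.sees _ hd).mem (L.sees _ (by simpa using hd)).mem h1
    (L.fits h hd)

theorem cost_le (L : LargeRegion m r t) (h : IsPrimeTarget P m) {d : P.graph.Dart}
    (hd : P.side d = r) {door elig : Bool}
    (hdoor : Bg m d → P.Door m (P.side d.symm) d.edge → door = true)
    (helig : Elig m d → elig = true) :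
    (cost (t d) (t (P.fc.symm d)) (t (P.fc d)) door elig : ℤ) ≤ toll m d :=
  (L.sees d hd).cost_le h (hd ▸ L.small) (L.sees _ (by simpa using hd))
    (L.sees _ (by simpa using hd)) hdoor helig

/-- Two consecutive cheap edges would both have multiplicity at least four, against `adjacent_le`.
-/
theorem two_le_lo_next (L : LargeRegion m r t) (h : IsPrimeTarget P m) {d : P.graph.Dart}
    (hd : P.side d = r) (h0 : lo (t d) < 2) : 2 ≤ lo (t (P.fc d)) := by
  by_contra! h1
  have hs : P.side (P.fc d) = r := by simpa using hd
  have k1 := ((single_spec (L.sees d hd).mem).2.2.2.1 h0).2.1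
  have k2 := ((single_spec (L.sees _ hs).mem).2.2.2.1 h1).2.1
  rw [(L.sees d hd).hm] at k1
  rw [(L.sees _ hs).hm] at k2
  have := adjacent_le h d
  omega

theorem two_le_lo_prev (L : LargeRegion m r t) (h : IsPrimeTarget P m) {d : P.graph.Dart}
    (hd : P.side d = r) (h0 : lo (t d) < 2) : 2 ≤ lo (t (P.fc.symm d)) := by
  by_contra! h1
  have := L.two_le_lo_next h (d := P.fc.symm d) (by simpa using hd) h1
  rw [Equiv.apply_symm_apply] at this
  omega

theorem sum_of_four_le (L : LargeRegion m r t) (hN : 4 ≤ (lights r t).card) :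
    16 ≤ ∑ d ∈ faceDarts r, toll m d := by
  have := L.le_sum List.nodup_nil (by simp)
  simp only [List.map_nil, List.sum_nil] at this
  omega

/-- Every edge takes at least four and there are at least five of them. With no light edge, `conf15`
caps `m⁺` at three, `conf8` and `conf16` exclude the other exceptions of the table, and there is no
door, so nothing is received by virtue of eligibility. -/
theorem sum_of_zero (L : LargeRegion m r t) (h : IsPrimeTarget P m)
    (hN : ∀ d, ¬ Light r t d) : 16 ≤ ∑ d ∈ faceDarts r, toll m d := by
  have hh : ∀ d, P.side d = r → (t d).heavy 3 = true := fun d hd => heavy_of_not_light hd (hN d)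
  have hp : ∀ d, P.side d = r → (t d).pm ≤ 3 := by
    intro d hd
    by_contra! h4
    obtain ⟨b, -, hb⟩ := L.conf15 h hd h4
    exact hN b hb
  have key : ∀ d, P.side d = r → 4 ≤ excess m t d := by
    intro d hd
    have h1 := L.triples h allHeavy_true hd
    have sp : P.side (P.fc.symm d) = r := by simpa using hd
    have sn : P.side (P.fc d) = r := by simpa using hd
    simp only [allHeavy, hh _ sp, hh _ hd, hh _ sn, leb_iff.2 (hp _ sp), leb_iff.2 (hp _ hd),
      leb_iff.2 (hp _ sn), Bool.and_true, Bool.not_true, Bool.false_or, Bool.or_eq_true,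
      leb_iff] at h1
    rcases h1 with ((h1 | h1) | h1) | h1
    · obtain ⟨b, -, hb⟩ := L.isH h hd h1
      exact absurd hb (hN b)
    · obtain ⟨b, -, hb⟩ := (L.attTail h hd).1 h1
      exact absurd hb (hN b)
    · obtain ⟨b, -, hb⟩ := (L.attHead h hd).1 h1
      exact absurd hb (hN b)
    · have := L.cost_le h hd (door := true) (elig := false) (fun _ _ => rfl) (fun he => by
        exfalso
        rcases he.cases with h2 | ⟨b, hb, hdoor⟩
        · have := (Set.nonempty_of_ncard_ne_zero (by omega :
            {f | P.Door m (P.side d) f}.ncard ≠ 0))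
          obtain ⟨f, hf⟩ := this
          obtain ⟨⟨b, hb, rfl⟩, -⟩ := id hf
          exact hN b (L.light_of_door h (hb.trans hd) (by
            rw [show P.side b = P.side d from hb]
            exact hf))
        · exact hN b (L.light_of_door h (hb.side hd) (side_door hb hdoor)))
      rw [excess_heavy (hh d hd)]
      omega
  obtain ⟨c, hc⟩ := P.exists_side r
  have s1 : P.side (P.fc c) = r := by simpa using hc
  have s2 : P.side (P.fc (P.fc c)) = r := by simpa using hc
  have s3 : P.side (P.fc (P.fc (P.fc c))) = r := by simpa using hc
  have s4 : P.side (P.fc (P.fc (P.fc (P.fc c)))) = r := by simpa using hc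
  have := L.le_sum (L.nodup h.threeConnected hc) (by
    simp only [List.mem_cons, List.not_mem_nil, or_false]
    rintro x (rfl | rfl | rfl | rfl | rfl) <;> assumption)
  simp only [List.map_cons, List.map_nil, List.sum_cons, List.sum_nil] at this
  have k0 := key _ hc
  have k1 := key _ s1
  have k2 := key _ s2
  have k3 := key _ s3
  have k4 := key _ s4
  omega

end LargeRegion

end PlaneGraph

/-! ### One or three light edges. -/

namespace PlaneGraph

open EdgeData

variable {V : Type*} {P : PlaneGraph V} {m : Sym2 V → ℕ} {r : P.Region}
  {t : P.graph.Dart → EdgeData}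

/-- Two edges of a region of length at least five have different neighbours. -/
theorem LargeRegion.not_crossed (L : LargeRegion m r t) {x y : P.graph.Dart} (hx : P.side x = r)
    (h1 : P.fc y = P.fc.symm x) (h2 : P.fc.symm y = P.fc x) : False := by
  apply L.not_quad x hx
  rw [Quad, ← h2, Equiv.apply_symm_apply, h1, Equiv.apply_symm_apply]

variable [Finite V]

namespace LargeRegion

/-- Any light witness must be `f`, which is adjacent to `P.fc f`; hence `conf15`, `isH` and
attachment at the tail are ruled out. Attachment of weight five is ruled out too, unless `m⁺` of `f`
is one. -/
theorem after_light (L : LargeRegion m r t) (h : IsPrimeTarget P m) {f : P.graph.Dart}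
    (hf : ∀ d, Light r t d ↔ d = f) :
    if (t f).pm ≤ 1 then 3 ≤ toll m (P.fc f) ∧
        4 ≤ (shareBound (t f) (t (P.fc f)) (t (P.fc f)).l false : ℤ) + toll m (P.fc f)
      else 4 ≤ toll m (P.fc f) ∨ (6 ≤ lo (t f) ∧ 3 ≤ toll m (P.fc f)) := by
  have hl := (hf f).2 rfl
  have hs : P.side (P.fc f) = r := by simpa using hl.1
  have hs' : P.side (P.fc (P.fc f)) = r := by simpa using hs
  have hn : (t (P.fc f)).heavy 3 = true := heavy_of_not_light hs fun k => P.fc_ne f ((hf _).1 k)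
  have ho : (t (P.fc (P.fc f))).heavy 3 = true := heavy_of_not_light hs' fun k =>
    P.fc_fc_ne h.threeConnected f ((hf _).1 k)
  have hp : (t (P.fc f)).pm ≤ 3 := by
    by_contra! h4
    obtain ⟨b, hb, hb'⟩ := L.conf15 h hs h4
    rw [hf] at hb'
    subst hb'
    exact hb.2.2.2 (by simp)
  have h1 := L.triples h afterLight_true hs
  have hc := L.cost_le h hs (door := true) (elig := true) (fun _ _ => rfl) fun _ => rfl
  rw [Equiv.symm_apply_apply] at h1 hc
  have k1 : EdgeData.isH (t (P.fc f)) = false := by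
    rw [← Bool.not_eq_true]
    intro hH
    obtain ⟨b, hb, hb'⟩ := L.isH h hs hH
    rw [hf] at hb'
    subst hb'
    exact hb.2.2.2 (by simp)
  have k2 : EdgeData.attTail 4 (t f) (t (P.fc f)) = false := by
    rw [← Bool.not_eq_true]
    intro hH
    obtain ⟨b, hb, hb'⟩ := (L.attTail h hs).1 (by rwa [Equiv.symm_apply_apply])
    rw [hf] at hb'
    subst hb'
    exact hb.2.2 (by simp)
  simp only [afterLight, hn, ho, hl.2, leb_iff.2 hp, k1, k2, Bool.and_true, Bool.not_true,
    Bool.not_false, Bool.false_or, cost0] at h1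
  split_ifs with hpm
  · rw [leb_iff.2 hpm, cond_true, Bool.and_eq_true, leb_iff, leb_iff] at h1
    omega
  · have k3 : EdgeData.attTail 5 (t f) (t (P.fc f)) = false := by
      rw [← Bool.not_eq_true]
      intro hH
      rcases (L.attTail h hs).2 (by rwa [Equiv.symm_apply_apply]) with ⟨b, hb, hb'⟩ |
        ⟨b, b', ⟨hb, hb'⟩, ⟨-, hb''⟩, hne⟩
      · have := (hf b).1 (L.light_of_pm (hb.1.trans hs) hb')
        subst this
        omega
      · exact hne (((hf _).1 hb').trans ((hf _).1 hb'').symm)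
    have k4 : EdgeData.attHead 5 (t (P.fc f)) (t (P.fc (P.fc f))) = false := by
      rw [← Bool.not_eq_true]
      intro hH
      rcases (L.attHead h hs).2 hH with ⟨b, hb, hb'⟩ | ⟨b, b', ⟨hb, hb'⟩, ⟨-, hb''⟩, hne⟩
      · have := (hf b).1 (L.light_of_pm (hb.1.trans hs) hb')
        subst this
        omega
      · exact hne (((hf _).1 hb').trans ((hf _).1 hb'').symm)
    rw [leb_false.2 (by omega), cond_false, k3, k4] at h1
    simp only [Bool.false_or, Bool.or_eq_true, Bool.and_eq_true, leb_iff] at h1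
    omega

/-- The mirror image of `after_light`; orientation makes it a separate computation. -/
theorem before_light (L : LargeRegion m r t) (h : IsPrimeTarget P m) {f : P.graph.Dart}
    (hf : ∀ d, Light r t d ↔ d = f) :
    if (t f).pm ≤ 1 then 3 ≤ toll m (P.fc.symm f) ∧
        4 ≤ (shareBound (t f) (t (P.fc.symm f)) (t (P.fc.symm f)).r false : ℤ) +
          toll m (P.fc.symm f)
      else 4 ≤ toll m (P.fc.symm f) ∨ (6 ≤ lo (t f) ∧ 3 ≤ toll m (P.fc.symm f)) := by
  have hl := (hf f).2 rfl
  have hs : P.side (P.fc.symm f) = r := by simpa using hl.1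
  have hs' : P.side (P.fc.symm (P.fc.symm f)) = r := by simpa using hs
  have hn : (t (P.fc.symm f)).heavy 3 = true := heavy_of_not_light hs fun k =>
    P.fc_ne f ((Equiv.symm_apply_eq _).1 ((hf _).1 k)).symm
  have ho : (t (P.fc.symm (P.fc.symm f))).heavy 3 = true := heavy_of_not_light hs' fun k =>
    P.fc_fc_ne h.threeConnected f (by
      have := (hf _).1 k
      rw [Equiv.symm_apply_eq, Equiv.symm_apply_eq] at this
      exact this.symm)
  have hp : (t (P.fc.symm f)).pm ≤ 3 := by
    by_contra! h4
    obtain ⟨b, hb, hb'⟩ := L.conf15 h hs h4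
    rw [hf] at hb'
    subst hb'
    exact hb.2.2.1 (by simp)
  have h1 := L.triples h beforeLight_true hs
  have hc := L.cost_le h hs (door := true) (elig := true) (fun _ _ => rfl) fun _ => rfl
  rw [Equiv.apply_symm_apply] at h1 hc
  have k1 : EdgeData.isH (t (P.fc.symm f)) = false := by
    rw [← Bool.not_eq_true]
    intro hH
    obtain ⟨b, hb, hb'⟩ := L.isH h hs hH
    rw [hf] at hb'
    subst hb'
    exact hb.2.2.1 (by simp)
  have k2 : EdgeData.attHead 4 (t (P.fc.symm f)) (t f) = false := by
    rw [← Bool.not_eq_true]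
    intro hH
    obtain ⟨b, hb, hb'⟩ := (L.attHead h hs).1 (by rwa [Equiv.apply_symm_apply])
    rw [hf] at hb'
    subst hb'
    exact hb.2.2 (by simp)
  simp only [beforeLight, hn, ho, hl.2, leb_iff.2 hp, k1, k2, Bool.and_true, Bool.not_true,
    Bool.not_false, Bool.false_or, cost0] at h1
  split_ifs with hpm
  · rw [leb_iff.2 hpm, cond_true, Bool.and_eq_true, leb_iff, leb_iff] at h1
    omega
  · have k3 : EdgeData.attHead 5 (t (P.fc.symm f)) (t f) = false := by
      rw [← Bool.not_eq_true]
      intro hH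
      rcases (L.attHead h hs).2 (by rwa [Equiv.apply_symm_apply]) with ⟨b, hb, hb'⟩ |
        ⟨b, b', ⟨hb, hb'⟩, ⟨-, hb''⟩, hne⟩
      · have := (hf b).1 (L.light_of_pm (hb.1.trans hs) hb')
        subst this
        omega
      · exact hne (((hf _).1 hb').trans ((hf _).1 hb'').symm)
    have k4 : EdgeData.attTail 5 (t (P.fc.symm (P.fc.symm f))) (t (P.fc.symm f)) = false := by
      rw [← Bool.not_eq_true]
      intro hH
      rcases (L.attTail h hs).2 hH with ⟨b, hb, hb'⟩ | ⟨b, b', ⟨hb, hb'⟩, ⟨-, hb''⟩, hne⟩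
      · have := (hf b).1 (L.light_of_pm (hb.1.trans hs) hb')
        subst this
        omega
      · exact hne (((hf _).1 hb').trans ((hf _).1 hb'').symm)
    rw [leb_false.2 (by omega), cond_false, k3, k4] at h1
    simp only [Bool.false_or, Bool.or_eq_true, Bool.and_eq_true, leb_iff] at h1
    omega

/-- An edge with `m⁺` equal to one takes at least eight, unless it is a door for the region
across it. -/
theorem toll_of_pm (L : LargeRegion m r t) (h : IsPrimeTarget P m) {f : P.graph.Dart}
    (hf : P.side f = r) (hp : (t f).pm < 2) (hdoor : ¬ P.Door m (P.side f.symm) f.edge) :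
    6 + (shareBound (t f) (t (P.fc.symm f)) (t (P.fc.symm f)).r false : ℤ) +
      shareBound (t f) (t (P.fc f)) (t (P.fc f)).l false ≤ toll m f := by
  have hc := L.cost_le h hf (door := false) (elig := true) (fun _ k => absurd k hdoor) fun _ => rfl
  obtain ⟨-, -, hm, hk⟩ := (single_spec (L.sees f hf).mem).2.2.1 hp
  rw [cost, hk, eqb_iff.2 rfl, cond_true, hm] at hc
  omega

theorem sum_of_one (L : LargeRegion m r t) (h : IsPrimeTarget P m) {c : P.graph.Dart}
    (hf : ∀ d, Light r t d ↔ d = P.fc c) : 16 ≤ ∑ d ∈ faceDarts r, toll m d := by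
  have hN : (lights r t).card = 1 := by
    rw [Finset.card_eq_one]
    refine ⟨P.fc c, ?_⟩
    ext d
    rw [mem_lights, hf, Finset.mem_singleton]
  have hlight := (hf _).2 rfl
  have sf := hlight.1
  have ha := L.after_light h hf
  have hb := L.before_light h hf
  rw [Equiv.symm_apply_apply] at hb
  have hc : P.side c = r := by simpa using sf
  have s2 : P.side (P.fc (P.fc c)) = r := by simpa using hc
  have s3 : P.side (P.fc (P.fc (P.fc c))) = r := by simpa using hc
  have s4 : P.side (P.fc (P.fc (P.fc (P.fc c)))) = r := by simpa using hc
  have hnd := L.nodup h.threeConnected hc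
  have hall : ∀ x ∈ [c, P.fc c, P.fc (P.fc c), P.fc (P.fc (P.fc c)),
      P.fc (P.fc (P.fc (P.fc c)))], P.side x = r := by
    simp only [List.mem_cons, List.not_mem_nil, or_false]
    rintro x (rfl | rfl | rfl | rfl | rfl) <;> assumption
  have hsum := L.le_sum hnd hall
  simp only [List.map_cons, List.map_nil, List.sum_cons, List.sum_nil] at hsum
  simp only [List.nodup_cons, List.mem_cons, List.not_mem_nil, or_false, not_or,
    not_false_eq_true, List.nodup_nil, and_true] at hnd
  obtain ⟨⟨n01, n02, n03, n04⟩, ⟨n12, n13, n14⟩, ⟨n23, n24⟩, n34⟩ := hnd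
  have ef := excess_light (m := m) hlight
  have heavy : ∀ x, P.side x = r → x ≠ P.fc c → (t x).heavy 3 = true := fun x hx hne =>
    heavy_of_not_light hx fun k => hne ((hf x).1 k)
  have e0 := excess_heavy (m := m) (heavy _ hc n01)
  have e2 := excess_heavy (m := m) (heavy _ s2 (Ne.symm n12))
  have e3 := excess_heavy (m := m) (heavy _ s3 (Ne.symm n13))
  have e4 := excess_heavy (m := m) (heavy _ s4 (Ne.symm n14))
  have l1 := L.lo_le sf
  have l3 := L.lo_le s3
  have l4 := L.lo_le s4
  have hf4 := (single_spec (L.sees _ sf).mem).1 hlight.2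
  split_ifs at ha hb with hpm
  · have h6 := ((single_spec (L.sees _ sf).mem).2.2.1 (by omega)).1
    -- If the light edge is a door for the region across, there is a far edge of multiplicity one,
    -- which is heavy and takes four: 6 + 3 + 3 + 4.
    by_cases hdoor : P.Door m (P.side (P.fc c).symm) (P.fc c).edge
    · obtain ⟨y, hy, hy1⟩ := exists_far_of_door_across h hdoor
      have hys := hy.side sf
      have hyh := heavy y hys hy.2.1
      have := (single_spec (L.sees _ hys).mem).2.2.2.2.1 hyh ((L.sees _ hys).hm.trans hy1)
      have ly := L.lo_le hys
      have ey := excess_heavy (m := m) hyh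
      have hy3 := hy.2.2.2
      rw [Equiv.symm_apply_apply] at hy3
      have := L.le_sum (l := [c, P.fc c, P.fc (P.fc c), y]) (by
        simp only [List.nodup_cons, List.mem_cons, List.not_mem_nil, or_false, not_or,
          not_false_eq_true, List.nodup_nil, and_true]
        exact ⟨⟨n01, n02, hy3.symm⟩, ⟨n12, hy.2.1.symm⟩, hy.2.2.1.symm⟩) (by
        simp only [List.mem_cons, List.not_mem_nil, or_false]
        rintro x (rfl | rfl | rfl | rfl) <;> assumption)
      simp only [List.map_cons, List.map_nil, List.sum_cons, List.sum_nil] at this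
      omega
    -- The two shares complete the neighbours to four each, giving 6 + 4 + 4, and of the next two
    -- edges one takes two because they are not both cheap.
    · have hT := L.toll_of_pm h sf (by omega) hdoor
      rw [Equiv.symm_apply_apply] at hT
      by_cases h3 : lo (t (P.fc (P.fc (P.fc c)))) < 2
      · have := L.two_le_lo_next h s3 h3
        omega
      · omega
  -- A cheap edge would, by `conf17`, need two light edges or one with `m⁺` one. So the two
  -- remaining edges take two each, and the light edge with its neighbours takes at least twelve.
  · have hz : ∀ x, P.side x = r → 2 ≤ lo (t x) := by
      intro x hx
      by_contra! h2
      have h5 := ((single_spec (L.sees x hx).mem).2.2.2.1 h2).1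
      rcases L.conf17 h hx h5 with ⟨b, hb, hb'⟩ | ⟨b, b', ⟨-, hb'⟩, ⟨-, hb''⟩, hne⟩
      · have := (hf b).1 (L.light_of_pm (hb.side hx) hb')
        subst this
        omega
      · exact hne (((hf _).1 hb').trans ((hf _).1 hb'').symm)
    have z3 := hz _ s3
    have z4 := hz _ s4
    omega

theorem fc_ne_fc_inv (h : IsPrimeTarget P m) (x : P.graph.Dart) : P.fc x ≠ P.fc.symm x := by
  intro hx
  have := congrArg P.fc hx
  rw [Equiv.apply_symm_apply] at this
  exact P.fc_fc_ne h.threeConnected x this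

/-- If three edges are not `3`-heavy and the sum is small, then the edges next to an edge `x` with
`m⁺` equal to five are two of them, and the third one takes six. -/
theorem exists_of_card_three (L : LargeRegion m r t) (h : IsPrimeTarget P m)
    (hN : (lights r t).card = 3) (hsum : ∑ d ∈ faceDarts r, toll m d < 16) {x : P.graph.Dart}
    (hx : P.side x = r) (h0 : lo (t x) < 2) :
    ∃ b, Far x b ∧ Light r t b ∧ 2 ≤ excess m t b ∧ Light r t (P.fc x) ∧
      Light r t (P.fc.symm x) := by
  have sn : P.side (P.fc x) = r := by simpa using hx
  have sp : P.side (P.fc.symm x) = r := by simpa using hx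
  have ln := L.two_le_lo_next h hx h0
  have lp := L.two_le_lo_prev h hx h0
  have en : ¬ Light r t (P.fc x) → 2 ≤ excess m t (P.fc x) := fun k => by
    have := L.lo_le sn
    rw [excess_heavy (heavy_of_not_light sn k)]
    omega
  have ep : ¬ Light r t (P.fc.symm x) → 2 ≤ excess m t (P.fc.symm x) := fun k => by
    have := L.lo_le sp
    rw [excess_heavy (heavy_of_not_light sp k)]
    omega
  have h5 := ((single_spec (L.sees x hx).mem).2.2.2.1 h0).1
  rcases L.conf19 h hx h5 with ⟨b, hb, hl, h6⟩ | ⟨a, b, c, ha, hb, hc, hab, hac, hbc⟩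
  · have sb := hb.side hx
    have eb : 2 ≤ excess m t b := by
      have := L.lo_le sb
      rw [excess_light hl]
      omega
    refine ⟨b, hb, hl, eb, ?_, ?_⟩
    · by_contra k
      have := en k
      have := L.le_sum (l := [P.fc x, b]) (by simpa using hb.2.2.1.symm) (by
        simp only [List.mem_cons, List.not_mem_nil, or_false]
        rintro y (rfl | rfl) <;> assumption)
      simp only [List.map_cons, List.map_nil, List.sum_cons, List.sum_nil] at this
      omega
    · by_contra k
      have := ep k
      have := L.le_sum (l := [P.fc.symm x, b]) (by simpa using hb.2.2.2.symm) (by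
        simp only [List.mem_cons, List.not_mem_nil, or_false]
        rintro y (rfl | rfl) <;> assumption)
      simp only [List.map_cons, List.map_nil, List.sum_cons, List.sum_nil] at this
      omega
  -- The three far edges are all the light ones, so both neighbours of `x` are heavy and supply the
  -- whole missing excess of four.
  · exfalso
    have key : ∀ y, Light r t y → y = a ∨ y = b ∨ y = c := by
      intro y hy
      have := mem_of_light (l := [a, b, c]) (by simp [hab, hac, hbc]) (by
        simp only [List.mem_cons, List.not_mem_nil, or_false]
        rintro y (rfl | rfl | rfl)
        exacts [ha.2, hb.2, hc.2]) (by simp [hN]) hy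
      simpa using this
    have kn := en fun k => by
      rcases key _ k with h' | h' | h'
      exacts [ha.1.2.2.1 h'.symm, hb.1.2.2.1 h'.symm, hc.1.2.2.1 h'.symm]
    have kp := ep fun k => by
      rcases key _ k with h' | h' | h'
      exacts [ha.1.2.2.2 h'.symm, hb.1.2.2.2 h'.symm, hc.1.2.2.2 h'.symm]
    have := L.le_sum (l := [P.fc x, P.fc.symm x]) (by simpa using fc_ne_fc_inv h x) (by
        simp only [List.mem_cons, List.not_mem_nil, or_false]
        rintro y (rfl | rfl) <;> assumption)
    simp only [List.map_cons, List.map_nil, List.sum_cons, List.sum_nil] at this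
    omega

/-- An excess of four is missing, and there are at least two heavy edges. Those that are not cheap
give two each. A cheap one comes with a far light edge of excess two and with light neighbours. Two
cheap ones come with different such far edges, or else share both neighbours, which would close the
boundary to a square. -/
theorem sum_of_three (L : LargeRegion m r t) (h : IsPrimeTarget P m)
    (hN : (lights r t).card = 3) : 16 ≤ ∑ d ∈ faceDarts r, toll m d := by
  by_contra! hsum
  have h5 := L.five_le_card h.threeConnected
  have e2 : ∀ y, P.side y = r → (t y).heavy 3 = true → ¬ lo (t y) < 2 → 2 ≤ excess m t y := by
    intro y hy hh h2
    have := L.lo_le hy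
    rw [excess_heavy hh]
    omega
  by_cases hz : ∃ x, P.side x = r ∧ lo (t x) < 2
  · obtain ⟨x, hx, h0⟩ := hz
    obtain ⟨b, hb, hbl, hbe, hn, hp⟩ := L.exists_of_card_three h hN hsum hx h0
    obtain ⟨y, hy, hyh, hyx⟩ := exists_heavy (t := t) (r := r) [x] (by simp [hN]; omega)
    have hby : b ≠ y := fun k => by
      rw [← k, hbl.2] at hyh
      exact absurd hyh (by decide)
    by_cases hy2 : lo (t y) < 2
    · obtain ⟨b', hb', hbl', hbe', hn', hp'⟩ := L.exists_of_card_three h hN hsum hy hy2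
      by_cases hbb : b = b'
      · subst hbb
        have key : ∀ z, Light r t z → z = b ∨ z = P.fc x ∨ z = P.fc.symm x := by
          intro z hz
          have := mem_of_light (l := [b, P.fc x, P.fc.symm x])
            (by simp [hb.2.2.1, hb.2.2.2, fc_ne_fc_inv h x]) (by
            simp only [List.mem_cons, List.not_mem_nil, or_false]
            rintro y (rfl | rfl | rfl)
            exacts [hbl, hn, hp]) (by simp [hN]) hz
          simpa using this
        have hne : y ≠ x := by simpa using hyx
        refine L.not_crossed hx (y := y) ?_ ?_
        · rcases key _ hn' with h' | h' | h'
          · exact absurd h'.symm hb'.2.2.1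
          · exact absurd (P.fc.injective h') hne
          · exact h'
        · rcases key _ hp' with h' | h' | h'
          · exact absurd h'.symm hb'.2.2.2
          · exact h'
          · exact absurd (P.fc.symm.injective h') hne
      · have := L.le_sum (l := [b, b']) (by simpa using hbb) (by
          simp only [List.mem_cons, List.not_mem_nil, or_false]
          rintro y (rfl | rfl)
          exacts [hbl.1, hbl'.1])
        simp only [List.map_cons, List.map_nil, List.sum_cons, List.sum_nil] at this
        omega
    · have := e2 y hy hyh hy2
      have := L.le_sum (l := [b, y]) (by simpa using hby) (by
        simp only [List.mem_cons, List.not_mem_nil, or_false]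
        rintro z (rfl | rfl)
        exacts [hbl.1, hy])
      simp only [List.map_cons, List.map_nil, List.sum_cons, List.sum_nil] at this
      omega
  · push Not at hz
    obtain ⟨x, hx, hxh, -⟩ := exists_heavy (t := t) (r := r) [] (by simp [hN]; omega)
    obtain ⟨y, hy, hyh, hyx⟩ := exists_heavy (t := t) (r := r) [x] (by simp [hN]; omega)
    have ex := e2 x hx hxh (hz x hx).not_gt
    have ey := e2 y hy hyh (hz y hy).not_gt
    have := L.le_sum (l := [x, y]) (by simpa using (Ne.symm (by simpa using hyx))) (by
        simp only [List.mem_cons, List.not_mem_nil, or_false]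
        rintro z (rfl | rfl) <;> assumption)
    simp only [List.map_cons, List.map_nil, List.sum_cons, List.sum_nil] at this
    omega

end LargeRegion

end PlaneGraph

/-! ### Length five with two light edges. -/

namespace EdgeData

theorem check5_spec {q : Bool} (hq : check5 q = true) {a b c d e : EdgeData} (ha : a ∈ all)
    (hb : b ∈ all) (hc : c ∈ all) (hd : d ∈ all) (he : e ∈ all) (a3 : a.heavy 3 = false)
    (b3 : b.heavy 3 = q) (c3 : c.heavy 3 = !q) (d3 : d.heavy 3 = true) (e3 : e.heavy 3 = true)
    (fab : fits a b = true) (fbc : fits b c = true) (fcd : fits c d = true)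
    (fde : fits d e = true) (fea : fits e a = true) (ba : bad5 a b c d e = false)
    (bb : bad5 b c d e a = false) (bc : bad5 c d e a b = false) (bd : bad5 d e a b c = false)
    (be : bad5 e a b c d = false) :
    16 ≤ lo a + cost0 a b c + lo c ∨ 16 ≤ lo a + cost0 a b c + cost0 b c d + lo d ∨
      16 ≤ cost0 e a b + cost0 a b c + cost0 b c d + cost0 c d e + cost0 d e a ∨
      16 ≤ cost5 a b c d e + cost5 b c d e a + cost5 c d e a b + cost5 d e a b c +
        cost5 e a b c d := by
  simp only [check5, next5, mid5, List.all_eq_true, List.mem_filter, Bool.and_eq_true,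
    Bool.or_eq_true, leb_iff, beq_iff_eq] at hq
  have k := (hq a ha).resolve_left (by simp [a3]) b ⟨hb, b3, fab⟩ c ⟨hc, c3, fbc⟩
  rcases k with k | k
  · exact Or.inl k
  have bfar : badFar a c d = false := by
    rw [← Bool.not_eq_true]
    intro hbad
    rw [bad5, hbad] at ba
    exact absurd ba (by simp)
  rcases k d ⟨hd, d3, fcd⟩ with (k | k) | k
  · exact absurd k (by simp [bfar])
  · exact Or.inr (Or.inl k)
  rcases k e ⟨he, e3, fde, fea⟩ with (((((k | k) | k) | k) | k) | k) | k
  · exact Or.inr (Or.inr (Or.inl k))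
  · exact absurd k (by simp [ba])
  · exact absurd k (by simp [bb])
  · exact absurd k (by simp [bc])
  · exact absurd k (by simp [bd])
  · exact absurd k (by simp [be])
  · exact Or.inr (Or.inr (Or.inr k))

end EdgeData

namespace PlaneGraph

open EdgeData

variable {V : Type*} [Finite V] {P : PlaneGraph V} {m : Sym2 V → ℕ} {r : P.Region}
  {t : P.graph.Dart → EdgeData}

theorem Pent.far {d b : P.graph.Dart} (hd : Pent d) (hb : Far d b) :
    b = P.fc (P.fc d) ∨ b = P.fc (P.fc (P.fc d)) := by
  unfold Far at hb
  rw [hd.side_eq_iff, hd.inv] at hb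
  tauto

theorem Pent.offTail {d b : P.graph.Dart} (hd : Pent d) (hb : OffTail d b) :
    b = P.fc d ∨ b = P.fc (P.fc d) ∨ b = P.fc (P.fc (P.fc d)) := by
  unfold OffTail at hb
  rw [hd.side_eq_iff, hd.inv] at hb
  tauto

theorem Pent.offHead {d b : P.graph.Dart} (hd : Pent d) (hb : OffHead d b) :
    b = P.fc (P.fc d) ∨ b = P.fc (P.fc (P.fc d)) ∨ b = P.fc (P.fc (P.fc (P.fc d))) := by
  unfold OffHead at hb
  rw [hd.side_eq_iff] at hb
  tauto

namespace LargeRegion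

theorem badFar_eq_false (L : LargeRegion m r t) (h : IsPrimeTarget P m) {d : P.graph.Dart}
    (hd : P.side d = r) (hp : Pent d) :
    badFar (t d) (t (P.fc (P.fc d))) (t (P.fc (P.fc (P.fc d)))) = false := by
  rw [← Bool.not_eq_true]
  simp only [badFar, Bool.or_eq_true, Bool.and_eq_true, leb_iff]
  rintro (⟨⟨h1, h2⟩, h3⟩ | ⟨h1, h2 | ⟨h2, h3⟩⟩)
  · obtain ⟨b, hb, hl⟩ := L.conf15 h hd h1
    rcases hp.far hb with rfl | rfl
    · exact absurd (h2.symm.trans hl.2) (by decide)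
    · exact absurd (h3.symm.trans hl.2) (by decide)
  · obtain ⟨⟨h2, h3⟩, h4⟩ := h2
    rcases L.conf17 h hd h1 with ⟨b, hb, hl⟩ | ⟨b, b', ⟨hb, hl⟩, ⟨hb', hl'⟩, hne⟩
    · rcases hp.far hb with rfl | rfl <;> omega
    · have l1 := hl.2
      have l2 := hl'.2
      rcases hp.far hb with rfl | rfl <;> rcases hp.far hb' with rfl | rfl <;> simp_all
  · rw [(L.sees d hd).pm_eq] at h1
    rcases PlaneGraph.conf19 h (L.not_tri d hd) (L.not_quad d hd) h1 with ⟨b, hb, hl⟩ |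
      ⟨x, y, z, ⟨hx, -⟩, ⟨hy, -⟩, ⟨hz, -⟩, n1, n2, n3⟩
    · have := L.not_hv (hb.side hd) hl
      rcases hp.far hb with rfl | rfl
      · exact absurd (h2.symm.trans this) (by decide)
      · exact absurd (h3.symm.trans this) (by decide)
    · rcases hp.far hx with rfl | rfl <;> rcases hp.far hy with rfl | rfl <;>
      rcases hp.far hz with rfl | rfl <;> simp_all

theorem badPath5_eq_false (L : LargeRegion m r t) (h : IsPrimeTarget P m) {d : P.graph.Dart}
    (hd : P.side d = r) (hp : Pent d) :
    badPath5 (t d) (t (P.fc d)) (t (P.fc (P.fc d))) (t (P.fc (P.fc (P.fc d))))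
      (t (P.fc (P.fc (P.fc (P.fc d))))) = false := by
  have s1 : P.side (P.fc d) = r := by simpa using hd
  have s2 : P.side (P.fc (P.fc d)) = r := by simpa using hd
  have s3 : P.side (P.fc (P.fc (P.fc d))) = r := by simpa using hd
  have s4 : P.side (P.fc (P.fc (P.fc (P.fc d)))) = r := by simpa using hd
  rw [← Bool.not_eq_true]
  simp only [badPath5, Bool.or_eq_true, Bool.and_eq_true, leb_iff, (L.sees _ hd).hm,
    (L.sees _ s1).hm, (L.sees _ s2).hm, (L.sees _ s3).hm, (L.sees _ s4).hm, (L.sees _ hd).pm_eq,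
    (L.sees _ s2).pm_eq, (L.sees _ s3).pm_eq]
  rintro ⟨⟨h1, h2⟩, h3⟩
  have := conf13 h hp h1 h2
  omega

theorem badTri5_eq_false (L : LargeRegion m r t) (h : IsPrimeTarget P m) {d : P.graph.Dart}
    (hd : P.side d = r) (hp : Pent d) (hk : (t d).k = 2) :
    badTri5 (t d) (t (P.fc d)) (t (P.fc (P.fc d))) (t (P.fc (P.fc (P.fc d))))
      (t (P.fc (P.fc (P.fc (P.fc d))))) = false := by
  have ta := L.attTail h hd
  have th := L.attHead h hd
  rw [hp.inv] at ta
  simp only [EdgeData.attTail, EdgeData.attHead, eqb_iff.2 hk, Bool.true_and, Bool.and_eq_true,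
    leb_iff] at ta th
  rw [← Bool.not_eq_true]
  simp only [badTri5, Bool.or_eq_true, Bool.and_eq_true, leb_iff]
  have cnt_of : ∀ {x : P.graph.Dart}, Light r t x → cnt ((t x).heavy 3) = 0 := fun hx => by
    rw [hx.2]; rfl
  have cnt_le : ∀ x, cnt ((t x).heavy 3) ≤ 1 := fun x => by
    cases (t x).heavy 3 <;> simp [cnt]
  have c1 := cnt_le (P.fc d)
  have c2 := cnt_le (P.fc (P.fc d))
  have c3 := cnt_le (P.fc (P.fc (P.fc d)))
  have c4 := cnt_le (P.fc (P.fc (P.fc (P.fc d))))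
  rintro ((⟨⟨h1, h2⟩, h3⟩ | ⟨⟨h1, h2⟩, h3⟩) | h1)
  · rcases h3 with ⟨⟨⟨h3, h4⟩, h5⟩, h6⟩ | ⟨⟨⟨⟨h3, h4⟩, h5⟩, h6⟩, h7⟩
    · obtain ⟨b, hb, hl⟩ := ta.1 ⟨⟨h1, h2⟩, h3⟩
      have := hl.2
      rcases hp.offTail hb with rfl | rfl | rfl <;> simp_all
    · rcases ta.2 ⟨⟨h1, h2⟩, h3⟩ with ⟨b, hb, hl⟩ | ⟨b, b', ⟨hb, hl⟩, ⟨hb', hl'⟩, hne⟩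
      · rcases hp.offTail hb with rfl | rfl | rfl <;> omega
      · have l1 := cnt_of hl
        have l2 := cnt_of hl'
        rcases hp.offTail hb with rfl | rfl | rfl <;>
        rcases hp.offTail hb' with rfl | rfl | rfl <;>
        first
          | exact hne rfl
          | omega
  · rcases h3 with ⟨⟨⟨h3, h4⟩, h5⟩, h6⟩ | ⟨⟨⟨⟨h3, h4⟩, h5⟩, h6⟩, h7⟩
    · obtain ⟨b, hb, hl⟩ := th.1 ⟨⟨h1, h2⟩, h3⟩
      have := hl.2
      rcases hp.offHead hb with rfl | rfl | rfl <;> simp_all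
    · rcases th.2 ⟨⟨h1, h2⟩, h3⟩ with ⟨b, hb, hl⟩ | ⟨b, b', ⟨hb, hl⟩, ⟨hb', hl'⟩, hne⟩
      · rcases hp.offHead hb with rfl | rfl | rfl <;> omega
      · have l1 := cnt_of hl
        have l2 := cnt_of hl'
        rcases hp.offHead hb with rfl | rfl | rfl <;>
        rcases hp.offHead hb' with rfl | rfl | rfl <;>
        first
          | exact hne rfl
          | omega
  · obtain ⟨⟨h1, h2⟩, h3⟩ := h1
    obtain ⟨b, hb, hdoor⟩ := (L.sees d hd).exists_door_of_isH h h1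
    have := (L.sees b (hb.side hd)).isDoor h (side_door hb hdoor)
    rcases hp.far hb with rfl | rfl <;> simp_all

theorem bad5_eq_false (L : LargeRegion m r t) (h : IsPrimeTarget P m) {d : P.graph.Dart}
    (hd : P.side d = r) (hp : Pent d) :
    bad5 (t d) (t (P.fc d)) (t (P.fc (P.fc d))) (t (P.fc (P.fc (P.fc d))))
      (t (P.fc (P.fc (P.fc (P.fc d))))) = false := by
  rw [bad5, L.badFar_eq_false h hd hp, L.badPath5_eq_false h hd hp, Bool.or_self, Bool.false_or,
    Bool.and_eq_false_iff]
  by_cases hk : (t d).k = 2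
  · exact Or.inr (L.badTri5_eq_false h hd hp hk)
  · exact Or.inl (eqb_false.2 hk)

open Classical in
-- As for squares the flags are read off the records, now with two edges disjoint from `d`.
theorem cost5_le (L : LargeRegion m r t) (h : IsPrimeTarget P m) {d : P.graph.Dart}
    (hd : P.side d = r) (hp : Pent d) :
    (cost5 (t d) (t (P.fc d)) (t (P.fc (P.fc d))) (t (P.fc (P.fc (P.fc d))))
      (t (P.fc (P.fc (P.fc (P.fc d))))) : ℤ) ≤ toll m d := by
  have s1 : P.side (P.fc d) = r := by simpa using hd
  have s2 : P.side (P.fc (P.fc d)) = r := by simpa using hd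
  have s3 : P.side (P.fc (P.fc (P.fc d))) = r := by simpa using hd
  have s4 : P.side (P.fc (P.fc (P.fc (P.fc d)))) = r := by simpa using hd
  rw [cost5, ← hp.inv]
  refine L.cost_le h hd (fun _ hdoor => ?_) (fun hel => ?_)
  · obtain ⟨x, hx, hx'⟩ := exists_far_of_door_across h hdoor
    have := (L.sees x (hx.side hd)).hm.trans hx'
    rw [Bool.or_eq_true, eqb_iff, eqb_iff]
    rcases hp.far hx with rfl | rfl
    exacts [Or.inl this, Or.inr this]
  · rw [Bool.or_eq_true, Bool.or_eq_true, leb_iff]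
    rcases hel.cases with h2 | ⟨x, hx, hx'⟩
    · right
      have key := doors_le_sum (m := m) (r := P.side d) (f := fun x =>
        if P.Door m (P.side d) x.edge then 1 else 0) (fun x _ => by
          constructor
          · intro hx; rw [if_pos hx]
          · split_ifs <;> norm_num)
      rw [hp.sum h] at key
      have cn : ∀ x : P.graph.Dart, P.side x = r →
          (if P.Door m (P.side d) x.edge then 1 else 0 : ℤ) ≤ cnt (t x).isDoor := by
        intro x hx
        split_ifs with hdoor
        · rw [(L.sees x hx).isDoor h (by rwa [hx, ← hd])]
          norm_num [cnt]
        · positivity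
      have c1 := cn _ hd
      have c2 := cn _ s1
      have c3 := cn _ s2
      have c4 := cn _ s3
      have c5 := cn _ s4
      rw [hp.inv]
      omega
    · left
      have := (L.sees x (hx.side hd)).isDoor h (side_door hx hx')
      rcases hp.far hx with rfl | rfl
      exacts [Or.inl this, Or.inr this]

theorem sum_of_pent (L : LargeRegion m r t) (h : IsPrimeTarget P m) {d : P.graph.Dart}
    (hd : P.side d = r) (hp : Pent d) {q : Bool} (hq : check5 q = true)
    (a3 : (t d).heavy 3 = false) (b3 : (t (P.fc d)).heavy 3 = q)
    (c3 : (t (P.fc (P.fc d))).heavy 3 = !q) (d3 : (t (P.fc (P.fc (P.fc d)))).heavy 3 = true)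
    (e3 : (t (P.fc (P.fc (P.fc (P.fc d))))).heavy 3 = true) :
    16 ≤ ∑ d ∈ faceDarts r, toll m d := by
  have s1 : P.side (P.fc d) = r := by simpa using hd
  have s2 : P.side (P.fc (P.fc d)) = r := by simpa using hd
  have s3 : P.side (P.fc (P.fc (P.fc d))) = r := by simpa using hd
  have s4 : P.side (P.fc (P.fc (P.fc (P.fc d)))) = r := by simpa using hd
  have h5 : P.fc (P.fc (P.fc (P.fc (P.fc d)))) = d := hp
  have i1 := L.fits h s4
  have b1 := L.bad5_eq_false h s1 hp.fc
  have b2 := L.bad5_eq_false h s2 hp.fc.fc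
  have b3' := L.bad5_eq_false h s3 hp.fc.fc.fc
  have b4 := L.bad5_eq_false h s4 hp.fc.fc.fc.fc
  rw [h5] at i1 b1 b2 b3' b4
  have key := check5_spec hq (L.sees _ hd).mem (L.sees _ s1).mem (L.sees _ s2).mem
    (L.sees _ s3).mem (L.sees _ s4).mem a3 b3 c3 d3 e3 (L.fits h hd) (L.fits h s1) (L.fits h s2)
    (L.fits h s3) i1 (L.bad5_eq_false h hd hp) b1 b2 b3' b4
  have l0 := L.lo_le hd
  have l1 := L.lo_le s1
  have l2 := L.lo_le s2
  have l3 := L.lo_le s3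
  have l4 := L.lo_le s4
  have cs : ∀ x, P.side x = r →
      (cost0 (t (P.fc.symm x)) (t x) (t (P.fc x)) : ℤ) ≤ toll m x := fun x hx =>
    L.cost_le h hx (fun _ _ => rfl) fun _ => rfl
  have k0 := cs _ hd
  have k1 := cs _ s1
  have k2 := cs _ s2
  have k3 := cs _ s3
  have k4 := cs _ s4
  rw [hp.inv] at k0
  rw [Equiv.symm_apply_apply] at k1 k2 k3 k4
  have f0 := L.cost5_le h hd hp
  have f1 := L.cost5_le h s1 hp.fc
  have f2 := L.cost5_le h s2 hp.fc.fc
  have f3 := L.cost5_le h s3 hp.fc.fc.fc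
  have f4 := L.cost5_le h s4 hp.fc.fc.fc.fc
  rw [h5] at k4 f1 f2 f3 f4
  rw [← hd, hp.sum h]
  omega

/-- Up to rotation the light edges are consecutive (`check5_false`) or at distance two
(`check5_true`). When `g` is three or four steps after `f`, the boundary is read from `g` instead.
-/
theorem sum_of_two_of_pent (L : LargeRegion m r t) (h : IsPrimeTarget P m) {f g : P.graph.Dart}
    (hfg : f ≠ g) (hl : ∀ d, Light r t d ↔ d = f ∨ d = g) (hp : Pent f) :
    16 ≤ ∑ d ∈ faceDarts r, toll m d := by
  have hf := (hl f).2 (Or.inl rfl)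
  have hg := (hl g).2 (Or.inr rfl)
  have h5 : P.fc (P.fc (P.fc (P.fc (P.fc f)))) = f := hp
  have n := L.nodup h.threeConnected hf.1
  simp only [List.nodup_cons, List.mem_cons, List.not_mem_nil, or_false, not_or,
    not_false_eq_true, List.nodup_nil, and_true] at n
  obtain ⟨⟨n01, n02, n03, n04⟩, ⟨n12, n13, n14⟩, ⟨n23, n24⟩, n34⟩ := n
  have heavy : ∀ x, P.side x = r → ¬ x = f → ¬ x = g → (t x).heavy 3 = true := fun x hx h1 h2 =>
    heavy_of_not_light hx fun k => ((hl x).1 k).elim h1 h2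
  have s1 : P.side (P.fc f) = r := by simpa using hf.1
  have s2 : P.side (P.fc (P.fc f)) = r := by simpa using hf.1
  have s3 : P.side (P.fc (P.fc (P.fc f))) = r := by simpa using hf.1
  have s4 : P.side (P.fc (P.fc (P.fc (P.fc f)))) = r := by simpa using hf.1
  rcases hp.side_eq_iff.1 (hg.1.trans hf.1.symm) with rfl | rfl | rfl | rfl | rfl
  · exact absurd rfl hfg
  · exact L.sum_of_pent h hf.1 hp check5_false hf.2 hg.2 (heavy _ s2 (Ne.symm n02) (Ne.symm n12))
      (heavy _ s3 (Ne.symm n03) (Ne.symm n13)) (heavy _ s4 (Ne.symm n04) (Ne.symm n14))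
  · exact L.sum_of_pent h hf.1 hp check5_true hf.2 (heavy _ s1 (Ne.symm n01) n12) hg.2
      (heavy _ s3 (Ne.symm n03) (Ne.symm n23)) (heavy _ s4 (Ne.symm n04) (Ne.symm n24))
  · refine L.sum_of_pent h hg.1 hp.fc.fc.fc check5_true hg.2 ?_ ?_ ?_ ?_ <;> (try rw [h5])
    · exact heavy _ s4 (Ne.symm n04) (Ne.symm n34)
    · exact hf.2
    · exact heavy _ s1 (Ne.symm n01) n13
    · exact heavy _ s2 (Ne.symm n02) n23
  · refine L.sum_of_pent h hg.1 hp.fc.fc.fc.fc check5_false hg.2 ?_ ?_ ?_ ?_ <;> rw [h5]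
    · exact hf.2
    · exact heavy _ s1 (Ne.symm n01) n14
    · exact heavy _ s2 (Ne.symm n02) n24
    · exact heavy _ s3 (Ne.symm n03) n34

end LargeRegion

end PlaneGraph

/-! ### Two light edges in longer regions, and the conclusion. -/

namespace PlaneGraph

open EdgeData

theorem eq_of_mem_pair {α : Type*} {a b p q u : α} (hp : p = a ∨ p = b) (hq : q = a ∨ q = b)
    (hu : u = a ∨ u = b) (hpq : p ≠ q) (hup : u ≠ p) : u = q := by
  rcases hp with rfl | rfl <;> rcases hq with rfl | rfl <;> rcases hu with rfl | rfl <;>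
  first
    | rfl
    | exact absurd rfl hpq
    | exact absurd rfl hup

variable {V : Type*} [Finite V] {P : PlaneGraph V} {m : Sym2 V → ℕ} {r : P.Region}
  {t : P.graph.Dart → EdgeData}

theorem six_le_card (h : IsPrimeTarget P m) (L : LargeRegion m r t) {c : P.graph.Dart}
    (hc : P.side c = r) (hp : ¬ Pent c) : 6 ≤ (faceDarts r).card := by
  classical
  have h1 : [c, P.fc c, P.fc (P.fc c), P.fc (P.fc (P.fc c)), P.fc (P.fc (P.fc (P.fc c))),
      P.fc (P.fc (P.fc (P.fc (P.fc c))))].Nodup := by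
    have n1 := L.nodup h.threeConnected (c := P.fc c) (by simpa using hc)
    have n2 := L.nodup h.threeConnected hc
    rw [List.nodup_cons] at n2 ⊢
    refine ⟨?_, n1⟩
    have := n2.1
    simp only [List.mem_cons, List.not_mem_nil, or_false, not_or] at this ⊢
    exact ⟨this.1, this.2.1, this.2.2.1, this.2.2.2, fun k => hp k.symm⟩
  rw [show 6 = ([c, P.fc c, P.fc (P.fc c), P.fc (P.fc (P.fc c)), P.fc (P.fc (P.fc (P.fc c))),
    P.fc (P.fc (P.fc (P.fc (P.fc c))))] : List _).length from rfl,
    ← List.toFinset_card_of_nodup h1]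
  apply Finset.card_le_card
  intro x hx
  simp only [List.mem_toFinset, List.mem_cons, List.not_mem_nil, or_false] at hx
  rw [mem_faceDarts]
  rcases hx with rfl | rfl | rfl | rfl | rfl | rfl <;> simpa using hc

namespace LargeRegion

/-- The edge next to an edge with `m⁺` equal to five. -/
theorem pm_of_not_far (L : LargeRegion m r t) (h : IsPrimeTarget P m) {f g x : P.graph.Dart}
    (hl : ∀ d, Light r t d ↔ d = f ∨ d = g) (hx : P.side x = r) (h0 : lo (t x) < 2)
    (hf : ¬ Far x f) : (t g).pm < 2 := by
  have h5 := ((single_spec (L.sees x hx).mem).2.2.2.1 h0).1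
  have key : ∀ b, Far x b → Light r t b → b = g := fun b hb hb' =>
    ((hl b).1 hb').resolve_left fun k => hf (k ▸ hb)
  rcases L.conf17 h hx h5 with ⟨b, hb, hb'⟩ | ⟨b, b', ⟨hb, hb'⟩, ⟨hb'', hb'''⟩, hne⟩
  · rwa [← key b hb (L.light_of_pm (hb.side hx) hb')]
  · exact absurd ((key _ hb hb').trans (key _ hb'' hb''').symm) hne

/-- The edge `f` is not next to an edge with `m⁺` equal to five, but `g` is. -/
theorem sum_of_two_of_far (L : LargeRegion m r t) (h : IsPrimeTarget P m) {f g y₁ y₂ : P.graph.Dart}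
    (hfg : f ≠ g) (hl : ∀ d, Light r t d ↔ d = f ∨ d = g) (hp : ¬ Pent f)
    (hN : (lights r t).card = 2) (s₁ : P.side y₁ = r) (s₂ : P.side y₂ = r)
    (k₁ : (t y₁).heavy 3 = true) (k₂ : (t y₂).heavy 3 = true) (l₁ : 2 ≤ lo (t y₁))
    (l₂ : 2 ≤ lo (t y₂)) (hne : y₁ ≠ y₂)
    (hz : ∀ y, P.side y = r → (t y).heavy 3 = true → 2 ≤ lo (t y) → y = y₁ ∨ y = y₂)
    (hf : ∀ x, P.side x = r → lo (t x) < 2 → Far x f) (hg : (t f).pm < 2) :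
    16 ≤ ∑ d ∈ faceDarts r, toll m d := by
  have hfl := (hl f).2 (Or.inl rfl)
  have hgl := (hl g).2 (Or.inr rfl)
  have sf := hfl.1
  have sg := hgl.1
  have ne_of : ∀ {y x}, (t y).heavy 3 = true → Light r t x → y ≠ x := fun hy hx k => by
    subst k
    exact absurd (hy.symm.trans hx.2) (by decide)
  have e₁ : 2 ≤ excess m t y₁ := by
    have := L.lo_le s₁
    rw [excess_heavy k₁]
    omega
  have e₂ : 2 ≤ excess m t y₂ := by
    have := L.lo_le s₂
    rw [excess_heavy k₂]
    omega
  obtain ⟨hf6, -, hf1, -⟩ := (single_spec (L.sees f sf).mem).2.2.1 hg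
  have ef : 2 ≤ excess m t f := by
    have := L.lo_le sf
    rw [excess_light hfl]
    omega
  -- An excess of eight is needed; `y₁`, `y₂` and `f` already give two each.
  by_cases hdoor : P.Door m (P.side f.symm) f.edge
  · obtain ⟨y, hy, hy1⟩ := exists_far_of_door_across h hdoor
    have sy := hy.side sf
    by_cases hyl : Light r t y
    · have hyg : y = g := ((hl y).1 hyl).resolve_left hy.2.1
      subst hyg
      have sn : P.side (P.fc f) = r := by simpa using sf
      have sp : P.side (P.fc.symm f) = r := by simpa using sf
      have cn : 2 ≤ lo (t (P.fc f)) := by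
        by_contra! k
        exact (hf _ sn k).2.2.2 (by simp)
      have cp : 2 ≤ lo (t (P.fc.symm f)) := by
        by_contra! k
        exact (hf _ sp k).2.2.1 (by simp)
      have nn : ¬ Light r t (P.fc f) := fun k =>
        ((hl _).1 k).elim (P.fc_ne f) fun k' => hy.2.2.1 k'.symm
      have np : ¬ Light r t (P.fc.symm f) := fun k =>
        ((hl _).1 k).elim (fun k' => P.fc_ne f ((Equiv.symm_apply_eq _).1 k').symm)
          fun k' => hy.2.2.2 k'.symm
      have qn := hz _ sn (heavy_of_not_light sn nn) cn
      have qp := hz _ sp (heavy_of_not_light sp np) cp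
      have qne := fc_ne_fc_inv h f
      have all4 : ∀ x, P.side x = r → 2 ≤ lo (t x) →
          x = f ∨ x = y ∨ x = P.fc f ∨ x = P.fc.symm f := by
        intro x hx h2
        by_cases hxl : Light r t x
        · rcases (hl x).1 hxl with k | k
          exacts [Or.inl k, Or.inr (Or.inl k)]
        · have q := hz x hx (heavy_of_not_light hx hxl) h2
          right; right
          rcases q with rfl | rfl <;> rcases qn with qn | qn <;> rcases qp with qp | qp <;>
          first
            | exact Or.inl qn.symm
            | exact Or.inr qp.symm
            | exact absurd (qn.trans qp.symm) qne
      have T : ∀ x, P.side x = r → P.fc (P.fc (P.fc x)) ≠ x := L.not_tri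
      have Q : ∀ x, P.side x = r → P.fc (P.fc (P.fc (P.fc x))) ≠ x := L.not_quad
      have F : P.fc (P.fc (P.fc (P.fc (P.fc f)))) ≠ f := hp
      have B := P.fc_fc_ne h.threeConnected
      have A := P.fc_ne
      have inv : ∀ {x}, x = P.fc.symm f → P.fc x = f := fun k => by
        rw [k, Equiv.apply_symm_apply]
      have y1 : y ≠ P.fc f := hy.2.2.1
      have y2 : P.fc y ≠ f := fun k => hy.2.2.2 (by rw [← k, Equiv.symm_apply_apply])
      have s2 : P.side (P.fc (P.fc f)) = r := by simpa using sf
      have s3 : P.side (P.fc (P.fc (P.fc f))) = r := by simpa using sf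
      have s4 : P.side (P.fc (P.fc (P.fc (P.fc f)))) = r := by simpa using sf
      have syn : P.side (P.fc y) = r := by simpa using sy
      have syp : P.side (P.fc.symm y) = r := by simpa using sy
      -- Of any two consecutive edges one is not cheap, hence among the four edges of `all4`. If a
      -- neighbour of `y` were one of these, the boundary would have length at most five, or `y`
      -- would equal or adjoin `f`.
      have zn : lo (t (P.fc y)) < 2 := by
        by_contra! k
        rcases all4 _ syn k with k | k | k | k
        · exact y2 k
        · exact A _ k
        · exact hy.2.1 (P.fc.injective k)
        have k := inv k
        have z2 : lo (t (P.fc (P.fc f))) < 2 := by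
          by_contra! k'
          rcases all4 _ s2 k' with k' | k' | k' | k'
          · exact B _ k'
          · rw [← k'] at k
            exact Q _ sf k
          · exact A _ k'
          · exact T _ sf (inv k')
        have z3 := L.two_le_lo_next h s2 z2
        rcases all4 _ s3 z3 with k' | k' | k' | k'
        · exact T _ sf k'
        · rw [← k'] at k
          exact F k
        · exact B _ k'
        · exact Q _ sf (inv k')
      have zp : lo (t (P.fc.symm y)) < 2 := by
        by_contra! k
        have hyy : y = P.fc (P.fc f) := by
          rcases all4 _ syp k with k | k | k | k <;> rw [Equiv.symm_apply_eq] at k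
          · exact absurd k y1
          · exact absurd k.symm (A _)
          · exact k
          · rw [Equiv.apply_symm_apply] at k
            exact absurd k hy.2.1
        have z3 : lo (t (P.fc (P.fc (P.fc f)))) < 2 := by
          rwa [← hyy]
        have z4 := L.two_le_lo_next h s3 z3
        rcases all4 _ s4 z4 with k' | k' | k' | k'
        · exact Q _ sf k'
        · rw [hyy] at k'
          exact B _ k'
        · exact T _ sn k'
        · exact F (inv k')
      -- Between two edges with `m⁺` at least five, a light edge of multiplicity one takes six. So
      -- `y` supplies the missing excess of two.
      have key := L.triples h lightCost_true sy
      simp only [lightCost, Bool.and_eq_true, Bool.or_eq_true, leb_iff, Bool.not_eq_true',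
        ← Bool.not_eq_true] at key
      have p1 := ((single_spec (L.sees _ syp).mem).2.2.2.1 zp).1
      have p2 := ((single_spec (L.sees _ syn).mem).2.2.2.1 zn).1
      have hm1 := (L.sees _ sy).hm.trans hy1
      have c6 := key.1.resolve_left fun k => k ⟨⟨⟨p1, p2⟩, by simp [hyl.2]⟩, hm1.le⟩
      have hc : (cost0 (t (P.fc.symm y)) (t y) (t (P.fc y)) : ℤ) ≤ toll m y :=
        L.cost_le h sy (fun _ _ => rfl) fun _ => rfl
      have ey := excess_light (m := m) hyl
      have := L.le_sum (l := [f, y, y₁, y₂]) (by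
        simp [hfg, hne, (ne_of k₁ hfl).symm, (ne_of k₂ hfl).symm, (ne_of k₁ hgl).symm,
          (ne_of k₂ hgl).symm]) (by
        simp only [List.mem_cons, List.not_mem_nil, or_false]
        rintro x (rfl | rfl | rfl | rfl) <;> assumption)
      simp only [List.map_cons, List.map_nil, List.sum_cons, List.sum_nil] at this
      omega
    -- A heavy edge of multiplicity one takes four and must be `y₁` or `y₂`, which gives 2 + 4 + 2.
    · have hyh := heavy_of_not_light sy hyl
      have h4 := (single_spec (L.sees _ sy).mem).2.2.2.2.1 hyh ((L.sees _ sy).hm.trans hy1)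
      have ey : 4 ≤ excess m t y := by
        have := L.lo_le sy
        rw [excess_heavy hyh]
        omega
      have := L.le_sum (l := [f, y₁, y₂]) (by
        simp [hne, (ne_of k₁ hfl).symm, (ne_of k₂ hfl).symm]) (by
        simp only [List.mem_cons, List.not_mem_nil, or_false]
        rintro x (rfl | rfl | rfl) <;> assumption)
      simp only [List.map_cons, List.map_nil, List.sum_cons, List.sum_nil] at this
      rcases hz y sy hyh (by omega) with rfl | rfl <;> omega
  -- As `f` is no door for the region across, the larger shares raise its toll to eight, which gives
  -- 4 + 2 + 2.
  · have key := L.triples h lightCost_true sf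
    simp only [lightCost, Bool.and_eq_true, Bool.or_eq_true, leb_iff, Bool.not_eq_true',
      ← Bool.not_eq_true] at key
    have c8 := key.2.resolve_left fun k => k (by omega)
    have hc := L.cost_le h sf (door := false) (elig := true) (fun _ k => absurd k hdoor) fun _ => rfl
    have ef := excess_light (m := m) hfl
    have := L.le_sum (l := [f, y₁, y₂]) (by
      simp [hne, (ne_of k₁ hfl).symm, (ne_of k₂ hfl).symm]) (by
      simp only [List.mem_cons, List.not_mem_nil, or_false]
      rintro x (rfl | rfl | rfl) <;> assumption)
    simp only [List.map_cons, List.map_nil, List.sum_cons, List.sum_nil] at this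
    omega

/-- Outside length five an excess of eight is missing, and at least four edges are heavy. If no edge
is cheap they suffice. Otherwise `conf19` provides a light edge of excess two, so at most two heavy
edges are not cheap when the sum is too small. Neighbours of cheap edges are not cheap, hence are
light or among these two, and this leaves few arrangements. -/
theorem sum_of_two (L : LargeRegion m r t) (h : IsPrimeTarget P m) {f g : P.graph.Dart}
    (hfg : f ≠ g) (hl : ∀ d, Light r t d ↔ d = f ∨ d = g) :
    16 ≤ ∑ d ∈ faceDarts r, toll m d := by
  classical
  by_cases hp : Pent f
  · exact L.sum_of_two_of_pent h hfg hl hp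
  have hfl := (hl f).2 (Or.inl rfl)
  have hgl := (hl g).2 (Or.inr rfl)
  have hpg : ¬ Pent g := by
    intro k
    rcases k.side_eq_iff.1 (hfl.1.trans hgl.1.symm) with rfl | rfl | rfl | rfl | rfl
    exacts [hp k, hp k.fc, hp k.fc.fc, hp k.fc.fc.fc, hp k.fc.fc.fc.fc]
  have h6 := six_le_card h L hfl.1 hp
  have hN : (lights r t).card = 2 := by
    rw [Finset.card_eq_two]
    refine ⟨f, g, hfg, ?_⟩
    ext d
    rw [mem_lights, hl, Finset.mem_insert, Finset.mem_singleton]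
  have hlg : ∀ d, Light r t d ↔ d = g ∨ d = f := fun d => (hl d).trans or_comm
  by_contra! hsum
  have ne_of : ∀ {y x}, (t y).heavy 3 = true → Light r t x → y ≠ x := fun hy hx k => by
    subst k
    exact absurd (hy.symm.trans hx.2) (by decide)
  have e2 : ∀ y, P.side y = r → (t y).heavy 3 = true → 2 ≤ lo (t y) → 2 ≤ excess m t y := by
    intro y hy hh h2
    have := L.lo_le hy
    rw [excess_heavy hh]
    omega
  have el : ∀ y, Light r t y → 6 ≤ lo (t y) → 2 ≤ excess m t y := by
    intro y hy h2
    have := L.lo_le hy.1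
    rw [excess_light hy]
    omega
  by_cases hz : ∃ x, P.side x = r ∧ lo (t x) < 2
  swap
  · push Not at hz
    obtain ⟨a, sa, ka, -⟩ := exists_heavy (t := t) (r := r) [] (by simp [hN]; omega)
    obtain ⟨b, sb, kb, nb⟩ := exists_heavy (t := t) (r := r) [a] (by simp [hN]; omega)
    obtain ⟨c, sc, kc, nc⟩ := exists_heavy (t := t) (r := r) [a, b] (by simp [hN]; omega)
    obtain ⟨d, sd, kd, nd⟩ := exists_heavy (t := t) (r := r) [a, b, c] (by simp [hN]; omega)
    simp only [List.mem_cons, List.not_mem_nil, or_false, not_or] at nb nc nd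
    have := L.le_sum (l := [d, c, b, a]) (by
      simp [nb, nc, nd]) (by
      simp only [List.mem_cons, List.not_mem_nil, or_false]
      rintro x (rfl | rfl | rfl | rfl) <;> assumption)
    simp only [List.map_cons, List.map_nil, List.sum_cons, List.sum_nil] at this
    have := e2 a sa ka (hz a sa)
    have := e2 b sb kb (hz b sb)
    have := e2 c sc kc (hz c sc)
    have := e2 d sd kd (hz d sd)
    omega
  obtain ⟨x₀, sx, h0⟩ := hz
  have h5 := ((single_spec (L.sees x₀ sx).mem).2.2.2.1 h0).1
  obtain ⟨b, hbl, hb6⟩ : ∃ b, Light r t b ∧ 6 ≤ lo (t b) := by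
    rcases L.conf19 h sx h5 with ⟨b, -, hb, h6⟩ | ⟨a, b, c, ha, hb, hc, hab, hac, hbc⟩
    · exact ⟨b, hb, h6⟩
    · exfalso
      exact hbc (eq_of_mem_pair ((hl a).1 ha.2) ((hl b).1 hb.2) ((hl c).1 hc.2) hab hac.symm).symm
  have eb := el b hbl hb6
  -- at most two `3`-heavy edges take anything
  have hthree : ∀ a c d, P.side a = r → P.side c = r → P.side d = r → (t a).heavy 3 = true →
      (t c).heavy 3 = true → (t d).heavy 3 = true → 2 ≤ lo (t a) → 2 ≤ lo (t c) →
      2 ≤ lo (t d) → a ≠ c → a ≠ d → c = d := by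
    intro a c d sa sc sd ka kc kd la lc ld hac had
    by_contra hcd
    have := L.le_sum (l := [b, a, c, d]) (by
      simp [hac, had, hcd, (ne_of ka hbl).symm, (ne_of kc hbl).symm, (ne_of kd hbl).symm]) (by
      simp only [List.mem_cons, List.not_mem_nil, or_false]
      rintro x (rfl | rfl | rfl | rfl)
      exacts [hbl.1, sa, sc, sd])
    simp only [List.map_cons, List.map_nil, List.sum_cons, List.sum_nil] at this
    have := e2 a sa ka la
    have := e2 c sc kc lc
    have := e2 d sd kd ld
    omega
  have nbr : ∀ x, P.side x = r → lo (t x) < 2 → ∀ y, y = P.fc x ∨ y = P.fc.symm x →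
      P.side y = r ∧ 2 ≤ lo (t y) := by
    rintro x hx hx0 y (rfl | rfl)
    · exact ⟨by simpa using hx, L.two_le_lo_next h hx hx0⟩
    · exact ⟨by simpa using hx, L.two_le_lo_prev h hx hx0⟩
  by_cases htwo : ∃ y₁ y₂, P.side y₁ = r ∧ P.side y₂ = r ∧ (t y₁).heavy 3 = true ∧
      (t y₂).heavy 3 = true ∧ 2 ≤ lo (t y₁) ∧ 2 ≤ lo (t y₂) ∧ y₁ ≠ y₂
  · obtain ⟨y₁, y₂, s₁, s₂, k₁, k₂, l₁, l₂, hne⟩ := htwo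
    have only : ∀ y, P.side y = r → (t y).heavy 3 = true → 2 ≤ lo (t y) → y = y₁ ∨ y = y₂ := by
      intro y sy ky ly
      by_contra! hno
      exact hne (hthree y y₁ y₂ sy s₁ s₂ ky k₁ k₂ ly l₁ l₂ hno.1 hno.2)
    by_cases hf : ∀ x, P.side x = r → lo (t x) < 2 → Far x f
    · by_cases hg : ∀ x, P.side x = r → lo (t x) < 2 → Far x g
      -- Two cheap edges away from both light ones would have `y₁` and `y₂` as neighbours in
      -- opposite order, which makes the region a square.
      · obtain ⟨x₁, sx₁, kx₁, nx₁⟩ := exists_heavy (t := t) (r := r) [y₁, y₂, x₀]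
          (by simp [hN]; omega)
        simp only [List.mem_cons, List.not_mem_nil, or_false, not_or] at nx₁
        have z₁ : lo (t x₁) < 2 := by
          by_contra! k
          exact (only x₁ sx₁ kx₁ k).elim nx₁.1 nx₁.2.1
        have nb : ∀ x, P.side x = r → lo (t x) < 2 → ∀ y, y = P.fc x ∨ y = P.fc.symm x →
            y = y₁ ∨ y = y₂ := by
          intro x hx hx0 y hy
          obtain ⟨sy, ly⟩ := nbr x hx hx0 y hy
          refine only y sy (heavy_of_not_light sy fun k => ?_) ly
          rcases (hl y).1 k with rfl | rfl
          · exact hy.elim (hf x hx hx0).2.2.1 (hf x hx hx0).2.2.2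
          · exact hy.elim (hg x hx hx0).2.2.1 (hg x hx hx0).2.2.2
        have a1 := nb x₀ sx h0 _ (Or.inl rfl)
        have a2 := nb x₀ sx h0 _ (Or.inr rfl)
        have a3 := nb x₁ sx₁ z₁ _ (Or.inl rfl)
        have a4 := nb x₁ sx₁ z₁ _ (Or.inr rfl)
        have d1 := fc_ne_fc_inv h x₀
        have d2 : P.fc x₁ ≠ P.fc x₀ := fun k => nx₁.2.2 (P.fc.injective k)
        have d3 : P.fc.symm x₁ ≠ P.fc.symm x₀ := fun k => nx₁.2.2 (P.fc.symm.injective k)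
        exact L.not_crossed sx (eq_of_mem_pair a1 a2 a3 d1 d2) (eq_of_mem_pair a2 a1 a4 d1.symm d3)
      · push Not at hg
        obtain ⟨x, hx, hx0, hxg⟩ := hg
        have := L.sum_of_two_of_far h hfg hl hp hN s₁ s₂ k₁ k₂ l₁ l₂ hne only hf
          (L.pm_of_not_far h hlg hx hx0 hxg)
        omega
    · push Not at hf
      obtain ⟨x, hx, hx0, hxf⟩ := hf
      have pg := L.pm_of_not_far h hl hx hx0 hxf
      by_cases hg : ∀ x, P.side x = r → lo (t x) < 2 → Far x g
      · have := L.sum_of_two_of_far h hfg.symm hlg hpg hN s₁ s₂ k₁ k₂ l₁ l₂ hne only hg pg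
        omega
      · push Not at hg
        obtain ⟨x', hx', hx0', hxg⟩ := hg
        have pf := L.pm_of_not_far h hlg hx' hx0' hxg
        -- Both light edges have `m⁺` one and take six, so together with `y₁` and `y₂` the excess is
        -- four times two.
        have ef := el f hfl ((single_spec (L.sees f hfl.1).mem).2.2.1 pf).1
        have eg := el g hgl ((single_spec (L.sees g hgl.1).mem).2.2.1 pg).1
        have := L.le_sum (l := [f, g, y₁, y₂]) (by
          simp [hfg, hne, (ne_of k₁ hfl).symm, (ne_of k₂ hfl).symm, (ne_of k₁ hgl).symm,
            (ne_of k₂ hgl).symm]) (by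
          simp only [List.mem_cons, List.not_mem_nil, or_false]
          rintro x (rfl | rfl | rfl | rfl)
          exacts [hfl.1, hgl.1, s₁, s₂])
        simp only [List.map_cons, List.map_nil, List.sum_cons, List.sum_nil] at this
        have := e2 y₁ s₁ k₁ l₁
        have := e2 y₂ s₂ k₂ l₂
        omega
  · obtain ⟨z, hz⟩ : ∃ z, ∀ y, P.side y = r → (t y).heavy 3 = true → 2 ≤ lo (t y) → y = z := by
      by_cases hone : ∃ z, P.side z = r ∧ (t z).heavy 3 = true ∧ 2 ≤ lo (t z)
      · obtain ⟨z, sz, kz, lz⟩ := hone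
        refine ⟨z, fun y sy ky ly => ?_⟩
        by_contra hyz
        exact htwo ⟨y, z, sy, sz, ky, kz, ly, lz, hyz⟩
      · exact ⟨f, fun y sy ky ly => absurd ⟨y, sy, ky, ly⟩ hone⟩
    -- Among at least four heavy edges one is neither `z` nor next to it. It is cheap, and its
    -- neighbours, being neither cheap nor `z`, are `f` and `g`; no light edge is then far from it,
    -- against `conf15`.
    obtain ⟨x, hx, kx, nx⟩ := exists_heavy (t := t) (r := r) [z, P.fc z, P.fc.symm z]
      (by simp [hN]; omega)
    simp only [List.mem_cons, List.not_mem_nil, or_false, not_or] at nx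
    have hx0 : lo (t x) < 2 := by
      by_contra! k
      exact nx.1 (hz x hx kx k)
    have nb : ∀ y, y = P.fc x ∨ y = P.fc.symm x → y = f ∨ y = g := by
      intro y hy
      obtain ⟨sy, ly⟩ := nbr x hx hx0 y hy
      by_contra hno
      have hyz := hz y sy (heavy_of_not_light sy fun k => hno ((hl y).1 k)) ly
      subst hyz
      rcases hy with hy | hy
      · exact nx.2.2 (by rw [hy, Equiv.symm_apply_apply])
      · exact nx.2.1 (by rw [hy, Equiv.apply_symm_apply])
    have p5 := ((single_spec (L.sees x hx).mem).2.2.2.1 hx0).1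
    obtain ⟨b, hb, hbl⟩ := L.conf15 h hx (by omega)
    have d1 := fc_ne_fc_inv h x
    exact hb.2.2.2 (eq_of_mem_pair (nb _ (Or.inl rfl)) (nb _ (Or.inr rfl)) ((hl b).1 hbl) d1
      hb.2.2.1)

end LargeRegion

theorem Tri.of_side {d e : P.graph.Dart} (hd : Tri d) (h : P.side e = P.side d) : Tri e := by
  rcases hd.side_eq_iff.1 h with rfl | rfl | rfl
  exacts [hd, hd.fc, hd.fc.fc]

theorem Quad.of_side {d e : P.graph.Dart} (hd : Quad d) (h : P.side e = P.side d) : Quad e := by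
  rcases hd.side_eq_iff.1 h with rfl | rfl | rfl | rfl
  exacts [hd, hd.fc, hd.fc.fc, hd.fc.fc.fc]

theorem LargeRegion.sum_toll (L : LargeRegion m r t) (h : IsPrimeTarget P m) :
    16 ≤ ∑ d ∈ faceDarts r, toll m d := by
  classical
  by_cases h4 : 4 ≤ (lights r t).card
  · exact L.sum_of_four_le h4
  obtain h0 | h1 | h2 | h3 : (lights r t).card = 0 ∨ (lights r t).card = 1 ∨
      (lights r t).card = 2 ∨ (lights r t).card = 3 := by omega
  · rw [Finset.card_eq_zero] at h0
    exact L.sum_of_zero h fun d hd => by simpa [h0] using mem_lights.2 hd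
  · obtain ⟨f, hf⟩ := Finset.card_eq_one.1 h1
    refine L.sum_of_one h (c := P.fc.symm f) fun d => ?_
    rw [← mem_lights, hf, Finset.mem_singleton, Equiv.apply_symm_apply]
  · obtain ⟨f, g, hfg, hl⟩ := Finset.card_eq_two.1 h2
    refine L.sum_of_two h hfg fun d => ?_
    rw [← mem_lights, hl, Finset.mem_insert, Finset.mem_singleton]
  · exact L.sum_of_three h h3

/-- A region does not keep a positive charge. -/
theorem sixteen_le_sum_toll (h : IsPrimeTarget P m) (r : P.Region) :
    16 ≤ ∑ d ∈ faceDarts r, toll m d := by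
  by_cases hs : P.Big m r
  · exact big_region h hs
  obtain ⟨d, rfl⟩ := P.exists_side r
  by_cases h3 : Tri d
  · exact h3.sum_toll h hs
  by_cases h4 : Quad d
  · exact h4.sum_toll h hs
  obtain ⟨t, ht⟩ := exists_sees_all h hs
  exact LargeRegion.sum_toll ⟨hs, ht, fun e he k => h3 (k.of_side he.symm),
    fun e he k => h4 (k.of_side he.symm)⟩ h

end PlaneGraph

theorem mainTheorem2 {V : Type*} [Finite V] (P : PlaneGraph V) (m : Sym2 V → ℕ)
    (h : IsTarget 8 P m) : ¬ IsPrimeTarget P m := by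
  intro hp
  obtain ⟨r, hr⟩ := PlaneGraph.exists_positive_region h (PlaneGraph.beta m) (PlaneGraph.beta_symm m)
  have := PlaneGraph.sixteen_le_sum_toll hp r
  simp only [PlaneGraph.toll, PlaneGraph.faceDarts] at this
  omega
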